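/- **Setting.** Let $G$ be a finite multigraph without loops and coloops (an edge is a loop if it lies in no spanning tree, a coloop if it lies in every spanning tree) that is *triconed*: it has three distinct vertices $0,1,2$ (the *special* vertices; the others are *normal*) such that $1$ and $2$ are adjacent to $0$, no two parallel edges have an endpoint in $\{0,1,2\}$, and every normal vertex is adjacent to at least one of $0,1,2$. A vertex has *height 2* if it is different from $0$ and not adjacent to $0$. Order the vertices totally: $0<1<2$, then the remaining neighbours of $0$, then the remaining neighbours of $1$, then all others (in any order within each block). Order the edges totally: first the edges at $0$, then the edges joining $1$ to a vertex of height 2, then the edges joining $2$ to a vertex of height 2 not adjacent to $1$ (each of these three blocks ordered lexicographically), then all other edges in any order. Let $B_0$ be the lexicographically smallest spanning tree of $G$, rooted at $0$. A vertex has *type* $1$ if it is $1$ or a child of $1$ in $B_0$, type $2$ if it is $2$ or a child of $2$ in $B_0$, and type $0$ otherwise. **The map $\phi_1$.** For a spanning tree $B$ of $G$ let $F=B\setminus B_0$, regarded as a spanning forest on the vertices other than $0$. Put a usual mark on $1$, on $2$, and on the child of every edge of $B\cap B_0$ other than $01,02$. If $B$ contains $02$ and the path in $B$ from $2$ to $1$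 does not go through $02$, take the first edge of this path (starting at $2$) not in $B_0$ and put one extra mark on its endpoint closer to $2$ (this vertex is then *doubly marked*). The forest $F$ with these marks is $\phi_1(B)$. **The map $\phi_2$.** Each mark of $\phi_1(B)$ empowers at most one edge of $F$. Consider a component of $F$; it has one, two or three marks. * One mark, on $v$: if $x\neq v$ is the smallest vertex of the component, the mark empowers the edge at $v$ on the path from $v$ to $x$; if $v$ is the smallest vertex, it empowers nothing. * In components with two or three marks, the usual marks on $1$ and $2$ empower nothing, and every other mark empowers the edge described next. * Two marks, on $v$ and $w$: each mark empowers the edge of the path between $v$ and $w$ at its own end. * Three marks on distinct vertices, none of which lies on the path between the other two: each mark empowers the edge at its vertex in the smallest subtree containing the three vertices. * Otherwise, name the marks so that the vertex $z$ of one of them lies on the path between the vertices $v,w$ of the other two and $\mathrm{type}(v)<\mathrm{type}(w)$; if there is a doubly marked vertex, it is $w$, with the extra mark as the mark at $z=w$. The marks at $v$ and at $w$ empower the edges at the two ends of this path. The mark at $z$ empowers the first edge on the path from $z$ to $v$ whose endpoint closer to $v$ has type $\ne\mathrm{type}(w)$ and whose endpoint closer to $w$ has type $\neq\mathrm{type}(v)$.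 Each edge $e\in F$ gets the weight $\omega(e)=1+\#\{\text{marks empowering } e\}$, and $\phi(B)=\phi_2(\phi_1(B))$ is the monomial $\prod_{e\in F}x_e^{\omega(e)}$. **Proposition.** The image $X=\{\phi(B): B \text{ a spanning tree of } G\}$ is a pure order ideal: $X$ is a finite set of monomials closed under taking divisors, and all monomials of $X$ that are maximal with respect to divisibility have the same degree. (Equivalently, given that $X$ is finite, for the last part: every monomial of $X$ divides a monomial of $X$ of the largest degree occurring in $X$.) -/

import Mathlib

open scoped Graph

namespace Triconed

/-! ### Spanning trees of a multigraph -/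

section General

variable {α β : Type*}

/-- The adjacency relation given by a finite set `S` of edges of the multigraph `G`. -/
def edgeGraph (G : Graph α β) (S : Finset β) : SimpleGraph α where
  Adj x y := x ≠ y ∧ ∃ e ∈ S, G.IsLink e x y
  symm := ⟨fun _ _ h => ⟨h.1.symm, h.2.imp fun _ he => ⟨he.1, he.2.symm⟩⟩⟩
  loopless := ⟨fun _ h => h.1 rfl⟩

/-- `B` is (the edge set of) a spanning tree of `G`: it connects all vertices, and it is acyclic,
i.e. no edge of `B` has its two ends connected by the other edges of `B`
(this excludes loops and pairs of parallel edges as well). -/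
structure IsSpanningTree [DecidableEq β] (G : Graph α β) (B : Finset β) : Prop where
  subset : (B : Set β) ⊆ E(G)
  connected : ∀ x ∈ V(G), ∀ y ∈ V(G), (edgeGraph G B).Reachable x y
  acyclic : ∀ e ∈ B, ∀ x y, G.IsLink e x y → ¬ (edgeGraph G (B.erase e)).Reachable x y

/-- A loop is an edge contained in no spanning tree. -/
def IsLoop [DecidableEq β] (G : Graph α β) (e : β) : Prop :=
  e ∈ E(G) ∧ ∀ B, IsSpanningTree G B → e ∉ B

/-- A coloop is an edge contained in every spanning tree. -/
def IsColoop [DecidableEq β] (G : Graph α β) (e : β) : Prop :=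
  e ∈ E(G) ∧ ∀ B, IsSpanningTree G B → e ∈ B

/-- `B₀` is the lexicographically smallest spanning tree of `G`: for every other spanning tree `B`,
the smallest edge lying in exactly one of `B₀` and `B` lies in `B₀`. -/
def IsLexSmallestTree [LinearOrder β] (G : Graph α β) (B₀ : Finset β) : Prop :=
  IsSpanningTree G B₀ ∧
    ∀ B, IsSpanningTree G B → B ≠ B₀ → ∃ e ∈ B₀ \ B, ∀ f ∈ B \ B₀, e < f

/-! ### Order ideals of monomials

A monomial in variables indexed by `β` is its exponent vector `β →₀ ℕ`; divisibility is `≤`. -/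

/-- A finite collection of monomials which is closed under taking divisors. -/
def IsOrderIdeal (X : Set (β →₀ ℕ)) : Prop :=
  X.Finite ∧ ∀ M ∈ X, ∀ N, N ≤ M → N ∈ X

/-- An order ideal is pure if all its maximal monomials have the same degree. -/
def IsPureOrderIdeal (X : Set (β →₀ ℕ)) : Prop :=
  IsOrderIdeal X ∧
    ∀ M N, Maximal (· ∈ X) M → Maximal (· ∈ X) N → M.degree = N.degree

/-- `d` is the first dart along the walk `p` with the property `P`. -/
def IsFirstDart {H : SimpleGraph α} {x y : α} (p : H.Walk x y) (P : H.Dart → Prop)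
    (d : H.Dart) : Prop :=
  P d ∧ ∃ l₁ l₂, p.darts = l₁ ++ d :: l₂ ∧ ∀ d' ∈ l₁, ¬ P d'

end General

/-! ### Triconed graphs -/

section Classes

variable {α β : Type*} (G : Graph α β) (c : Fin 3 → α)

/-- The vertices of height 2: those different from `0` and not adjacent to `0`. -/
def IsHeightTwo (x : α) : Prop := x ∈ V(G) ∧ x ≠ c 0 ∧ ¬ G.Adj (c 0) x

open Classical in
/-- The block of a vertex in the vertex ordering: adjacent to `0`; otherwise adjacent to `1`;
otherwise. -/
noncomputable def vertexBlock (x : α) : ℕ :=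
  if G.Adj (c 0) x then 0 else if G.Adj (c 1) x then 1 else 2

open Classical in
/-- The block of an edge in the edge ordering: edges at `0`; edges joining `1` to a vertex of
height 2; edges joining `2` to a vertex of height 2 that is not adjacent to `1`; other edges. -/
noncomputable def edgeBlock (e : β) : ℕ :=
  if G.Inc e (c 0) then 0
  else if ∃ x, IsHeightTwo G c x ∧ G.IsLink e (c 1) x then 1
  else if ∃ x, IsHeightTwo G c x ∧ ¬ G.Adj (c 1) x ∧ G.IsLink e (c 2) x then 2
  else 3

end Classes

/-- A finite triconed graph without loops and coloops, with a choice of the special vertices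
`0 = c 0`, `1 = c 1`, `2 = c 2` and admissible total orders of its vertices and of its edges.
Parallel edges are allowed away from the special vertices. -/
structure TriconedGraph (α β : Type*) [LinearOrder α] [LinearOrder β] where
  graph : Graph α β
  c : Fin 3 → α
  finite_vertexSet : V(graph).Finite
  finite_edgeSet : E(graph).Finite
  /-- `1` and `2` are adjacent to `0`. -/
  adj_one : graph.Adj (c 0) (c 1)
  adj_two : graph.Adj (c 0) (c 2)
  /-- There are no parallel edges having a special vertex as an endpoint. -/
  no_parallel : ∀ i x e f, graph.IsLink e (c i) x → graph.IsLink f (c i) x → e = f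
  /-- Every other vertex is adjacent to a special vertex. -/
  dominated : ∀ x ∈ V(graph), (∀ i, x ≠ c i) → ∃ i, graph.Adj (c i) x
  no_loop : ∀ e, ¬ IsLoop graph e
  no_coloop : ∀ e, ¬ IsColoop graph e
  /-- Vertex ordering: `0 < 1 < 2`, then the remaining vertices, block by block. -/
  special_lt : StrictMono c
  lt_normal : ∀ x ∈ V(graph), (∀ i, x ≠ c i) → c 2 < x
  normal_lt : ∀ x ∈ V(graph), ∀ y ∈ V(graph), (∀ i, x ≠ c i) → (∀ i, y ≠ c i) →
    vertexBlock graph c x < vertexBlock graph c y → x < y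
  /-- Edge ordering: block by block, the first three blocks being ordered lexicographically.
  (All the edges of the block `i < 3` have `c i` as their smaller endpoint.) -/
  edge_lt : ∀ e ∈ E(graph), ∀ f ∈ E(graph), edgeBlock graph c e < edgeBlock graph c f → e < f
  edge_lex : ∀ (i : Fin 3) e f x y, edgeBlock graph c e = i → edgeBlock graph c f = i →
    graph.IsLink e (c i) x → graph.IsLink f (c i) y → x < y → e < f

/-! ### Marked forests -/

/-- A mark on a vertex: a usual mark, or the extra mark carried by a doubly marked vertex. -/
inductive Mark (α : Type*)
  | usual (v : α)
  | extra (v : α)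

/-- The vertex on which a mark lies. -/
def Mark.vertex {α : Type*} : Mark α → α
  | usual v => v
  | extra v => v

/-- A set of edges together with a set of marks on the vertices. -/
structure MarkedForest (α β : Type*) where
  edges : Finset β
  marks : Set (Mark α)

namespace TriconedGraph

variable {α β : Type*} [LinearOrder α] [LinearOrder β] (T : TriconedGraph α β) (B₀ : Finset β)

/-- The vertex `u` is the child of the edge `e` of `B₀`, and `v` is the other end of `e`, the
parent of `u`, where the tree `B₀` is rooted at the vertex `0`. -/
def IsConeEdge (e : β) (v u : α) : Prop :=
  e ∈ B₀ ∧ T.graph.IsLink e v u ∧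
    (edgeGraph T.graph B₀).dist (T.c 0) u = (edgeGraph T.graph B₀).dist (T.c 0) v + 1

/-- `u` is a child of `v` in the tree `B₀` rooted at `0`. -/
def IsChild (u v : α) : Prop := ∃ e, T.IsConeEdge B₀ e v u

open Classical in
/-- The type of a vertex: 1 for the vertex `1` and its children, 2 for the vertex `2` and its
children, and 0 otherwise. -/
noncomputable def vtype (x : α) : ℕ :=
  if x = T.c 1 ∨ T.IsChild B₀ x (T.c 1) then 1
  else if x = T.c 2 ∨ T.IsChild B₀ x (T.c 2) then 2
  else 0

/-! ### From spanning trees to marked forests -/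

/-- The vertex `u` gets a usual mark: it is `1` or `2`, or it is the child of an edge of `B ∩ B₀`
other than `01` and `02`. -/
def IsMarked (B : Finset β) (u : α) : Prop :=
  u = T.c 1 ∨ u = T.c 2 ∨
    ∃ e ∈ B ∩ B₀, ¬ T.graph.IsLink e (T.c 0) (T.c 1) ∧ ¬ T.graph.IsLink e (T.c 0) (T.c 2) ∧
      ∃ v, T.IsConeEdge B₀ e v u

/-- The vertex `u` gets an extra mark: `B` contains the edge `02`, there is a path in `B` from `2`
to `1` not going through `02`, and `u` is the endpoint closer to `2` of the first edge along this
path that is not in `B₀`. -/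
def IsDoublyMarked (B : Finset β) (u : α) : Prop :=
  (∃ e ∈ B, T.graph.IsLink e (T.c 0) (T.c 2)) ∧
    ∃ p : (edgeGraph T.graph B).Walk (T.c 2) (T.c 1), p.IsPath ∧ s(T.c 0, T.c 2) ∉ p.edges ∧
      ∃ d, IsFirstDart p (fun d => ∃ e ∈ B \ B₀, T.graph.IsLink e d.fst d.snd) d ∧ d.fst = u

/-- The map `φ₁`, sending a spanning tree `B` to the forest `B \ B₀` with marks. -/
def phi₁ (B : Finset β) : MarkedForest α β where
  edges := B \ B₀
  marks := {m | match m with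
    | .usual u => T.IsMarked B₀ B u
    | .extra u => T.IsDoublyMarked B₀ B u}

/-! ### From marked forests to weighted forests -/

section Weights

variable (F : MarkedForest α β)

/-- `z` lies on the path between `v` and `w` in the forest `F`. -/
def OnPath (v w z : α) : Prop :=
  ∃ p : (edgeGraph T.graph F.edges).Walk v w, p.IsPath ∧ z ∈ p.support

/-- `e` is the edge closest to `v` on the path between `v` and `w` in the forest `F`. -/
def IsEndEdge (v w : α) (e : β) : Prop :=
  ∃ p : (edgeGraph T.graph F.edges).Walk v w, p.IsPath ∧
    ∃ d l, p.darts = d :: l ∧ e ∈ F.edges ∧ T.graph.IsLink e d.fst d.snd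

/-- The marks of `F` in the component of the mark `m`. -/
def componentMarks (m : Mark α) : Set (Mark α) :=
  {m' ∈ F.marks | (edgeGraph T.graph F.edges).Reachable m.vertex m'.vertex}

/-- The usual marks on the special vertices `1` and `2` do not empower any edge in components of
degree at least 2; the marks on normal vertices and the extra mark do. -/
def MayEmpower : Mark α → Prop
  | .usual v => v ≠ T.c 1 ∧ v ≠ T.c 2
  | .extra _ => True

/-- `v`, `w`, `z` are the three different marks of a component of `F`. -/
structure IsTriple (v w z : Mark α) : Prop where
  ne₁ : v ≠ w
  ne₂ : v ≠ z
  ne₃ : w ≠ z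
  marks_eq : T.componentMarks F v = {v, w, z}

/-- `v`, `w`, `z` are the three marks of a component of `F`, and `z` is sandwiched by `v` and `w`:
it lies on the path between `v` and `w`, where `v` has smaller type than `w`. If the component
has a doubly marked vertex, then `z` is the extra mark. -/
structure IsSandwiched (v w : α) (z : Mark α) : Prop where
  triple : T.IsTriple F (.usual v) (.usual w) z
  type_lt : T.vtype B₀ v < T.vtype B₀ w
  onPath : T.OnPath F v w z.vertex

/-- `e` is the first edge along the path from `z` to `v` such that its endpoint closer to `v` has
a type different from that of `w`, and its endpoint closer to `w` has a type different from that
of `v`. -/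
def IsMiddleEdge (v w z : α) (e : β) : Prop :=
  ∃ p : (edgeGraph T.graph F.edges).Walk z v, p.IsPath ∧
    ∃ d, IsFirstDart p (fun d => T.vtype B₀ d.snd ≠ T.vtype B₀ w ∧
        T.vtype B₀ d.fst ≠ T.vtype B₀ v) d ∧
      e ∈ F.edges ∧ T.graph.IsLink e d.fst d.snd

/-- The mark `m` of `F` empowers the edge `e`. -/
inductive Empowers : Mark α → β → Prop
  /-- Components of degree 1, with smallest vertex `x`; nothing is empowered if the mark is
  on `x`. -/
  | one (m : Mark α) (x : α) (e : β) (hm : T.componentMarks F m = {m})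
      (hx : IsLeast {y | (edgeGraph T.graph F.edges).Reachable m.vertex y} x)
      (he : T.IsEndEdge F m.vertex x e) : Empowers m e
  /-- Components of degree 2. -/
  | two (m m' : Mark α) (e : β) (hne : m ≠ m') (hm : T.componentMarks F m = {m, m'})
      (hn : T.MayEmpower m) (he : T.IsEndEdge F m.vertex m'.vertex e) : Empowers m e
  /-- Components of degree 3, where the three marked vertices are leaves of the minimal tree
  containing them. -/
  | leaf (m v w : Mark α) (e : β) (h : T.IsTriple F m v w)
      (h₁ : ¬ T.OnPath F v.vertex w.vertex m.vertex)
      (h₂ : ¬ T.OnPath F m.vertex w.vertex v.vertex)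
      (h₃ : ¬ T.OnPath F m.vertex v.vertex w.vertex)
      (hn : T.MayEmpower m) (he : T.IsEndEdge F m.vertex v.vertex e) : Empowers m e
  /-- Components of degree 3 with a sandwiched mark `z`: the outer marks `v`, `w`, and `z`. -/
  | left (v w : α) (z : Mark α) (e : β) (h : T.IsSandwiched B₀ F v w z)
      (hn : T.MayEmpower (.usual v)) (he : T.IsEndEdge F v w e) : Empowers (.usual v) e
  | right (v w : α) (z : Mark α) (e : β) (h : T.IsSandwiched B₀ F v w z)
      (hn : T.MayEmpower (.usual w)) (he : T.IsEndEdge F w v e) : Empowers (.usual w) e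
  | middle (v w : α) (z : Mark α) (e : β) (h : T.IsSandwiched B₀ F v w z)
      (hn : T.MayEmpower z) (he : T.IsMiddleEdge B₀ F v w z.vertex e) : Empowers z e

open Classical in
/-- The map `φ₂`: the monomial of the weighted forest which has the same edges as `F`, each edge
having weight 1 plus the number of marks that empower it. -/
noncomputable def phi₂ : β →₀ ℕ :=
  Finsupp.onFinset F.edges
    (fun e => if e ∈ F.edges then 1 + {m ∈ F.marks | T.Empowers B₀ F m e}.ncard else 0)
    (fun _ h => by by_contra h'; exact h (if_neg h'))

end Weights

/-- The map `φ = φ₂ ∘ φ₁` from spanning trees to monomials. -/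
noncomputable def phi (B : Finset β) : β →₀ ℕ := T.phi₂ B₀ (T.phi₁ B₀ B)

/-- The image of `φ`. -/
def imagePhi : Set (β →₀ ℕ) := {M | ∃ B, IsSpanningTree T.graph B ∧ T.phi B₀ B = M}

end TriconedGraph

end Triconed

/-! The tree `B₀` is the breadth-first tree rooted at `0` (`eq_coneEdges`): every vertex other than
`0` hangs from one of `0`, `1`, `2`, and the type of a normal vertex names its parent. A normal
marked vertex of type `t` is therefore joined in `B` to the special vertex `t` by its own edge of
`B₀`, and a component of `F = B \ B₀` with marks of types `s` and `t` joins the special vertices `s`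
and `t`. As `B` has no cycle, the usual marks of a component have different types, two components
never carry the same two types, and three components never carry the pairs 01, 12, 02. Hence all
components have one mark except that either one component has three (possibly counting the extra
mark), or at most two components have two marks each, with different missing types.

The proof forgets the trees and keeps this description. `IsConfig` says that the weights on a forest
look like this for some position of the marks; `mem_imagePhi_iff` says that the monomials of the
image are exactly those admitting a forest of edges outside `B₀` on which they are positive and form
a configuration. One inclusion is `isConfig_phi`. For the other, `exists_phi_eq_of_isConfig` adds to
`F` the parent edges of the normal marks and a suitable subset of `{01, 02}`; the result connects
everything and has fewer than |V| edges, so it is a spanning tree. No injectivity of the map is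
needed. In a component with one mark only "at most one edge of weight two, none if there is a
special vertex" has to be remembered, since the mark is then recovered as the end of that edge away
from the smallest vertex.

Closure under division: lowering a weight that is at least two drops a mark of an exceptional
component (`IsConfig.sub_single`), and deleting an edge of weight one cuts a component and
distributes its marks (`IsConfig.erase`). The delicate case is a sandwiched mark. The rule for its
edge `ab` says that the end `a` away from `v` has a type other than that of `v`, and the end `b`
away from `w` a type other than that of `w`. So when `w` disappears the middle mark may be moved to
`a` and forms a legal pair with `v`, and likewise with `b` and `w`.

Purity: a maximal monomial has degree |V| - 1 (`IsValid.degree_of_maximal`). By maximality every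
component with one mark contains a special vertex or an edge of weight two, and there are exactly
two marks more than components other than `{0}`; otherwise some weight could be raised or an edge
added. The room to do so comes from the absence of coloops: every normal vertex has an edge outside
`B₀`, and some edge outside `B₀` leaves the set of vertices of type `1`, respectively `2`. Every
mark then contributes one to the weights, except those on `1` and `2`, so the excess weight equals
the number of components other than `{0}`; adding the number of edges of `F` gives |V| - 1. -/

namespace Triconed

/-! ### Connectivity by sets of edges -/

section Connectivity

variable {α β : Type*} {G : Graph α β} {S S' F : Finset β} {e f : β} {x y z a b c d : α}

/-- `x` and `y` are connected by edges in `S`. -/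
abbrev Conn (G : Graph α β) (S : Finset β) (x y : α) : Prop := (edgeGraph G S).Reachable x y

lemma Conn.refl (x : α) : Conn G S x x := SimpleGraph.Reachable.refl x

lemma Conn.mono (h : Conn G S x y) (hS : S ⊆ S') : Conn G S' x y :=
  SimpleGraph.Reachable.mono (G := edgeGraph G S) (G' := edgeGraph G S')
    (fun _ _ h => ⟨h.1, h.2.imp fun _ he => ⟨hS he.1, he.2⟩⟩) h

lemma conn_of_isLink (he : e ∈ S) (h : G.IsLink e x y) : Conn G S x y := by
  by_cases hxy : x = y
  · exact hxy ▸ Conn.refl x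
  · exact SimpleGraph.Adj.reachable (G := edgeGraph G S) ⟨hxy, e, he, h⟩

lemma Conn.induction {P : α → Prop} (h : Conn G S x y) (hx : P x)
    (step : ∀ e ∈ S, ∀ a b, G.IsLink e a b → Conn G S x a → P a → P b) : P y := by
  rw [Conn, SimpleGraph.reachable_iff_reflTransGen] at h
  induction h with
  | refl => exact hx
  | tail hab hbc ih =>
    obtain ⟨-, e, he, hl⟩ := hbc
    exact step e he _ _ hl (SimpleGraph.reachable_iff_reflTransGen _ _ |>.2 hab) ih

lemma Conn.mem_vertexSet (h : Conn G S x y) (hx : x ∈ V(G)) : y ∈ V(G) :=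
  h.induction hx fun _ _ _ _ hl _ _ => hl.right_mem

lemma Conn.eq_or_exists_isLink (h : Conn G S x y) (hxy : x ≠ y) :
    ∃ e ∈ S, ∃ z, z ≠ x ∧ G.IsLink e x z := by
  have := h.induction (P := fun y => y = x ∨ ∃ e ∈ S, ∃ z, z ≠ x ∧ G.IsLink e x z) (Or.inl rfl) ?_
  · exact this.resolve_left (Ne.symm hxy)
  · rintro e he a b hl - (rfl | h)
    · by_cases hb : b = a
      · exact Or.inl hb
      · exact Or.inr ⟨e, he, b, hb, hl⟩
    · exact Or.inr h

lemma Conn.exists_switch {P : α → Prop} (h : Conn G S x y) (hx : P x) (hy : ¬ P y) :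
    ∃ e ∈ S, ∃ a b, G.IsLink e a b ∧ Conn G S x a ∧ P a ∧ ¬ P b := by
  by_contra! hc
  exact hy (h.induction hx fun e he a b hl ha hPa => hc e he a b hl ha hPa)

/-- `z` lies between `x` and `y` in the forest `F`. -/
def Btw (G : Graph α β) (F : Finset β) (x y z : α) : Prop :=
  Conn G F x y ∧ ∀ S ⊆ F, Conn G S x y → Conn G S x z

lemma Btw.symm (h : Btw G F x y z) : Btw G F y x z :=
  ⟨h.1.symm, fun S hS hc => hc.trans (h.2 S hS hc.symm)⟩

lemma Btw.conn_left (h : Btw G F x y z) : Conn G F x z := h.2 F subset_rfl h.1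

lemma btw_left (h : Conn G F x y) : Btw G F x y x := ⟨h, fun _ _ _ => Conn.refl x⟩

lemma btw_right (h : Conn G F x y) : Btw G F x y y := ⟨h, fun _ _ h => h⟩

lemma Btw.trans_left (h : Btw G F x y z) (h' : Btw G F x z c) : Btw G F x y c :=
  ⟨h.1, fun S hS hc => h'.2 S hS (h.2 S hS hc)⟩

lemma Btw.trans_right (h : Btw G F x y z) (h' : Btw G F z y c) : Btw G F x y c :=
  (h.symm.trans_left h'.symm).symm

/-- Passing to a smaller forest is immediate because betweenness quantifies over all connecting
subsets and mentions no walk. The converse `Btw.mono` needs uniqueness of paths. -/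
lemma Btw.restrict (h : Btw G F x y z) (hS : S ⊆ F) (hc : Conn G S x y) : Btw G S x y z :=
  ⟨hc, fun _ hS' hc => h.2 _ (hS'.trans hS) hc⟩

variable [DecidableEq β]

/-- Induction along the walk: crossing `e` a second time returns to a vertex already reached without
`e`, so one crossing suffices. -/
lemma Conn.erase_cases (h : Conn G S x y) (hl : G.IsLink e a b) :
    Conn G (S.erase e) x y ∨ (Conn G (S.erase e) x a ∧ Conn G (S.erase e) b y) ∨
      (Conn G (S.erase e) x b ∧ Conn G (S.erase e) a y) := by
  refine h.induction (P := fun y => Conn G (S.erase e) x y ∨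
    (Conn G (S.erase e) x a ∧ Conn G (S.erase e) b y) ∨
      (Conn G (S.erase e) x b ∧ Conn G (S.erase e) a y)) (Or.inl (Conn.refl x)) ?_
  intro f hf c d hcd _ ih
  by_cases hfe : f = e
  · subst hfe
    rcases hl.eq_and_eq_or_eq_and_eq hcd with ⟨rfl, rfl⟩ | ⟨rfl, rfl⟩
    · rcases ih with h | ⟨h, -⟩ | ⟨h, -⟩
      · exact Or.inr (Or.inl ⟨h, Conn.refl _⟩)
      · exact Or.inr (Or.inl ⟨h, Conn.refl _⟩)
      · exact Or.inl h
    · rcases ih with h | ⟨h, -⟩ | ⟨h, -⟩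
      · exact Or.inr (Or.inr ⟨h, Conn.refl _⟩)
      · exact Or.inl h
      · exact Or.inr (Or.inr ⟨h, Conn.refl _⟩)
  · have hcd' := conn_of_isLink (S := S.erase e) (Finset.mem_erase.2 ⟨hfe, hf⟩) hcd
    rcases ih with h | ⟨h, h'⟩ | ⟨h, h'⟩
    · exact Or.inl (h.trans hcd')
    · exact Or.inr (Or.inl ⟨h, h'.trans hcd'⟩)
    · exact Or.inr (Or.inr ⟨h, h'.trans hcd'⟩)

lemma Conn.insert_cases (h : Conn G (insert e S) x y) (hl : G.IsLink e a b) :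
    Conn G S x y ∨ (Conn G S x a ∧ Conn G S b y) ∨ (Conn G S x b ∧ Conn G S a y) := by
  have hs : (insert e S).erase e ⊆ S := Finset.erase_insert_subset e S
  rcases h.erase_cases hl with h | ⟨h, h'⟩ | ⟨h, h'⟩
  · exact Or.inl (h.mono hs)
  · exact Or.inr (Or.inl ⟨h.mono hs, h'.mono hs⟩)
  · exact Or.inr (Or.inr ⟨h.mono hs, h'.mono hs⟩)

/-- No edge of `S` has its two ends connected by the other edges of `S`. -/
def IsForest (G : Graph α β) (S : Finset β) : Prop :=
  ∀ e ∈ S, ∀ x y, G.IsLink e x y → ¬ Conn G (S.erase e) x y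

lemma IsForest.subset (h : IsForest G S') (hS : S ⊆ S') : IsForest G S :=
  fun e he x y hl hc => h e (hS he) x y hl (hc.mono (Finset.erase_subset_erase e hS))

lemma IsForest.ne (h : IsForest G S) (he : e ∈ S) (hl : G.IsLink e x y) : x ≠ y := by
  rintro rfl
  exact h e he x x hl (Conn.refl x)

lemma IsForest.insert_edge (h : IsForest G S) (hl : G.IsLink e a b) (hab : ¬ Conn G S a b) :
    IsForest G (insert e S) := by
  have heS : e ∉ S := fun he => hab (conn_of_isLink he hl)
  intro f hf x y hxy hc
  by_cases hfe : f = e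
  · subst hfe
    rw [Finset.erase_insert heS] at hc
    rcases hl.eq_and_eq_or_eq_and_eq hxy with ⟨rfl, rfl⟩ | ⟨rfl, rfl⟩
    · exact hab hc
    · exact hab hc.symm
  · have hf' : f ∈ S := (Finset.mem_insert.1 hf).resolve_left hfe
    rw [Finset.erase_insert_of_ne (Ne.symm hfe)] at hc
    have hs := Finset.erase_subset f S
    rcases hc.insert_cases hl with h1 | ⟨h1, h2⟩ | ⟨h1, h2⟩
    · exact h f hf' x y hxy h1
    · exact hab ((h1.mono hs).symm.trans ((conn_of_isLink hf' hxy).trans (h2.mono hs).symm))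
    · exact hab ((h2.mono hs).trans ((conn_of_isLink hf' hxy).symm.trans (h1.mono hs)))

/-! ### Directed edges along paths of a forest -/

/-- The edge `e`, directed from `a` to `b`, lies on the path from `x` to `y` in the forest `F`. -/
structure OnDart (G : Graph α β) (F : Finset β) (x y : α) (e : β) (a b : α) : Prop where
  mem : e ∈ F
  isLink : G.IsLink e a b
  left : Conn G (F.erase e) x a
  right : Conn G (F.erase e) b y

lemma OnDart.conn (h : OnDart G F x y e a b) : Conn G F x y :=
  ((h.left.mono (Finset.erase_subset e F)).trans (conn_of_isLink h.mem h.isLink)).trans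
    (h.right.mono (Finset.erase_subset e F))

lemma OnDart.conn_left (h : OnDart G F x y e a b) : Conn G F x a :=
  h.left.mono (Finset.erase_subset e F)

lemma OnDart.conn_right (h : OnDart G F x y e a b) : Conn G F b y :=
  h.right.mono (Finset.erase_subset e F)

lemma OnDart.symm (h : OnDart G F x y e a b) : OnDart G F y x e b a :=
  ⟨h.mem, h.isLink.symm, h.right.symm, h.left.symm⟩

lemma OnDart.not_conn (hF : IsForest G F) (h : OnDart G F x y e a b) :
    ¬ Conn G (F.erase e) x y :=
  fun hc => hF e h.mem a b h.isLink (h.left.symm.trans (hc.trans h.right.symm))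

lemma onDart_of_not_conn (hc : Conn G F x y) (hl : G.IsLink e a b) (ha : Conn G (F.erase e) x a)
    (hxy : ¬ Conn G (F.erase e) x y) (he : e ∈ F) : OnDart G F x y e a b := by
  rcases hc.erase_cases hl with h | ⟨-, h⟩ | ⟨h, h'⟩
  · exact absurd h hxy
  · exact ⟨he, hl, ha, h⟩
  · exact absurd (ha.trans h') hxy

lemma exists_onDart_of_not_conn (hc : Conn G F x y) (hl : G.IsLink e a b)
    (hxy : ¬ Conn G (F.erase e) x y) (he : e ∈ F) :
    OnDart G F x y e a b ∨ OnDart G F x y e b a := by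
  rcases hc.erase_cases hl with h | ⟨h, h'⟩ | ⟨h, h'⟩
  · exact absurd h hxy
  · exact Or.inl ⟨he, hl, h, h'⟩
  · exact Or.inr ⟨he, hl.symm, h, h'⟩

lemma OnDart.mono (h : OnDart G S x y e a b) (hS : S ⊆ F) : OnDart G F x y e a b :=
  ⟨hS h.mem, h.isLink, h.left.mono (Finset.erase_subset_erase e hS),
    h.right.mono (Finset.erase_subset_erase e hS)⟩

/-- A set that joins `x` to `y` cannot miss `e`, which separates them, and cannot cross it
backwards, since this would join the ends of `e` without `e`. Thus positions on paths do not depend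
on the ambient forest. -/
lemma OnDart.restrict (hF : IsForest G F) (h : OnDart G F x y e a b) (hS : S ⊆ F)
    (hc : Conn G S x y) : OnDart G S x y e a b := by
  have he : e ∈ S := by
    by_contra he
    exact h.not_conn hF (hc.mono fun f hf => Finset.mem_erase.2 ⟨fun h => he (h ▸ hf), hS hf⟩)
  have hs := Finset.erase_subset_erase e hS
  rcases hc.erase_cases h.isLink with h1 | ⟨h1, h2⟩ | ⟨h1, h2⟩
  · exact absurd (h1.mono hs) (h.not_conn hF)
  · exact ⟨he, h.isLink, h1, h2⟩
  · exact absurd (h.left.symm.trans (h1.mono hs)) (hF e h.mem a b h.isLink)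

lemma OnDart.btw_left (hF : IsForest G F) (h : OnDart G F x y e a b) : Btw G F x y a :=
  ⟨h.conn, fun _ hS hc => (h.restrict hF hS hc).conn_left⟩

lemma OnDart.btw_right (hF : IsForest G F) (h : OnDart G F x y e a b) : Btw G F x y b :=
  (h.symm.btw_left hF).symm

/-- This is uniqueness of paths. An edge of `S` outside `S'` is not needed to join `x` to `y`,
because `S'` joins them without it; such edges are deleted one at a time. -/
lemma IsForest.conn_inter (hF : IsForest G F) (hS : S ⊆ F) (hS' : S' ⊆ F) (h : Conn G S x y)
    (h' : Conn G S' x y) : Conn G (S ∩ S') x y := by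
  induction hn : (S \ S').card generalizing S with
  | zero =>
    have : S ⊆ S' := Finset.sdiff_eq_empty_iff_subset.1 (Finset.card_eq_zero.1 hn)
    rwa [Finset.inter_eq_left.2 this]
  | succ n ih =>
    obtain ⟨f, hf⟩ : (S \ S').Nonempty := Finset.card_pos.1 (by omega)
    obtain ⟨hfS, hfS'⟩ := Finset.mem_sdiff.1 hf
    have hc : Conn G (S.erase f) x y := by
      by_contra hc
      by_cases hl : ∃ a b, G.IsLink f a b
      · obtain ⟨a, b, hl⟩ := hl
        have hs : S' ⊆ F.erase f := fun g hg =>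
          Finset.mem_erase.2 ⟨fun h => hfS' (h ▸ hg), hS' hg⟩
        rcases exists_onDart_of_not_conn h hl hc hfS with hd | hd
        · exact (hd.mono hS).not_conn hF (h'.mono hs)
        · exact (hd.mono hS).not_conn hF (h'.mono hs)
      -- An element of `S` without ends in `G` is never traversed.
      · refine hc (h.induction (Conn.refl x) fun g hg a b hab _ ha => ha.trans ?_)
        exact conn_of_isLink (Finset.mem_erase.2 ⟨fun h => hl ⟨a, b, h ▸ hab⟩, hg⟩) hab
    have := ih ((Finset.erase_subset f S).trans hS) hc (by
      rw [Finset.erase_sdiff_comm, Finset.card_erase_of_mem hf, hn]; rfl)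
    exact this.mono (Finset.inter_subset_inter_right (Finset.erase_subset f S))

lemma Btw.mono (hF : IsForest G F) (h : Btw G S x y z) (hS : S ⊆ F) : Btw G F x y z := by
  refine ⟨h.1.mono hS, fun S' hS' hc => ?_⟩
  have := hF.conn_inter hS hS' h.1 hc
  exact (h.2 _ Finset.inter_subset_left this).mono Finset.inter_subset_right

lemma OnDart.trans_left (hF : IsForest G F) (h : Btw G F x y z) (h' : OnDart G F x z e a b) :
    OnDart G F x y e a b :=
  onDart_of_not_conn h.1 h'.isLink h'.left
    (fun hc => h'.not_conn hF (h.2 _ (Finset.erase_subset e F) hc)) h'.mem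

lemma OnDart.trans_right (hF : IsForest G F) (h : Btw G F x y z) (h' : OnDart G F z y e a b) :
    OnDart G F x y e a b :=
  (h'.symm.trans_left hF h.symm).symm

lemma exists_minimal_conn (h : Conn G F x y) :
    ∃ S ⊆ F, Conn G S x y ∧ ∀ e ∈ S, ¬ Conn G (S.erase e) x y := by
  induction F using Finset.strongInduction with
  | H F ih =>
    by_cases hm : ∃ e ∈ F, Conn G (F.erase e) x y
    · obtain ⟨e, he, hc⟩ := hm
      obtain ⟨S, hS, h⟩ := ih _ (Finset.erase_ssubset he) hc
      exact ⟨S, hS.trans (Finset.erase_subset e F), h⟩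
    · push Not at hm
      exact ⟨F, subset_rfl, h, hm⟩

/-- In an inclusion-minimal connecting set every edge is indispensable, in particular one at `x`. -/
lemma exists_first_onDart (h : Conn G F x y) (hxy : x ≠ y) : ∃ e b, OnDart G F x y e x b := by
  obtain ⟨S, hS, hc, hmin⟩ := exists_minimal_conn h
  obtain ⟨e, he, b, -, hl⟩ := hc.eq_or_exists_isLink hxy
  rcases exists_onDart_of_not_conn hc hl (hmin e he) he with hd | hd
  · exact ⟨e, b, hd.mono hS⟩
  · exact absurd hd.right (hmin e he)

/-- The edge at the beginning of a path depends only on the direction of the path. -/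
lemma OnDart.first_of_btw (hF : IsForest G F) (h : OnDart G F x y e x b) (hz : Btw G F x y z)
    (hzx : z ≠ x) : OnDart G F x z e x b := by
  obtain ⟨f, c, hd⟩ := exists_first_onDart hz.conn_left hzx.symm
  have hd' := hd.trans_left hF hz
  by_cases hfe : f = e
  · subst hfe
    obtain rfl := hd.isLink.right_unique h.isLink
    exact hd
  · have h1 : Conn G (F.erase f) x b :=
      conn_of_isLink (Finset.mem_erase.2 ⟨Ne.symm hfe, h.mem⟩) h.isLink
    rcases h.right.erase_cases hd.isLink with h2 | ⟨h2, -⟩ | ⟨h2, h3⟩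
    · exact absurd (h1.trans (h2.mono (Finset.erase_subset_erase f (Finset.erase_subset e F))))
        (hd'.not_conn hF)
    · exact absurd (h2.mono (Finset.erase_subset f _)).symm (hF e h.mem x b h.isLink)
    · exact absurd (h3.mono (Finset.erase_subset f _)) (h.not_conn hF)

/-- If `f ≠ e`, the connection from `b` to `y` avoiding `e` either avoids `f` too, although `f`
separates `x` from `y`, or it passes through `f` and joins `b` to `x`, or `x` to `y`, without `e`.
-/
lemma OnDart.first_unique (hF : IsForest G F) (h : OnDart G F x y e x b)
    (h' : OnDart G F x y f x c) : e = f ∧ b = c := by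
  by_cases hfe : f = e
  · subst hfe
    exact ⟨rfl, h.isLink.right_unique h'.isLink⟩
  · have h1 : Conn G (F.erase f) x b :=
      conn_of_isLink (Finset.mem_erase.2 ⟨Ne.symm hfe, h.mem⟩) h.isLink
    rcases h.right.erase_cases h'.isLink with h2 | ⟨h2, -⟩ | ⟨h2, h3⟩
    · exact absurd (h1.trans (h2.mono (Finset.erase_subset_erase f (Finset.erase_subset e F))))
        (h'.not_conn hF)
    · exact absurd (h2.mono (Finset.erase_subset f _)).symm (hF e h.mem x b h.isLink)
    · exact absurd (h3.mono (Finset.erase_subset f _)) (h.not_conn hF)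

/-- If the paths from `x` to `y` and from `x` to `z` begin differently, then `x` lies between
`y` and `z`. -/
lemma btw_of_first_ne (hF : IsForest G F) (h : OnDart G F x y e x b) (h' : OnDart G F x z f x c)
    (hne : e ≠ f) : Btw G F y z x := by
  have h1 : ¬ Conn G (F.erase e) y z := by
    intro hc
    have hx : ¬ Conn G (F.erase e) x z := fun h2 => h.not_conn hF (h2.trans hc.symm)
    have := onDart_of_not_conn (h'.conn) h.isLink (Conn.refl x) hx h.mem
    exact hne (this.first_unique hF h').1
  have := onDart_of_not_conn (h.conn.symm.trans h'.conn) h.isLink.symm h.right.symm h1 h.mem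
  exact this.btw_right hF

/-- Deleting the first edge of the path keeps the rest of the path, so the induction on the forest
moves along the path until `P` fails. -/
lemma exists_onDart_switch (hF : IsForest G F) {P : α → Prop} (h : Conn G F x y) (hx : P x)
    (hy : ¬ P y) : ∃ e a b, OnDart G F x y e a b ∧ P a ∧ ¬ P b := by
  induction F using Finset.strongInduction generalizing x with
  | H F ih =>
    obtain ⟨e, b, hd⟩ := exists_first_onDart h (by rintro rfl; exact hy hx)
    by_cases hb : P b
    · have hs := Finset.erase_subset e F
      obtain ⟨f, c, d, hd', hP⟩ := ih _ (Finset.erase_ssubset hd.mem) (hF.subset hs) hd.right hb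
      exact ⟨f, c, d, (hd'.mono hs).trans_right hF (hd.btw_right hF), hP⟩
    · exact ⟨e, x, b, hd, hx, hb⟩

/-- `e` is the first edge along the path from `x` to `y` with the property `P`. -/
structure FirstDart (G : Graph α β) (F : Finset β) (x y : α) (P : α → α → Prop) (e : β)
    (a b : α) : Prop where
  dart : OnDart G F x y e a b
  prop : P a b
  first : ∀ f c d, OnDart G F x a f c d → ¬ P c d

/-- If an earlier edge has the property, deleting `e` preserves the path from `x` to `a`, and the
search continues there in a smaller forest. -/
lemma exists_firstDart (hF : IsForest G F) {P : α → α → Prop} (h : OnDart G F x y e a b)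
    (hP : P a b) : ∃ f c d, FirstDart G F x y P f c d := by
  induction F using Finset.strongInduction generalizing y e a b with
  | H F ih =>
    by_cases hf : ∀ f c d, OnDart G F x a f c d → ¬ P c d
    · exact ⟨e, a, b, h, hP, hf⟩
    · push Not at hf
      obtain ⟨f, c, d, hd, hPd⟩ := hf
      have hs := Finset.erase_subset e F
      obtain ⟨f', c', d', hd', hP', hf'⟩ := ih _ (Finset.erase_ssubset h.mem) (hF.subset hs)
        (hd.restrict hF hs h.left) hPd
      refine ⟨f', c', d', (hd'.mono hs).trans_left hF (h.btw_left hF), hP', fun g p q hg => ?_⟩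
      exact hf' g p q (hg.restrict hF hs hd'.conn_left)

lemma OnDart.not_self (hF : IsForest G F) : ¬ OnDart G F x x e a b :=
  fun h => h.not_conn hF (Conn.refl x)

lemma OnDart.cons_cases (hF : IsForest G F) (h : OnDart G F x y e x z)
    (hd : OnDart G F x y f a b) : (f = e ∧ a = x ∧ b = z) ∨ OnDart G F z y f a b := by
  by_cases hfe : f = e
  · subst hfe
    rcases h.isLink.eq_and_eq_or_eq_and_eq hd.isLink with ⟨rfl, rfl⟩ | ⟨rfl, rfl⟩
    · exact Or.inl ⟨rfl, rfl, rfl⟩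
    · exact absurd hd.left (hF f h.mem x z h.isLink)
  · refine Or.inr ⟨hd.mem, hd.isLink, ?_, hd.right⟩
    exact (conn_of_isLink (Finset.mem_erase.2 ⟨Ne.symm hfe, h.mem⟩) h.isLink).symm.trans hd.left

lemma OnDart.of_cons (hF : IsForest G F) (h : OnDart G F x y e x z)
    (hd : OnDart G F z y f a b) : OnDart G F x y f a b :=
  hd.trans_right hF (h.btw_right hF)

end Connectivity

/-! ### Paths in forests -/

section Paths

variable {α β : Type*} {G : Graph α β} {F : Finset β} {e f : β}
  {x y z u v w a b : α}

lemma Conn.exists_isPath (h : Conn G F x y) : ∃ p : (edgeGraph G F).Walk x y, p.IsPath := by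
  classical
  obtain ⟨p⟩ := h
  exact ⟨p.toPath, p.toPath.2⟩

variable [DecidableEq β]

lemma conn_erase_of_walk (q : (edgeGraph G F).Walk u y) (hx : x ∉ q.support)
    (hl : G.IsLink e x z) : Conn G (F.erase e) u y := by
  induction q with
  | nil => exact Conn.refl _
  | @cons u u' y h q ih =>
    rw [SimpleGraph.Walk.support_cons, List.mem_cons, not_or] at hx
    obtain ⟨-, f, hf, hfl⟩ := h
    refine (conn_of_isLink (Finset.mem_erase.2 ⟨?_, hf⟩) hfl).trans (ih hx.2)
    rintro rfl
    rcases hl.left_eq_or_eq hfl with rfl | rfl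
    · exact hx.1 rfl
    · exact hx.2 q.start_mem_support

lemma onDart_of_isPath_cons {h : (edgeGraph G F).Adj x z} {p : (edgeGraph G F).Walk z y}
    (hp : (SimpleGraph.Walk.cons h p).IsPath) (he : e ∈ F) (hl : G.IsLink e x z) :
    OnDart G F x y e x z :=
  ⟨he, hl, Conn.refl x, conn_erase_of_walk p ((SimpleGraph.Walk.cons_isPath_iff h p).1 hp).2 hl⟩

lemma OnDart.exists_mem_darts (hF : IsForest G F) (h : OnDart G F x y e a b)
    {p : (edgeGraph G F).Walk x y} (hp : p.IsPath) :
    ∃ d ∈ p.darts, d.fst = a ∧ d.snd = b := by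
  induction p with
  | nil => exact (OnDart.not_self hF h).elim
  | @cons x z y hxz p ih =>
    have h' := hxz
    obtain ⟨-, f, hf, hfl⟩ := h'
    rcases (onDart_of_isPath_cons hp hf hfl).cons_cases hF h with ⟨rfl, rfl, rfl⟩ | h
    · exact ⟨⟨(_, _), hxz⟩, by simp, rfl, rfl⟩
    · obtain ⟨d, hd, hd'⟩ := ih h ((SimpleGraph.Walk.cons_isPath_iff _ p).1 hp).1
      exact ⟨d, by simp [hd], hd'⟩

lemma btw_of_mem_support (hF : IsForest G F) {p : (edgeGraph G F).Walk x y} (hp : p.IsPath)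
    (hz : z ∈ p.support) : Btw G F x y z := by
  induction p with
  | nil =>
    obtain rfl : z = _ := by simpa using hz
    exact btw_left (Conn.refl _)
  | @cons x x' y h p ih =>
    rw [SimpleGraph.Walk.support_cons, List.mem_cons] at hz
    have h' := h
    obtain ⟨-, f, hf, hfl⟩ := h'
    have hd := onDart_of_isPath_cons hp hf hfl
    rcases hz with rfl | hz
    · exact btw_left hd.conn
    · exact (hd.btw_right hF).trans_right (ih ((SimpleGraph.Walk.cons_isPath_iff h p).1 hp).1 hz)

lemma Btw.mem_support (hF : IsForest G F) (h : Btw G F x y z)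
    {p : (edgeGraph G F).Walk x y} (hp : p.IsPath) : z ∈ p.support := by
  by_cases hzx : z = x
  · subst hzx
    exact p.start_mem_support
  · obtain ⟨e, a, he⟩ := exists_first_onDart h.conn_left.symm hzx
    obtain ⟨d, hd, -, rfl⟩ := (he.symm.trans_left hF h).exists_mem_darts hF hp
    exact p.dart_snd_mem_support_of_mem_darts hd

/-- With `FirstDart.exists_isFirstDart` this translates between the dart lists of walks, used in the
definitions of the marks and of the weights, and the walk-free notion used everywhere else. -/
lemma firstDart_of_isFirstDart (hF : IsForest G F) {p : (edgeGraph G F).Walk x y}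
    (hp : p.IsPath) {P : (edgeGraph G F).Dart → Prop} {Q : α → α → Prop}
    (hPQ : ∀ d, P d ↔ Q d.fst d.snd) {d : (edgeGraph G F).Dart} (hd : IsFirstDart p P d)
    (he : e ∈ F) (hl : G.IsLink e d.fst d.snd) : FirstDart G F x y Q e d.fst d.snd := by
  induction p with
  | nil =>
    obtain ⟨-, l₁, l₂, h, -⟩ := hd
    simp at h
  | @cons x z y h p ih =>
    obtain ⟨hPd, l₁, l₂, hl₁, hl₂⟩ := hd
    rw [SimpleGraph.Walk.darts_cons] at hl₁
    have h' := h
    obtain ⟨-, f, hf, hfl⟩ := h'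
    have hd₀ := onDart_of_isPath_cons hp hf hfl
    rcases l₁ with - | ⟨d₀, l₁⟩
    · obtain ⟨rfl, -⟩ : _ = d ∧ _ := by simpa using hl₁
      exact ⟨onDart_of_isPath_cons hp he hl, (hPQ _).1 hPd,
        fun f c d hd => absurd hd (OnDart.not_self hF)⟩
    · rw [List.cons_append, List.cons.injEq] at hl₁
      obtain ⟨rfl, hl₁⟩ := hl₁
      have ih' := ih ((SimpleGraph.Walk.cons_isPath_iff h p).1 hp).1
        ⟨hPd, l₁, l₂, hl₁, fun d' hd' => hl₂ d' (List.mem_cons_of_mem _ hd')⟩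
      have hdart := hd₀.of_cons hF ih'.dart
      refine ⟨hdart, ih'.prop, fun g c d' hg => ?_⟩
      have hne : d.fst ≠ x := by
        intro hx
        rw [hx] at hg
        exact OnDart.not_self hF hg
      rcases (hd₀.first_of_btw hF (hdart.btw_left hF) hne).cons_cases hF hg with
        ⟨-, rfl, rfl⟩ | hg
      · exact fun hQ => hl₂ _ List.mem_cons_self ((hPQ _).2 hQ)
      · exact ih'.first g c d' hg

lemma FirstDart.exists_isFirstDart (hF : IsForest G F) {p : (edgeGraph G F).Walk x y}
    (hp : p.IsPath) {P : (edgeGraph G F).Dart → Prop} {Q : α → α → Prop}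
    (hPQ : ∀ d, P d ↔ Q d.fst d.snd) (h : FirstDart G F x y Q e a b) :
    ∃ d, IsFirstDart p P d ∧ d.fst = a ∧ d.snd = b := by
  induction p with
  | nil => exact (OnDart.not_self hF h.dart).elim
  | @cons x z y hxz p ih =>
    have h' := hxz
    obtain ⟨-, f, hf, hfl⟩ := h'
    have hd₀ := onDart_of_isPath_cons hp hf hfl
    rcases hd₀.cons_cases hF h.dart with ⟨rfl, rfl, rfl⟩ | hd
    · exact ⟨⟨(_, _), hxz⟩, ⟨(hPQ _).2 h.prop, [], p.darts, by simp, by simp⟩, rfl, rfl⟩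
    · have hs := Finset.erase_subset f F
      have hne : a ≠ x := by
        rintro rfl
        exact hF f hf _ _ hfl (hd.restrict hF hs hd₀.right).conn_left.symm
      have hd₁ := hd₀.first_of_btw hF (h.dart.btw_left hF) hne
      obtain ⟨d, ⟨hPd, l₁, l₂, hl₁, hl₂⟩, hd'⟩ :=
        ih ((SimpleGraph.Walk.cons_isPath_iff _ p).1 hp).1
          ⟨hd, h.prop, fun g c d hg => h.first g c d (hd₁.of_cons hF hg)⟩
      refine ⟨d, ⟨hPd, ⟨(x, z), hxz⟩ :: l₁, l₂, by simp [hl₁], ?_⟩, hd'⟩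
      intro d' hd'
      rcases List.mem_cons.1 hd' with rfl | hd'
      · exact fun hP => h.first f x z hd₁ ((hPQ _).1 hP)
      · exact hl₂ d' hd'

end Paths

/-! ### Counting components -/

section Counting

variable {α β : Type*} [LinearOrder α] {G : Graph α β} {S F : Finset β}
  {V : Finset α} {e : β} {x y a b : α}

/-- `x` is the smallest vertex of its component. -/
def IsRoot (G : Graph α β) (S : Finset β) (x : α) : Prop := ∀ y, Conn G S x y → x ≤ y

open Classical in
/-- The smallest vertices of the components that lie in `V`. -/
noncomputable def roots (G : Graph α β) (V : Finset α) (S : Finset β) : Finset α :=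
  V.filter (IsRoot G S)

lemma mem_roots : x ∈ roots G V S ↔ x ∈ V ∧ IsRoot G S x := by
  classical
  simp [roots]

lemma IsRoot.eq (hx : IsRoot G S x) (hy : IsRoot G S y) (h : Conn G S x y) : x = y :=
  le_antisymm (hx y h) (hy x h.symm)

lemma exists_isRoot (hV : (V : Set α) = V(G)) (hx : x ∈ V) :
    ∃ r ∈ V, IsRoot G S r ∧ Conn G S x r := by
  classical
  have hmem : ∀ y, Conn G S x y → y ∈ V := fun y h => by
    have := h.mem_vertexSet (hV ▸ hx)
    exact Finset.mem_coe.1 (hV ▸ this)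
  have hne : (V.filter (Conn G S x)).Nonempty := ⟨x, Finset.mem_filter.2 ⟨hx, Conn.refl x⟩⟩
  obtain ⟨hr, hr'⟩ := Finset.mem_filter.1 (Finset.min'_mem _ hne)
  refine ⟨_, hr, fun y hy => Finset.min'_le _ _ ?_, hr'⟩
  exact Finset.mem_filter.2 ⟨hmem y (hr'.trans hy), hr'.trans hy⟩

variable [DecidableEq β]

/-- A new edge merges at most two components, and the only root that can be lost is the larger of
their two roots. -/
lemma card_roots_le (hV : (V : Set α) = V(G)) (S : Finset β) :
    V.card ≤ (roots G V S).card + S.card := by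
  classical
  induction S using Finset.induction_on with
  | empty =>
    rw [Finset.card_empty, add_zero]
    refine Finset.card_le_card fun x hx => mem_roots.2 ⟨hx, fun y hy => ?_⟩
    by_contra hlt
    obtain ⟨e, he, -⟩ := hy.eq_or_exists_isLink (by rintro rfl; exact hlt le_rfl)
    simp at he
  | insert e S he ih =>
    rw [Finset.card_insert_of_notMem he]
    by_cases hl : ∃ a b, G.IsLink e a b
    · obtain ⟨a, b, hl⟩ := hl
      obtain ⟨a₀, -, ha₀, haa⟩ := exists_isRoot (S := S) hV
        (Finset.mem_coe.1 (hV ▸ hl.left_mem))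
      obtain ⟨b₀, -, hb₀, hbb⟩ := exists_isRoot (S := S) hV
        (Finset.mem_coe.1 (hV ▸ hl.right_mem))
      have hsub : roots G V S ⊆ insert (max a₀ b₀) (roots G V (insert e S)) := by
        intro x hx
        obtain ⟨hxV, hx⟩ := mem_roots.1 hx
        by_contra hcon
        rw [Finset.mem_insert, not_or, mem_roots, not_and] at hcon
        obtain ⟨hne, hcon⟩ := hcon
        refine hcon hxV fun y hy => ?_
        rcases hy.insert_cases hl with h | ⟨h, h'⟩ | ⟨h, h'⟩
        · exact hx y h
        · obtain rfl := hx.eq ha₀ (h.trans haa)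
          have h1 := hb₀ y (hbb.symm.trans h')
          rcases le_total x b₀ with h2 | h2
          · exact h2.trans h1
          · exact absurd (max_eq_left h2).symm hne
        · obtain rfl := hx.eq hb₀ (h.trans hbb)
          have h1 := ha₀ y (haa.symm.trans h')
          rcases le_total x a₀ with h2 | h2
          · exact h2.trans h1
          · exact absurd (max_eq_right h2).symm hne
      have := (Finset.card_le_card hsub).trans (Finset.card_insert_le _ _)
      omega
    · have hsub : roots G V S ⊆ roots G V (insert e S) := by
        intro x hx
        obtain ⟨hxV, hx⟩ := mem_roots.1 hx
        refine mem_roots.2 ⟨hxV, fun y hy => hx y ?_⟩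
        refine hy.induction (Conn.refl x) fun f hf a b hab _ ha => ha.trans ?_
        rcases Finset.mem_insert.1 hf with rfl | hf
        · exact absurd ⟨a, b, hab⟩ hl
        · exact conn_of_isLink hf hab
      have := Finset.card_le_card hsub
      omega

/-- In a forest each edge merges two different components, so it destroys a root; this is the
inequality opposite to `card_roots_le`. -/
lemma IsForest.card_roots (hV : (V : Set α) = V(G)) (hF : IsForest G F) (hE : (F : Set β) ⊆ E(G)) :
    (roots G V F).card + F.card = V.card := by
  refine le_antisymm ?_ (card_roots_le hV F)
  induction F using Finset.induction_on with
  | empty => simpa using Finset.card_le_card fun x (hx : x ∈ roots G V ∅) => (mem_roots.1 hx).1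
  | insert e S he ih =>
    rw [Finset.card_insert_of_notMem he]
    have ih := ih (hF.subset (Finset.subset_insert e S))
      (subset_trans (Finset.coe_subset.2 (Finset.subset_insert e S)) hE)
    obtain ⟨a, b, hl⟩ := G.exists_isLink_of_mem_edgeSet (hE (Finset.mem_coe.2 (Finset.mem_insert_self e S)))
    have hab : ¬ Conn G S a b := by
      have := hF e (Finset.mem_insert_self e S) a b hl
      rwa [Finset.erase_insert he] at this
    obtain ⟨a₀, haV, ha₀, haa⟩ := exists_isRoot (S := S) hV
      (Finset.mem_coe.1 (hV ▸ hl.left_mem))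
    obtain ⟨b₀, hbV, hb₀, hbb⟩ := exists_isRoot (S := S) hV
      (Finset.mem_coe.1 (hV ▸ hl.right_mem))
    have hss := Finset.subset_insert e S
    have hab' : Conn G (insert e S) a₀ b₀ := ((haa.mono hss).symm.trans
      (conn_of_isLink (Finset.mem_insert_self e S) hl)).trans (hbb.mono hss)
    have hne : a₀ ≠ b₀ := by
      rintro rfl
      exact hab (haa.trans hbb.symm)
    have hsub : roots G V (insert e S) ⊆ roots G V S := fun x hx =>
      mem_roots.2 ⟨(mem_roots.1 hx).1, fun y hy => (mem_roots.1 hx).2 y (hy.mono hss)⟩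
    have hlt : (roots G V (insert e S)).card < (roots G V S).card := by
      refine Finset.card_lt_card ⟨hsub, fun h => ?_⟩
      have h1 := (mem_roots.1 (h (mem_roots.2 ⟨haV, ha₀⟩))).2 b₀ hab'
      have h2 := (mem_roots.1 (h (mem_roots.2 ⟨hbV, hb₀⟩))).2 a₀ hab'.symm
      exact hne (le_antisymm h1 h2)
    omega

/-- A redundant edge could be deleted without disconnecting anything; the remaining edges would be
too few to leave only one root. Spanning trees are recognised by this count. -/
lemma isForest_of_card (hV : (V : Set α) = V(G)) (hc : ∀ x ∈ V, ∀ y ∈ V, Conn G S x y)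
    (hcard : S.card < V.card) : IsForest G S := by
  intro e he x y hl hxy
  have hc' : ∀ x ∈ V, ∀ y ∈ V, Conn G (S.erase e) x y := by
    intro a ha b hb
    rcases (hc a ha b hb).erase_cases hl with h | ⟨h, h'⟩ | ⟨h, h'⟩
    · exact h
    · exact h.trans (hxy.trans h')
    · exact h.trans (hxy.symm.trans h')
  have h1 := card_roots_le hV (S.erase e)
  have h2 : (roots G V (S.erase e)).card ≤ 1 := Finset.card_le_one.2 fun a ha b hb =>
    (mem_roots.1 ha).2.eq (mem_roots.1 hb).2 (hc' a (mem_roots.1 ha).1 b (mem_roots.1 hb).1)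
  rw [Finset.card_erase_of_mem he] at h1
  have := Finset.card_pos.2 ⟨e, he⟩
  omega

end Counting

/-! ### Weighted components -/

section LocalDefs

variable {α β : Type*} [DecidableEq β] (G : Graph α β) (τ : α → ℕ) (sp : α → Prop)
  (F : Finset β) (M : β →₀ ℕ)

/-- The edge `e` has an end in the component of `u`. -/
def InComp (u : α) (e : β) : Prop := ∃ a b, G.IsLink e a b ∧ Conn G F u a

/-- In the component of `u`, the edge `e` has weight `1` plus its multiplicity in `m`. -/
def Weighted (u : α) (m : Multiset β) : Prop :=
  ∀ e ∈ F, InComp G F u e → M e = 1 + m.count e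

/-- `m` consists of the edge empowered by a mark on `v` in the direction of `w`. -/
def ToEdge (v w : α) (m : Multiset β) : Prop :=
  (sp v ∧ m = 0) ∨ (¬ sp v ∧ ∃ e b, OnDart G F v w e v b ∧ m = {e})

/-- The weights in the component of `u` are those of a component with one mark. -/
structure OneMark (u : α) : Prop where
  sp_unique : ∀ v w, sp v → sp w → Conn G F u v → Conn G F u w → v = w
  sp_le : ∀ v e, sp v → Conn G F u v → e ∈ F → InComp G F u e → M e ≤ 1
  le_two : ∀ e ∈ F, InComp G F u e → M e ≤ 2
  unique : ∀ e ∈ F, ∀ f ∈ F, InComp G F u e → InComp G F u f → 2 ≤ M e → 2 ≤ M f → e = f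

/-- The marks of a component lie on `v` and `w`, their types are not `r`, and they empower `mv` and
`mw`. -/
structure IsPairAt (v w : α) (mv mw : Multiset β) (r : ℕ) : Prop where
  conn : Conn G F v w
  ne : τ v ≠ τ w
  ne_left : τ v ≠ r
  ne_right : τ w ≠ r
  lt : r < 3
  sp_mem : ∀ x, sp x → Conn G F v x → x = v ∨ x = w
  left : ToEdge G sp F v w mv
  right : ToEdge G sp F w v mw

/-- The weights in the component of `u` are those of a component with two marks, whose types are
not `r`. -/
def TwoMarks (r : ℕ) (u : α) : Prop :=
  ∃ v w mv mw, Conn G F u v ∧ IsPairAt G τ sp F v w mv mw r ∧ Weighted G F M v (mv + mw)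

/-- The marks of a component lie on `v`, `w`, `z`, none of which lies between the two others unless
it is special, and they empower `mv`, `mw`, `mz`. -/
structure IsTripodAt (v w z : α) (mv mw mz : Multiset β) : Prop where
  conn₁ : Conn G F v w
  conn₂ : Conn G F v z
  ne₁ : τ v ≠ τ w
  ne₂ : τ w ≠ τ z
  ne₃ : τ z ≠ τ v
  sp_mem : ∀ x, sp x → Conn G F v x → x = v ∨ x = w ∨ x = z
  toEdge₁ : ToEdge G sp F v w mv
  toEdge₂ : ToEdge G sp F w z mw
  toEdge₃ : ToEdge G sp F z v mz
  leaf₁ : sp v ∨ ¬ Btw G F w z v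
  leaf₂ : sp w ∨ ¬ Btw G F z v w
  leaf₃ : sp z ∨ ¬ Btw G F v w z

/-- The marks of a component lie on `v`, `w`, `z`, where `z` is normal and lies between `v` and `w`
or is the extra mark on `w`, and they empower `mv`, `mw` and `e`. -/
structure IsSandwichAt (v w z : α) (mv mw : Multiset β) (e : β) (a b : α) : Prop where
  lt : τ v < τ w
  btw : Btw G F v w z
  mid : (¬ sp z ∧ τ z ≠ τ v ∧ τ z ≠ τ w) ∨ (z = w ∧ τ v = 1 ∧ τ w = 2)
  sp_mem : ∀ x, sp x → Conn G F v x → x = v ∨ x = w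
  left : ToEdge G sp F v w mv
  right : ToEdge G sp F w v mw
  first : FirstDart G F z v (fun a b => τ b ≠ τ w ∧ τ a ≠ τ v) e a b

/-- The weights in the component of `u` are those of a component with three marks. -/
def ThreeMarks (u : α) : Prop :=
  (∃ v w z mv mw mz, Conn G F u v ∧ IsTripodAt G τ sp F v w z mv mw mz ∧
    Weighted G F M v (mv + mw + mz)) ∨
  (∃ v w z mv mw e a b, Conn G F u v ∧ IsSandwichAt G τ sp F v w z mv mw e a b ∧
    Weighted G F M v (mv + mw + {e}))

/-- The weights in the component of `u` are those of a component with one mark, or with two marks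
whose types are not `r`. -/
def OneOrTwo (r : ℕ) (u : α) : Prop := OneMark G sp F M u ∨ TwoMarks G τ sp F M r u

/-- The weights are those of the components of a marked forest that comes from a spanning tree. -/
def IsConfig : Prop :=
  (∃ u, ThreeMarks G τ sp F M u ∧ ∀ x, ¬ Conn G F u x → OneMark G sp F M x) ∨
  (∃ u u' r r', r ≠ r' ∧ OneOrTwo G τ sp F M r u ∧
    (Conn G F u u' ∨ OneOrTwo G τ sp F M r' u') ∧
    ∀ x, ¬ Conn G F u x → ¬ Conn G F u' x → OneMark G sp F M x)

end LocalDefs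

/-! ### Restricting and moving the marks of a single component -/

section LocalLemmas

variable {α β : Type*} [DecidableEq β] {G : Graph α β} {τ : α → ℕ} {sp : α → Prop}
  {F F' : Finset β} {M M' : β →₀ ℕ} {u v w x y z a b c : α} {e f : β} {m m' mv mw mz : Multiset β}
  {r : ℕ}

omit [DecidableEq β] in
lemma InComp.mono (h : InComp G F' x e) (hF : F' ⊆ F) (hx : Conn G F u x) : InComp G F u e := by
  obtain ⟨a, b, hl, h⟩ := h
  exact ⟨a, b, hl, hx.trans (h.mono hF)⟩

omit [DecidableEq β] in
lemma InComp.trans (h : InComp G F x e) (hx : Conn G F u x) : InComp G F u e :=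
  h.mono subset_rfl hx

omit [DecidableEq β] in
lemma InComp.conn_of_isLink (h : InComp G F x e) (he : e ∈ F) (hl : G.IsLink e a b) :
    Conn G F x a := by
  obtain ⟨c, d, hl', h⟩ := h
  rcases hl.eq_and_eq_or_eq_and_eq hl' with ⟨rfl, rfl⟩ | ⟨rfl, rfl⟩
  · exact h
  · exact h.trans (Triconed.conn_of_isLink he hl')

omit [DecidableEq β] in
lemma InComp.conn (h : InComp G F x e) (h' : InComp G F y e) (he : e ∈ F) : Conn G F x y := by
  obtain ⟨a, b, hl, hc⟩ := h
  exact hc.trans (h'.conn_of_isLink he hl).symm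

lemma OnDart.inComp (h : OnDart G F x y e a b) : InComp G F x e := ⟨a, b, h.isLink, h.conn_left⟩

lemma Weighted.restrict (h : Weighted G F M v m) (hF : F' ⊆ F) (hM : ∀ f ∈ F', M' f = M f)
    (hx : Conn G F v x) : Weighted G F' M' x m :=
  fun f hf hc => (hM f hf).trans (h f (hF hf) (hc.mono hF hx))

lemma Weighted.of_conn (h : Weighted G F M v m) (hx : Conn G F v x) : Weighted G F M x m :=
  h.restrict subset_rfl (fun _ _ => rfl) hx

lemma Weighted.drop (h : Weighted G F M v (m + m')) (hm : ∀ f ∈ m', ¬ InComp G F v f) :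
    Weighted G F M v m := by
  intro f hf hc
  rw [h f hf hc, Multiset.count_add, Multiset.count_eq_zero_of_notMem fun hf => hm f hf hc,
    add_zero]

lemma Weighted.oneMark (h : Weighted G F M v m) (hm : m.card ≤ 1)
    (hs : ∀ x, sp x → Conn G F v x → m = 0)
    (hu : ∀ x y, sp x → sp y → Conn G F v x → Conn G F v y → x = y) : OneMark G sp F M v where
  sp_unique := hu
  sp_le x e hx hc he hi := by
    rw [h e he hi, hs x hx hc]
    simp
  le_two e he hi := by
    rw [h e he hi]
    have := Multiset.count_le_card e m
    omega
  unique e he f hf hie hif h2e h2f := by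
    rw [h e he hie] at h2e
    rw [h f hf hif] at h2f
    have h1 : e ∈ m := Multiset.count_pos.1 (by omega)
    have h2 : f ∈ m := Multiset.count_pos.1 (by omega)
    obtain ⟨g, rfl⟩ := Multiset.card_eq_one.1
      (le_antisymm hm (Multiset.card_pos_iff_exists_mem.2 ⟨e, h1⟩))
    rw [Multiset.mem_singleton] at h1 h2
    exact h1.trans h2.symm

omit [DecidableEq β] in
lemma OneMark.mono (h : OneMark G sp F M v) (hF : F' ⊆ F) (hM : ∀ f, M' f ≤ M f)
    (hx : Conn G F v x) : OneMark G sp F' M' x where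
  sp_unique a b ha hb hca hcb := h.sp_unique a b ha hb (hx.trans (hca.mono hF))
    (hx.trans (hcb.mono hF))
  sp_le a e ha hc he hi := (hM e).trans
    (h.sp_le a e ha (hx.trans (hc.mono hF)) (hF he) (hi.mono hF hx))
  le_two e he hi := (hM e).trans (h.le_two e (hF he) (hi.mono hF hx))
  unique e he f hf hie hif h2e h2f := h.unique e (hF he) f (hF hf) (hie.mono hF hx)
    (hif.mono hF hx) (h2e.trans (hM e)) (h2f.trans (hM f))

lemma ToEdge.card_le (h : ToEdge G sp F v w m) : m.card ≤ 1 := by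
  rcases h with ⟨-, rfl⟩ | ⟨-, e, b, -, rfl⟩ <;> simp

lemma ToEdge.eq_zero (h : ToEdge G sp F v w m) (hv : sp v) : m = 0 := by
  rcases h with ⟨-, rfl⟩ | ⟨hv', -⟩
  · rfl
  · exact absurd hv hv'

lemma ToEdge.not_sp (h : ToEdge G sp F v w m) (he : e ∈ m) : ¬ sp v := by
  intro hv
  simp [h.eq_zero hv] at he

lemma ToEdge.eq_singleton (h : ToEdge G sp F v w m) (he : e ∈ m) : m = {e} := by
  rcases h with ⟨-, rfl⟩ | ⟨-, f, b, -, rfl⟩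
  · simp at he
  · rw [Multiset.mem_singleton.1 he]

lemma ToEdge.exists_isLink (h : ToEdge G sp F v w m) (he : e ∈ m) :
    e ∈ F ∧ ∃ b, G.IsLink e v b := by
  rcases h with ⟨-, rfl⟩ | ⟨-, f, b, hd, rfl⟩
  · simp at he
  · rw [Multiset.mem_singleton.1 he]
    exact ⟨hd.mem, b, hd.isLink⟩

lemma ToEdge.inComp (h : ToEdge G sp F v w m) (he : e ∈ m) (F' : Finset β) :
    InComp G F' v e := by
  obtain ⟨-, b, hl⟩ := h.exists_isLink he
  exact ⟨v, b, hl, Conn.refl v⟩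

lemma ToEdge.restrict (hF : IsForest G F) (h : ToEdge G sp F v w m) (hS : F' ⊆ F)
    (hc : Conn G F' v w) : ToEdge G sp F' v w m :=
  h.imp id fun ⟨hv, e, b, hd, hm⟩ => ⟨hv, e, b, hd.restrict hF hS hc, hm⟩

lemma ToEdge.mono (h : ToEdge G sp F' v w m) (hS : F' ⊆ F) : ToEdge G sp F v w m :=
  h.imp id fun ⟨hv, e, b, hd, hm⟩ => ⟨hv, e, b, hd.mono hS, hm⟩

lemma ToEdge.of_btw (hF : IsForest G F) (h : ToEdge G sp F v w m) (hz : Btw G F v w z)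
    (hzv : z ≠ v) : ToEdge G sp F v z m :=
  h.imp id fun ⟨hv, e, b, hd, hm⟩ => ⟨hv, e, b, hd.first_of_btw hF hz hzv, hm⟩

lemma ToEdge.to_btw (hF : IsForest G F) (h : ToEdge G sp F v z m) (hz : Btw G F v w z) :
    ToEdge G sp F v w m :=
  h.imp id fun ⟨hv, e, b, hd, hm⟩ => ⟨hv, e, b, hd.trans_left hF hz, hm⟩

/-- If the paths from `v` to `w` and to `z` began with different edges, `v` would lie between `w`
and `z`. So at a leaf the empowered edge does not depend on which of the other marks is aimed at. -/
lemma ToEdge.of_not_btw (hF : IsForest G F) (h : ToEdge G sp F v w m) (hz : Conn G F v z)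
    (hzv : z ≠ v) (hb : sp v ∨ ¬ Btw G F w z v) : ToEdge G sp F v z m := by
  refine h.imp id fun ⟨hv, e, b, hd, hm⟩ => ⟨hv, ?_⟩
  obtain ⟨f, c, hd'⟩ := exists_first_onDart hz hzv.symm
  by_cases hfe : e = f
  · exact ⟨f, c, hd', hfe ▸ hm⟩
  · exact absurd (btw_of_first_ne hF hd hd' hfe) (hb.resolve_left hv)

lemma IsPairAt.symm (h : IsPairAt G τ sp F v w mv mw r) : IsPairAt G τ sp F w v mw mv r :=
  ⟨h.conn.symm, h.ne.symm, h.ne_right, h.ne_left, h.lt,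
    fun x hx hc => (h.sp_mem x hx (h.conn.trans hc)).symm, h.right, h.left⟩

lemma IsTripodAt.rotate (h : IsTripodAt G τ sp F v w z mv mw mz) :
    IsTripodAt G τ sp F w z v mw mz mv :=
  ⟨h.conn₁.symm.trans h.conn₂, h.conn₁.symm, h.ne₂, h.ne₃, h.ne₁,
    fun x hx hc => by
      rcases h.sp_mem x hx (h.conn₁.trans hc) with h | h | h
      exacts [.inr (.inr h), .inl h, .inr (.inl h)],
    h.toEdge₂, h.toEdge₃, h.toEdge₁, h.leaf₂, h.leaf₃, h.leaf₁⟩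

/-- The mark at `v` is forgotten. The edge of `z` was defined by aiming at `v`, but `z` is special
or a leaf, so the same edge aims at `w`. If `v` is special it cannot be forgotten unless it is cut
off, whence the hypothesis on `v`. -/
lemma IsTripodAt.isPairAt (hF : IsForest G F) (hτ : ∀ x, τ x < 3)
    (h : IsTripodAt G τ sp F v w z mv mw mz)
    (hS : F' ⊆ F) (hc : Conn G F' w z) (hv : sp v → ¬ Conn G F' w v) :
    IsPairAt G τ sp F' w z mw mz (τ v) where
  conn := hc
  ne := h.ne₂
  ne_left := h.ne₁.symm
  ne_right := h.ne₃
  lt := hτ v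
  sp_mem x hx hcx := by
    rcases h.sp_mem x hx (h.conn₁.trans (hcx.mono hS)) with rfl | h | h
    exacts [absurd hcx (hv hx), .inl h, .inr h]
  left := h.toEdge₂.restrict hF hS hc
  right := (h.toEdge₃.of_not_btw hF (hc.mono hS).symm (fun h' => h.ne₂ (h' ▸ rfl))
    h.leaf₃).restrict hF hS hc.symm

lemma exists_third (hτ : ∀ x, τ x < 3) (v w : α) : ∃ r < 3, τ v ≠ r ∧ τ w ≠ r := by
  have := hτ v
  have := hτ w
  by_contra! h
  have h0 := h 0
  have h1 := h 1
  have h2 := h 2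
  omega

lemma IsSandwichAt.dart (hF : IsForest G F) (h : IsSandwichAt G τ sp F v w z mv mw e a b) :
    OnDart G F w v e a b :=
  h.first.dart.trans_right hF h.btw.symm

/-- Here half of the rule for the middle edge is used: its end `a` away from `v` has a type other
than that of `v`. Once `w` is dropped or cut off, the middle mark is moved to `a`, where it empowers
the same edge. -/
lemma IsSandwichAt.isPairAt_left (hF : IsForest G F) (hτ : ∀ x, τ x < 3)
    (h : IsSandwichAt G τ sp F v w z mv mw e a b) (hS : F' ⊆ F) (hc : Conn G F' v a)
    (hw : sp w → ¬ Conn G F' v w) : ∃ r, IsPairAt G τ sp F' v a mv {e} r := by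
  obtain ⟨r, hr, hr'⟩ := exists_third hτ v a
  have hd := h.dart hF
  have hav : a ≠ v := by
    rintro rfl
    exact h.first.prop.2 rfl
  refine ⟨r, hc, h.first.prop.2.symm, hr'.1, hr'.2, hr, fun x hx hcx => ?_, ?_, ?_⟩
  · rcases h.sp_mem x hx (hcx.mono hS) with rfl | rfl
    exacts [.inl rfl, absurd hcx (hw hx)]
  · exact (h.left.of_btw hF (hd.btw_left hF).symm hav).restrict hF hS hc
  · refine Or.inr ⟨fun ha => ?_, e, b, ?_, rfl⟩
    · rcases h.sp_mem a ha (hc.mono hS) with rfl | rfl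
      exacts [hav rfl, hw ha hc]
    · exact OnDart.restrict hF ⟨hd.mem, hd.isLink, Conn.refl a, hd.right⟩ hS hc.symm

/-- The other half of the rule: the end `b` away from `w` has a type other than that of `w`, so the
middle mark can be moved to `b` when `v` disappears. -/
lemma IsSandwichAt.isPairAt_right (hF : IsForest G F) (hτ : ∀ x, τ x < 3)
    (h : IsSandwichAt G τ sp F v w z mv mw e a b) (hS : F' ⊆ F) (hc : Conn G F' w b)
    (hv : sp v → ¬ Conn G F' w v) : ∃ r, IsPairAt G τ sp F' w b mw {e} r := by
  obtain ⟨r, hr, hr'⟩ := exists_third hτ w b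
  have hd := h.dart hF
  have hbw : b ≠ w := by
    rintro rfl
    exact h.first.prop.1 rfl
  refine ⟨r, hc, h.first.prop.1.symm, hr'.1, hr'.2, hr, fun x hx hcx => ?_, ?_, ?_⟩
  · rcases h.sp_mem x hx (h.btw.1.trans (hcx.mono hS)) with rfl | rfl
    exacts [absurd hcx (hv hx), .inl rfl]
  · exact (h.right.of_btw hF (hd.btw_right hF) hbw).restrict hF hS hc
  · refine Or.inr ⟨fun hb => ?_, e, a, ?_, rfl⟩
    · rcases h.sp_mem b hb (h.btw.1.trans (hc.mono hS)) with rfl | rfl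
      exacts [hv hb hc, hbw rfl]
    · exact OnDart.restrict hF ⟨hd.mem, hd.isLink.symm, Conn.refl b, hd.left.symm⟩ hS hc.symm

lemma FirstDart.restrict (hF : IsForest G F) {P : α → α → Prop} (h : FirstDart G F x y P e a b)
    (hS : F' ⊆ F) (hc : Conn G F' x y) : FirstDart G F' x y P e a b :=
  ⟨h.dart.restrict hF hS hc, h.prop, fun f c d hd => h.first f c d (hd.mono hS)⟩

end LocalLemmas

/-! ### Dividing by a variable -/

section Closure

variable {α β : Type*} [DecidableEq β] {G : Graph α β} {τ : α → ℕ} {sp : α → Prop}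
  {F F' : Finset β} {M M' : β →₀ ℕ} {u v w x y z a b c : α} {e f : β} {m m' mv mw mz : Multiset β}
  {r : ℕ}

lemma Weighted.sub_single (h : Weighted G F M v (m + {e})) :
    Weighted G F (M - Finsupp.single e 1) v m := by
  intro f hf hc
  rw [Finsupp.tsub_apply, h f hf hc, Multiset.count_add, Multiset.count_singleton]
  by_cases hfe : f = e
  · subst hfe
    simp [add_comm]
  · simp [hfe]

lemma Weighted.sub_single_of_not_inComp (h : Weighted G F M v m) (he : ¬ InComp G F v e) :
    Weighted G F (M - Finsupp.single e 1) v m := by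
  intro f hf hc
  have hfe : e ≠ f := by
    rintro rfl
    exact he hc
  rw [Finsupp.tsub_apply, h f hf hc, Finsupp.single_eq_of_ne' hfe]
  rfl

lemma Weighted.mem (h : Weighted G F M v m) (he : e ∈ F) (hi : InComp G F v e) (h2 : 2 ≤ M e) :
    e ∈ m := by
  rw [h e he hi] at h2
  exact Multiset.count_pos.1 (by omega)

lemma IsPairAt.eq_of_sp (h : IsPairAt G τ sp F v w mv mw r) (hx : sp x) (hc : Conn G F v x) :
    (x = v ∧ mv = 0) ∨ (x = w ∧ mw = 0) := by
  rcases h.sp_mem x hx hc with rfl | rfl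
  · exact Or.inl ⟨rfl, h.left.eq_zero hx⟩
  · exact Or.inr ⟨rfl, h.right.eq_zero hx⟩

/-- Lowering a weight in a component with two marks. -/
lemma TwoMarks.oneMark_sub_single (h : TwoMarks G τ sp F M r u) (he : e ∈ F)
    (hi : InComp G F u e) (h2 : 2 ≤ M e) (hc : Conn G F u x) :
    OneMark G sp F (M - Finsupp.single e 1) x := by
  obtain ⟨v, w, mv, mw, huv, hp, hw⟩ := h
  have hem := hw.mem he (hi.trans huv.symm) h2
  have hvx := huv.symm.trans hc
  have hpos : 0 < (mv + mw).card := Multiset.card_pos_iff_exists_mem.2 ⟨e, hem⟩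
  obtain ⟨m, hm⟩ := Multiset.exists_cons_of_mem hem
  rw [hm, ← Multiset.singleton_add, add_comm] at hw
  have hcard := congrArg Multiset.card hm
  rw [Multiset.card_cons, Multiset.card_add] at hcard
  have h1 := hp.left.card_le
  have h2 := hp.right.card_le
  refine (hw.sub_single.of_conn hvx).oneMark (by omega) (fun y hy hcy => ?_)
    fun y y' hy hy' hcy hcy' => ?_
  · refine Multiset.card_eq_zero.1 ?_
    rcases hp.eq_of_sp hy (hvx.trans hcy) with ⟨-, h0⟩ | ⟨-, h0⟩
    · rw [h0, Multiset.card_zero] at hcard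
      omega
    · rw [h0, Multiset.card_zero] at hcard
      omega
  · rcases hp.eq_of_sp hy (hvx.trans hcy) with ⟨rfl, h0⟩ | ⟨rfl, h0⟩ <;>
      rcases hp.eq_of_sp hy' (hvx.trans hcy') with ⟨rfl, h0'⟩ | ⟨rfl, h0'⟩
    · rfl
    · simp [h0, h0'] at hem
    · simp [h0, h0'] at hem
    · rfl

lemma IsTripodAt.twoMarks_sub_single (hF : IsForest G F) (hτ : ∀ x, τ x < 3)
    (h : IsTripodAt G τ sp F v w z mv mw mz) (hw : Weighted G F M v (mv + mw + mz))
    (he : e ∈ mv) : ∃ r, TwoMarks G τ sp F (M - Finsupp.single e 1) r w := by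
  refine ⟨τ v, w, z, mw, mz, Conn.refl w, h.isPairAt hF hτ subset_rfl (h.conn₁.symm.trans h.conn₂)
    fun hv => absurd hv (h.toEdge₁.not_sp he), ?_⟩
  rw [h.toEdge₁.eq_singleton he, add_assoc, add_comm] at hw
  exact hw.sub_single.of_conn h.conn₁

/-- Lowering a weight in a component with three marks. -/
lemma ThreeMarks.twoMarks_sub_single (hF : IsForest G F) (hτ : ∀ x, τ x < 3)
    (h : ThreeMarks G τ sp F M u) (he : e ∈ F) (hi : InComp G F u e) (h2 : 2 ≤ M e) :
    ∃ r u₁, Conn G F u u₁ ∧ TwoMarks G τ sp F (M - Finsupp.single e 1) r u₁ := by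
  rcases h with ⟨v, w, z, mv, mw, mz, huv, h, hw⟩ | ⟨v, w, z, mv, mw, e₀, a, b, huv, h, hw⟩
  · have hem := hw.mem he (hi.trans huv.symm) h2
    rw [Multiset.mem_add, Multiset.mem_add] at hem
    have huw := huv.trans h.conn₁
    have huz := huv.trans h.conn₂
    have hw₁ : Weighted G F M w (mw + mz + mv) := by
      rw [add_comm (mw + mz), ← add_assoc]
      exact hw.of_conn h.conn₁
    have hw₂ : Weighted G F M z (mz + mv + mw) := by
      rw [add_assoc, add_comm mz]
      exact hw.of_conn h.conn₂
    rcases hem with (hem | hem) | hem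
    · obtain ⟨r, h⟩ := h.twoMarks_sub_single hF hτ hw hem
      exact ⟨r, w, huw, h⟩
    · obtain ⟨r, h⟩ := h.rotate.twoMarks_sub_single hF hτ hw₁ hem
      exact ⟨r, z, huz, h⟩
    · obtain ⟨r, h⟩ := h.rotate.rotate.twoMarks_sub_single hF hτ hw₂ hem
      exact ⟨r, v, huv, h⟩
  · have hem := hw.mem he (hi.trans huv.symm) h2
    rw [Multiset.mem_add, Multiset.mem_add] at hem
    have hd := h.dart hF
    rcases hem with (hem | hem) | hem
    -- Dropping the mark at `v` moves the middle mark to `b`, dropping the one at `w` moves it to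
    -- `a`, and dropping the middle mark leaves the pair `v`, `w`.
    · obtain ⟨r, hr⟩ := h.isPairAt_right hF hτ subset_rfl (h.btw.1.symm.trans hd.conn_right.symm)
        fun hv => absurd hv (h.left.not_sp hem)
      refine ⟨r, w, huv.trans h.btw.1, w, b, mw, {e₀}, Conn.refl w, hr, ?_⟩
      rw [h.left.eq_singleton hem, add_assoc, add_comm] at hw
      exact hw.sub_single.of_conn h.btw.1
    · obtain ⟨r, hr⟩ := h.isPairAt_left hF hτ subset_rfl (h.btw.1.trans hd.conn_left)
        fun hv => absurd hv (h.right.not_sp hem)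
      refine ⟨r, v, huv, v, a, mv, {e₀}, Conn.refl v, hr, ?_⟩
      rw [h.right.eq_singleton hem, add_right_comm] at hw
      exact hw.sub_single
    · rw [Multiset.mem_singleton] at hem
      subst hem
      obtain ⟨r, hr, hr'⟩ := exists_third hτ v w
      exact ⟨r, v, huv, v, w, mv, mw, Conn.refl v,
        ⟨h.btw.1, h.lt.ne, hr'.1, hr'.2, hr, h.sp_mem, h.left, h.right⟩, hw.sub_single⟩

/-- Lowering a weight that is at least two. -/
lemma IsConfig.sub_single (hF : IsForest G F) (hτ : ∀ x, τ x < 3) (h : IsConfig G τ sp F M)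
    (he : e ∈ F) (h2 : 2 ≤ M e) : IsConfig G τ sp F (M - Finsupp.single e 1) := by
  have hM : ∀ f, (M - Finsupp.single e 1 : β →₀ ℕ) f ≤ M f := fun f => by
    rw [Finsupp.tsub_apply]
    exact Nat.sub_le _ _
  have h₁ : ∀ {x}, OneMark G sp F M x → OneMark G sp F (M - Finsupp.single e 1) x :=
    fun h => h.mono subset_rfl hM (Conn.refl _)
  rcases h with ⟨u, hu, ho⟩ | ⟨u, u', r, r', hr, hu, hu', ho⟩
  · by_cases hi : InComp G F u e
    · obtain ⟨r, u₁, hc, hu₁⟩ := hu.twoMarks_sub_single hF hτ he hi h2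
      -- A single pair is encoded by equal base points; the second type only has to differ from `r`.
      refine Or.inr ⟨u₁, u₁, r, r + 1, by omega, Or.inr hu₁, Or.inl (Conn.refl u₁),
        fun x hx _ => h₁ (ho x fun h => hx (hc.symm.trans h))⟩
    · refine Or.inl ⟨u, ?_, fun x hx => h₁ (ho x hx)⟩
      rcases hu with ⟨v, w, z, mv, mw, mz, huv, h, hw⟩ | ⟨v, w, z, mv, mw, e₀, a, b, huv, h, hw⟩
      · exact Or.inl ⟨v, w, z, mv, mw, mz, huv, h,
          hw.sub_single_of_not_inComp fun h => hi (h.trans huv)⟩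
      · exact Or.inr ⟨v, w, z, mv, mw, e₀, a, b, huv, h,
          hw.sub_single_of_not_inComp fun h => hi (h.trans huv)⟩
  · have h₂ : ∀ {r x}, OneOrTwo G τ sp F M r x →
        OneOrTwo G τ sp F (M - Finsupp.single e 1) r x := by
      rintro r x (h | h)
      · exact Or.inl (h₁ h)
      · by_cases hi : InComp G F x e
        · exact Or.inl (h.oneMark_sub_single he hi h2 (Conn.refl x))
        · obtain ⟨v, w, mv, mw, huv, h, hw⟩ := h
          exact Or.inr ⟨v, w, mv, mw, huv, h,
            hw.sub_single_of_not_inComp fun h => hi (h.trans huv)⟩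
    exact Or.inr ⟨u, u', r, r', hr, h₂ hu, hu'.imp_right h₂, fun x hx hx' => h₁ (ho x hx hx')⟩

lemma Conn.split (h : Conn G F v w) (hl : G.IsLink e a b) (hvw : ¬ Conn G (F.erase e) v w)
    (hx : Conn G F v x) : Conn G (F.erase e) v x ∨ Conn G (F.erase e) w x := by
  rcases h.erase_cases hl with h | ⟨h, h'⟩ | ⟨h, h'⟩
  · exact absurd h hvw
  · rcases hx.erase_cases hl with hx | ⟨-, hx⟩ | ⟨-, hx⟩
    exacts [.inl hx, .inr (h'.symm.trans hx), .inl (h.trans hx)]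
  · rcases hx.erase_cases hl with hx | ⟨-, hx⟩ | ⟨-, hx⟩
    exacts [.inl hx, .inl (h.trans hx), .inr (h'.symm.trans hx)]

/-- In the component of `u` in `F`, all components of `F.erase e` have one mark, except possibly
the component of `u₁`, which satisfies `P`. -/
def Splits (G : Graph α β) (sp : α → Prop) (F : Finset β) (e : β) (M' : β →₀ ℕ) (P : α → Prop)
    (u : α) : Prop :=
  ∃ u₁, Conn G F u u₁ ∧ P u₁ ∧
    ∀ x, Conn G F u x → ¬ Conn G (F.erase e) u₁ x → OneMark G sp (F.erase e) M' x

lemma ToEdge.not_inComp (h : ToEdge G sp F v w m) (hem : e ∉ m)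
    (hx : ¬ Conn G (F.erase e) v x) : ∀ f ∈ m, ¬ InComp G (F.erase e) x f := by
  intro f hf hi
  have hfe : f ≠ e := by
    rintro rfl
    exact hem hf
  exact hx (((h.inComp hf _).conn hi (Finset.mem_erase.2 ⟨hfe, (h.exists_isLink hf).1⟩)))

/-- An edge of weight one is empowered by no mark, so the empowered edges survive its removal. If
the two marks stay together, the other part has no mark and all its weights are one; otherwise each
part keeps one mark. -/
lemma TwoMarks.splits (hF : IsForest G F) (h : TwoMarks G τ sp F M r u) (he : e ∈ F)
    (hM : ∀ f ∈ F.erase e, M' f = M f) (hl : G.IsLink e a b) (h1 : M e = 1) :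
    Splits G sp F e M' (OneOrTwo G τ sp (F.erase e) M' r) u := by
  obtain ⟨v, w, mv, mw, huv, hp, hw⟩ := h
  have hs := Finset.erase_subset e F
  have hem : e ∉ mv + mw := fun hem => by
    have hi : InComp G F v e := by
      rcases Multiset.mem_add.1 hem with h | h
      exacts [hp.left.inComp h F, (hp.right.inComp h F).trans hp.conn]
    have := hw e he hi
    have := Multiset.count_pos.2 hem
    omega
  obtain ⟨hev, hew⟩ : e ∉ mv ∧ e ∉ mw := by simpa using hem
  by_cases hc : Conn G (F.erase e) v w
  · refine ⟨v, huv, Or.inr ⟨v, w, mv, mw, Conn.refl v, ?_, hw.restrict hs hM (Conn.refl v)⟩,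
      fun x hux hvx => ?_⟩
    · exact ⟨hc, hp.ne, hp.ne_left, hp.ne_right, hp.lt, fun x hx hcx => hp.sp_mem x hx (hcx.mono hs),
        hp.left.restrict hF hs hc, hp.right.restrict hF hs hc.symm⟩
    · have hvx' := huv.symm.trans hux
      have hno : ∀ y, sp y → ¬ Conn G (F.erase e) x y := by
        intro y hy hcy
        rcases hp.sp_mem y hy (hvx'.trans (hcy.mono hs)) with rfl | rfl
        · exact hvx hcy.symm
        · exact hvx (hc.trans hcy.symm)
      have hw' := hw.restrict hs hM hvx'
      rw [← zero_add (mv + mw)] at hw'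
      refine (hw'.drop fun f hf => ?_).oneMark (by simp) (fun _ _ _ => rfl)
        fun y _ hy _ hcy _ => absurd hcy (hno y hy)
      rcases Multiset.mem_add.1 hf with hf | hf
      · exact hp.left.not_inComp hev hvx f hf
      · exact hp.right.not_inComp hew (fun h => hvx (hc.trans h)) f hf
  · have key : ∀ {v w mv mw}, IsPairAt G τ sp F v w mv mw r → Weighted G F M v (mv + mw) →
        e ∉ mw → ¬ Conn G (F.erase e) v w → ∀ x, Conn G (F.erase e) v x →
        OneMark G sp (F.erase e) M' x := by
      intro v w mv mw hp hw hew hc x hvx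
      have hsp : ∀ y, sp y → Conn G (F.erase e) x y → y = v := by
        intro y hy hcy
        rcases hp.sp_mem y hy (Conn.mono (hvx.trans hcy) hs) with rfl | rfl
        · rfl
        · exact absurd (hvx.trans hcy) hc
      refine ((hw.restrict hs hM (hvx.mono hs)).drop
        (hp.right.not_inComp hew fun h => hc (hvx.trans h.symm))).oneMark hp.left.card_le
        (fun y hy hcy => hp.left.eq_zero (hsp y hy hcy ▸ hy))
        fun y y' hy hy' hcy hcy' => (hsp y hy hcy).trans (hsp y' hy' hcy').symm
    refine ⟨v, huv, Or.inl (key hp hw hew hc v (Conn.refl v)), fun x hux hvx => ?_⟩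
    have hwx := (hp.conn.split hl hc (huv.symm.trans hux)).resolve_left hvx
    refine key hp.symm ?_ hev (fun h => hc h.symm) x hwx
    rw [add_comm]
    exact hw.of_conn hp.conn

lemma IsTripodAt.splits (hF : IsForest G F) (hτ : ∀ x, τ x < 3)
    (h : IsTripodAt G τ sp F v w z mv mw mz) (hw : Weighted G F M v (mv + mw + mz))
    (hM : ∀ f ∈ F.erase e, M' f = M f) (hl : G.IsLink e a b) (hev : e ∉ mv) (hew : e ∉ mw)
    (hez : e ∉ mz) (hc : Conn G (F.erase e) w z) (hvw : ¬ Conn G (F.erase e) v w) :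
    Splits G sp F e M' (TwoMarks G τ sp (F.erase e) M' (τ v)) v := by
  have hs := Finset.erase_subset e F
  refine ⟨w, h.conn₁, ⟨w, z, mw, mz, Conn.refl w,
    h.isPairAt hF hτ hs hc fun _ h => hvw h.symm, ?_⟩, fun x hvx hwx => ?_⟩
  · have hw' := hw.restrict hs hM h.conn₁
    rw [add_assoc, add_comm] at hw'
    exact hw'.drop (h.toEdge₁.not_inComp hev hvw)
  · have hvx' := (h.conn₁.split hl hvw hvx).resolve_right hwx
    have hsp : ∀ y, sp y → Conn G (F.erase e) x y → y = v := by
      intro y hy hcy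
      rcases h.sp_mem y hy (hvx.trans (hcy.mono hs)) with rfl | rfl | rfl
      · rfl
      · exact absurd hcy.symm hwx
      · exact absurd (hc.trans hcy.symm) hwx
    have hw' := hw.restrict hs hM hvx
    rw [add_assoc] at hw'
    refine (hw'.drop fun f hf => ?_).oneMark h.toEdge₁.card_le
      (fun y hy hcy => h.toEdge₁.eq_zero (hsp y hy hcy ▸ hy))
      fun y y' hy hy' hcy hcy' => (hsp y hy hcy).trans (hsp y' hy' hcy').symm
    rcases Multiset.mem_add.1 hf with hf | hf
    · exact h.toEdge₂.not_inComp hew hwx f hf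
    · exact h.toEdge₃.not_inComp hez (fun h => hwx (hc.trans h)) f hf

lemma Splits.of_conn {P : α → Prop} (h : Splits G sp F e M' P v) (hc : Conn G F u v) :
    Splits G sp F e M' P u := by
  obtain ⟨u₁, h1, h2, h3⟩ := h
  exact ⟨u₁, hc.trans h1, h2, fun x hx => h3 x (hc.symm.trans hx)⟩

/-- A cut leaves only two parts. The marks of a tripod either stay together or a single one is
separated from a pair. In a sandwich whose outer marks are separated, the middle edge falls on one
side and forms a pair with the outer mark there. -/
lemma ThreeMarks.splits (hF : IsForest G F) (hτ : ∀ x, τ x < 3) (h : ThreeMarks G τ sp F M u)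
    (he : e ∈ F) (hM : ∀ f ∈ F.erase e, M' f = M f) (hl : G.IsLink e a b) (h1 : M e = 1) :
    Splits G sp F e M' (ThreeMarks G τ sp (F.erase e) M') u ∨
      ∃ r, Splits G sp F e M' (TwoMarks G τ sp (F.erase e) M' r) u := by
  have hs := Finset.erase_subset e F
  have hmem : ∀ {v m}, Weighted G F M v m → (e ∈ m → InComp G F v e) → e ∉ m := by
    intro v m hw hi hem
    have := hw e he (hi hem)
    have := Multiset.count_pos.2 hem
    omega
  rcases h with ⟨v, w, z, mv, mw, mz, huv, h, hw⟩ | ⟨v, w, z, mv, mw, e₀, c, d, huv, h, hw⟩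
  · have hem : e ∉ mv + mw + mz := hmem hw fun hem => by
      rcases Multiset.mem_add.1 hem with hem | hem
      · rcases Multiset.mem_add.1 hem with hem | hem
        exacts [h.toEdge₁.inComp hem F, (h.toEdge₂.inComp hem F).trans h.conn₁]
      · exact (h.toEdge₃.inComp hem F).trans h.conn₂
    obtain ⟨hev, hew, hez⟩ : e ∉ mv ∧ e ∉ mw ∧ e ∉ mz := by simpa [and_assoc] using hem
    by_cases hvw : Conn G (F.erase e) v w
    · by_cases hvz : Conn G (F.erase e) v z
      · left
        refine ⟨v, huv, Or.inl ⟨v, w, z, mv, mw, mz, Conn.refl v, ?_,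
          hw.restrict hs hM (Conn.refl v)⟩, fun x hux hvx => ?_⟩
        · have hwz := hvw.symm.trans hvz
          exact ⟨hvw, hvz, h.ne₁, h.ne₂, h.ne₃, fun x hx hc => h.sp_mem x hx (hc.mono hs),
            h.toEdge₁.restrict hF hs hvw, h.toEdge₂.restrict hF hs hwz,
            h.toEdge₃.restrict hF hs hvz.symm, h.leaf₁.imp_right fun h h' => h (h'.mono hF hs),
            h.leaf₂.imp_right fun h h' => h (h'.mono hF hs),
            h.leaf₃.imp_right fun h h' => h (h'.mono hF hs)⟩
        · have hvx' := huv.symm.trans hux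
          have hno : ∀ y, sp y → ¬ Conn G (F.erase e) x y := by
            intro y hy hcy
            rcases h.sp_mem y hy (hvx'.trans (hcy.mono hs)) with rfl | rfl | rfl
            exacts [hvx hcy.symm, hvx (hvw.trans hcy.symm), hvx (hvz.trans hcy.symm)]
          have hw' := hw.restrict hs hM hvx'
          rw [← zero_add (mv + mw + mz)] at hw'
          refine (hw'.drop fun f hf => ?_).oneMark (by simp) (fun _ _ _ => rfl)
            fun y _ hy _ hcy _ => absurd hcy (hno y hy)
          rcases Multiset.mem_add.1 hf with hf | hf
          · rcases Multiset.mem_add.1 hf with hf | hf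
            · exact h.toEdge₁.not_inComp hev hvx f hf
            · exact h.toEdge₂.not_inComp hew (fun h => hvx (hvw.trans h)) f hf
          · exact h.toEdge₃.not_inComp hez (fun h => hvx (hvz.trans h)) f hf
      · right
        have hw' : Weighted G F M z (mz + mv + mw) := by
          rw [add_assoc, add_comm mz]
          exact hw.of_conn h.conn₂
        exact ⟨_, (h.rotate.rotate.splits hF hτ hw' hM hl hez hev hew hvw
          fun h => hvz h.symm).of_conn (huv.trans h.conn₂)⟩
    · right
      by_cases hwz : Conn G (F.erase e) w z
      · exact ⟨_, (h.splits hF hτ hw hM hl hev hew hez hwz hvw).of_conn huv⟩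
      -- Only two parts exist, so `w` is the mark that has been separated.
      · have hvz := (h.conn₁.split hl hvw h.conn₂).resolve_right hwz
        have hw' : Weighted G F M w (mw + mz + mv) := by
          rw [add_comm (mw + mz), ← add_assoc]
          exact hw.of_conn h.conn₁
        exact ⟨_, (h.rotate.splits hF hτ hw' hM hl hew hez hev hvz.symm hwz).of_conn
          (huv.trans h.conn₁)⟩
  · have hd := h.dart hF
    have hem : e ∉ mv + mw + {e₀} := hmem hw fun hem => by
      rcases Multiset.mem_add.1 hem with hem | hem
      · rcases Multiset.mem_add.1 hem with hem | hem
        exacts [h.left.inComp hem F, (h.right.inComp hem F).trans h.btw.1]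
      · rw [Multiset.mem_singleton.1 hem]
        exact hd.inComp.trans h.btw.1
    obtain ⟨hev, hew, hee⟩ : e ∉ mv ∧ e ∉ mw ∧ e ≠ e₀ := by simpa [and_assoc] using hem
    have he₀ : e₀ ∈ F.erase e := Finset.mem_erase.2 ⟨Ne.symm hee, hd.mem⟩
    have hcd := conn_of_isLink he₀ hd.isLink
    have hsingle : ∀ x, ¬ Conn G (F.erase e) c x → ∀ f ∈ ({e₀} : Multiset β),
        ¬ InComp G (F.erase e) x f := by
      intro x hx f hf hi
      rw [Multiset.mem_singleton] at hf
      subst hf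
      exact hx (hi.conn_of_isLink he₀ hd.isLink).symm
    have hva : Conn G F v c := h.btw.1.trans hd.conn_left
    by_cases hvw : Conn G (F.erase e) v w
    · left
      have hb := h.btw.restrict hs hvw
      have hfirst := h.first.restrict hF hs hb.conn_left.symm
      refine ⟨v, huv, Or.inr ⟨v, w, z, mv, mw, e₀, c, d, Conn.refl v,
        ⟨h.lt, hb, h.mid, fun x hx hc => h.sp_mem x hx (hc.mono hs), h.left.restrict hF hs hvw,
          h.right.restrict hF hs hvw.symm, hfirst⟩, hw.restrict hs hM (Conn.refl v)⟩,
        fun x hux hvx => ?_⟩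
      have hvx' := huv.symm.trans hux
      have hno : ∀ y, sp y → ¬ Conn G (F.erase e) x y := by
        intro y hy hcy
        rcases h.sp_mem y hy (hvx'.trans (hcy.mono hs)) with rfl | rfl
        exacts [hvx hcy.symm, hvx (hvw.trans hcy.symm)]
      have hw' := hw.restrict hs hM hvx'
      rw [← zero_add (mv + mw + {e₀})] at hw'
      refine (hw'.drop fun f hf => ?_).oneMark (by simp) (fun _ _ _ => rfl)
        fun y _ hy _ hcy _ => absurd hcy (hno y hy)
      rcases Multiset.mem_add.1 hf with hf | hf
      · rcases Multiset.mem_add.1 hf with hf | hf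
        · exact h.left.not_inComp hev hvx f hf
        · exact h.right.not_inComp hew (fun h => hvx (hvw.trans h)) f hf
      · exact hsingle x (fun h => hvx ((hb.conn_left.trans hfirst.dart.conn_left).trans h)) f hf
    · right
      have hsp : ∀ x y, Conn G F v x → sp y → Conn G (F.erase e) x y → y = v ∨ y = w :=
        fun x y hx hy hc => h.sp_mem y hy (hx.trans (hc.mono hs))
      -- The side on which the middle edge `cd` lies decides which outer mark it is paired with.
      rcases h.btw.1.split hl hvw hva with hvc | hwc
      · obtain ⟨r, hr⟩ := h.isPairAt_left hF hτ hs hvc fun _ => hvw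
        refine ⟨r, v, huv, ⟨v, c, mv, {e₀}, Conn.refl v, hr, ?_⟩, fun x hux hvx => ?_⟩
        · have hw' := hw.restrict hs hM (Conn.refl v)
          rw [add_right_comm] at hw'
          exact hw'.drop (h.right.not_inComp hew fun h => hvw h.symm)
        · have hux' := huv.symm.trans hux
          have hwx := (h.btw.1.split hl hvw hux').resolve_left hvx
          have hsp' : ∀ y, sp y → Conn G (F.erase e) x y → y = w := fun y hy hc =>
            (hsp x y hux' hy hc).resolve_left fun h => hvx (h ▸ hc.symm)
          have hw' := hw.restrict hs hM hux'
          rw [add_comm mv, add_assoc] at hw'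
          refine (hw'.drop fun f hf => ?_).oneMark h.right.card_le
            (fun y hy hcy => h.right.eq_zero (hsp' y hy hcy ▸ hy))
            fun y y' hy hy' hcy hcy' => (hsp' y hy hcy).trans (hsp' y' hy' hcy').symm
          rcases Multiset.mem_add.1 hf with hf | hf
          · exact h.left.not_inComp hev hvx f hf
          · exact hsingle x (fun h => hvx (hvc.trans h)) f hf
      · obtain ⟨r, hr⟩ := h.isPairAt_right hF hτ hs (hwc.trans hcd) fun _ h => hvw h.symm
        refine ⟨r, w, huv.trans h.btw.1, ⟨w, d, mw, {e₀}, Conn.refl w, hr, ?_⟩,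
          fun x hux hwx => ?_⟩
        · have hw' := hw.restrict hs hM h.btw.1
          rw [add_comm mv, add_right_comm] at hw'
          exact hw'.drop (h.left.not_inComp hev hvw)
        · have hux' := huv.symm.trans hux
          have hvx := (h.btw.1.split hl hvw hux').resolve_right hwx
          have hsp' : ∀ y, sp y → Conn G (F.erase e) x y → y = v := fun y hy hc =>
            (hsp x y hux' hy hc).resolve_right fun h => hwx (h ▸ hc.symm)
          have hw' := hw.restrict hs hM hux'
          rw [add_assoc] at hw'
          refine (hw'.drop fun f hf => ?_).oneMark h.left.card_le
            (fun y hy hcy => h.left.eq_zero (hsp' y hy hcy ▸ hy))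
            fun y y' hy hy' hcy hcy' => (hsp' y hy hcy).trans (hsp' y' hy' hcy').symm
          rcases Multiset.mem_add.1 hf with hf | hf
          · exact h.right.not_inComp hew hwx f hf
          · exact hsingle x (fun h => hwx (hwc.trans h)) f hf

/-- Removing an edge of weight one. -/
lemma IsConfig.erase (hF : IsForest G F) (hτ : ∀ x, τ x < 3) (h : IsConfig G τ sp F M)
    (he : e ∈ F) (h1 : M e = 1) (hl : G.IsLink e a b) :
    IsConfig G τ sp (F.erase e) (M - Finsupp.single e 1) := by
  have hs := Finset.erase_subset e F
  have hM : ∀ f, (M - Finsupp.single e 1 : β →₀ ℕ) f ≤ M f := fun f => by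
    rw [Finsupp.tsub_apply]
    exact Nat.sub_le _ _
  have hM' : ∀ f ∈ F.erase e, (M - Finsupp.single e 1 : β →₀ ℕ) f = M f := fun f hf => by
    rw [Finsupp.tsub_apply, Finsupp.single_eq_of_ne (Finset.ne_of_mem_erase hf)]
    rfl
  have h₁ : ∀ {x}, OneMark G sp F M x → OneMark G sp (F.erase e) (M - Finsupp.single e 1) x :=
    fun h => h.mono hs hM (Conn.refl _)
  rcases h with ⟨u, hu, ho⟩ | ⟨u, u', r, r', hr, hu, hu', ho⟩
  · have hrest : ∀ u₁, (∀ x, Conn G F u x → ¬ Conn G (F.erase e) u₁ x →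
        OneMark G sp (F.erase e) (M - Finsupp.single e 1) x) →
        ∀ x, ¬ Conn G (F.erase e) u₁ x → OneMark G sp (F.erase e) (M - Finsupp.single e 1) x := by
      intro u₁ hu₁ x hx
      by_cases hux : Conn G F u x
      · exact hu₁ x hux hx
      · exact h₁ (ho x hux)
    rcases hu.splits hF hτ he hM' hl h1 with ⟨u₁, -, h, hx⟩ | ⟨r, u₁, -, h, hx⟩
    · exact Or.inl ⟨u₁, h, hrest u₁ hx⟩
    · exact Or.inr ⟨u₁, u₁, r, r + 1, by omega, Or.inr h, Or.inl (Conn.refl u₁),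
        fun x hx' _ => hrest u₁ hx x hx'⟩
  · have h₂ : ∀ {r x}, OneOrTwo G τ sp F M r x → Splits G sp F e (M - Finsupp.single e 1)
        (OneOrTwo G τ sp (F.erase e) (M - Finsupp.single e 1) r) x := by
      rintro r x (h | h)
      · exact ⟨x, Conn.refl x, Or.inl (h₁ h), fun y hy _ => h.mono hs hM hy⟩
      · exact h.splits hF he hM' hl h1
    obtain ⟨u₁, -, hu₁, hx⟩ := h₂ hu
    by_cases huu : Conn G F u u'
    · refine Or.inr ⟨u₁, u₁, r, r', hr, hu₁, Or.inl (Conn.refl u₁), fun x hx' _ => ?_⟩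
      by_cases hux : Conn G F u x
      · exact hx x hux hx'
      · exact h₁ (ho x hux fun h => hux (huu.trans h))
    · obtain ⟨u₁', -, hu₁', hx'⟩ := h₂ (hu'.resolve_left huu)
      refine Or.inr ⟨u₁, u₁', r, r', hr, hu₁, Or.inr hu₁', fun x hx₁ hx₁' => ?_⟩
      by_cases hux : Conn G F u x
      · exact hx x hux hx₁
      · by_cases hux' : Conn G F u' x
        · exact hx' x hux' hx₁'
        · exact h₁ (ho x hux hux')

end Closure

/-! ### Multiplying by a variable -/

section Extension

variable {α β : Type*} [DecidableEq β] {G : Graph α β} {τ : α → ℕ} {sp : α → Prop}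
  {F F' : Finset β} {M M' : β →₀ ℕ} {u u₀ v w x y z a b c h p q : α} {e f g : β}
  {m m' mv mw mz mp mq : Multiset β} {r : ℕ}

lemma Btw.antisymm (hF : IsForest G F) (h : Btw G F w z v) (h' : Btw G F z v w) : v = w := by
  by_contra hne
  obtain ⟨e, b, hd⟩ := exists_first_onDart h.conn_left (Ne.symm hne)
  have h1 := hd.trans_left hF h
  have h2 := hd.symm.trans_left hF h'.symm
  exact hF e hd.mem w b hd.isLink (h2.right.trans h1.right.symm)

/-! #### Raising a weight -/

lemma Weighted.add_single (h : Weighted G F M v m) :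
    Weighted G F (M + Finsupp.single f 1) v (m + {f}) := by
  intro e he hi
  rw [Finsupp.add_apply, h e he hi, Multiset.count_add, Multiset.count_singleton, add_assoc]
  by_cases hfe : e = f
  · subst hfe
    simp
  · rw [Finsupp.single_eq_of_ne hfe, if_neg hfe]

omit [DecidableEq β] in
lemma add_single_apply_of_not_inComp (hi : ¬ InComp G F v f) (he : InComp G F v e) :
    (M + Finsupp.single f 1 : β →₀ ℕ) e = M e := by
  have hfe : e ≠ f := by
    rintro rfl
    exact hi he
  rw [Finsupp.add_apply, Finsupp.single_eq_of_ne hfe, add_zero]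

lemma Weighted.add_single_of_not_inComp (h : Weighted G F M v m) (hi : ¬ InComp G F v f) :
    Weighted G F (M + Finsupp.single f 1) v m := fun e he hie =>
  (add_single_apply_of_not_inComp hi hie).trans (h e he hie)

omit [DecidableEq β] in
lemma OneMark.add_single_of_not_inComp (h : OneMark G sp F M v) (hi : ¬ InComp G F v f) :
    OneMark G sp F (M + Finsupp.single f 1) v where
  sp_unique := h.sp_unique
  sp_le w e hw hc he hie := by
    rw [add_single_apply_of_not_inComp hi hie]
    exact h.sp_le w e hw hc he hie
  le_two e he hie := by
    rw [add_single_apply_of_not_inComp hi hie]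
    exact h.le_two e he hie
  unique e he e' he' hie hie' := by
    rw [add_single_apply_of_not_inComp hi hie, add_single_apply_of_not_inComp hi hie']
    exact h.unique e he e' he' hie hie'

lemma TwoMarks.add_single_of_not_inComp (h : TwoMarks G τ sp F M r u) (hi : ¬ InComp G F u f) :
    TwoMarks G τ sp F (M + Finsupp.single f 1) r u := by
  obtain ⟨v, w, mv, mw, huv, hp, hw⟩ := h
  exact ⟨v, w, mv, mw, huv, hp, hw.add_single_of_not_inComp fun h => hi (h.trans huv)⟩

lemma ThreeMarks.add_single_of_not_inComp (h : ThreeMarks G τ sp F M u)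
    (hi : ¬ InComp G F u f) : ThreeMarks G τ sp F (M + Finsupp.single f 1) u := by
  rcases h with ⟨v, w, z, mv, mw, mz, huv, h, hw⟩ | ⟨v, w, z, mv, mw, e₀, a, b, huv, h, hw⟩
  · exact Or.inl ⟨v, w, z, mv, mw, mz, huv, h,
      hw.add_single_of_not_inComp fun h => hi (h.trans huv)⟩
  · exact Or.inr ⟨v, w, z, mv, mw, e₀, a, b, huv, h,
      hw.add_single_of_not_inComp fun h => hi (h.trans huv)⟩

omit [DecidableEq β] in
lemma OneMark.of_conn (h : OneMark G sp F M u) (hc : Conn G F u v) : OneMark G sp F M v :=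
  h.mono subset_rfl (fun _ => le_rfl) hc

lemma TwoMarks.of_conn (h : TwoMarks G τ sp F M r u) (hc : Conn G F u v) :
    TwoMarks G τ sp F M r v := by
  obtain ⟨w, z, mw, mz, huw, hp⟩ := h
  exact ⟨w, z, mw, mz, hc.symm.trans huw, hp⟩

lemma isConfig_of_oneMark (u : α) (h : ∀ x, OneMark G sp F M x) : IsConfig G τ sp F M :=
  Or.inr ⟨u, u, 0, 1, by omega, Or.inl (h u), Or.inl (Conn.refl u), fun x _ _ => h x⟩

lemma isConfig_of_twoMarks (h : TwoMarks G τ sp F M r u)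
    (ho : ∀ x, ¬ Conn G F u x → OneMark G sp F M x) : IsConfig G τ sp F M :=
  Or.inr ⟨u, u, r, r + 1, by omega, Or.inr h, Or.inl (Conn.refl u), fun x hx _ => ho x hx⟩

/-- `IsConfig` lets the two base points share a component and lets each of them have one mark only,
which is convenient when marks are removed. Here the degenerate cases are sorted out: the last
alternative has two pairs in different components. -/
lemma IsConfig.cases (h : IsConfig G τ sp F M) :
    (∀ x, OneMark G sp F M x) ∨
    (∃ u r, TwoMarks G τ sp F M r u ∧ ∀ x, ¬ Conn G F u x → OneMark G sp F M x) ∨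
    (∃ u, ThreeMarks G τ sp F M u ∧ ∀ x, ¬ Conn G F u x → OneMark G sp F M x) ∨
    (∃ u u' r r', r ≠ r' ∧ ¬ Conn G F u u' ∧ TwoMarks G τ sp F M r u ∧ TwoMarks G τ sp F M r' u' ∧
      ∀ x, ¬ Conn G F u x → ¬ Conn G F u' x → OneMark G sp F M x) := by
  rcases h with ⟨u, hu, ho⟩ | ⟨u, u', r, r', hr, hu, hu', ho⟩
  · exact Or.inr (Or.inr (Or.inl ⟨u, hu, ho⟩))
  · by_cases huu : Conn G F u u'
    · have ho' : ∀ x, ¬ Conn G F u x → OneMark G sp F M x :=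
        fun x hx => ho x hx fun h => hx (huu.trans h)
      rcases hu with hu | hu
      · refine Or.inl fun x => ?_
        by_cases hx : Conn G F u x
        exacts [hu.of_conn hx, ho' x hx]
      · exact Or.inr (Or.inl ⟨u, r, hu, ho'⟩)
    · have hu' := hu'.resolve_left huu
      rcases hu with hu | hu
      · have ho' : ∀ x, ¬ Conn G F u' x → OneMark G sp F M x := fun x hx => by
          by_cases hx' : Conn G F u x
          exacts [hu.of_conn hx', ho x hx' hx]
        rcases hu' with hu' | hu'
        · refine Or.inl fun x => ?_
          by_cases hx : Conn G F u' x
          exacts [hu'.of_conn hx, ho' x hx]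
        · exact Or.inr (Or.inl ⟨u', r', hu', ho'⟩)
      · rcases hu' with hu' | hu'
        · refine Or.inr (Or.inl ⟨u, r, hu, fun x hx => ?_⟩)
          by_cases hx' : Conn G F u' x
          exacts [hu'.of_conn hx', ho x hx hx']
        · exact Or.inr (Or.inr (Or.inr ⟨u, u', r, r', hr, huu, hu, hu', ho⟩))

/-- In a maximal configuration every component with one mark whose vertices are all normal has
an edge of weight two. -/
lemma IsConfig.add_single_of_oneMark (h : IsConfig G τ sp F M) (hu : OneMark G sp F M u)
    (hsp : ∀ x, sp x → ¬ Conn G F u x) (hf : f ∈ F) (hi : InComp G F u f)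
    (hM : ∀ e ∈ F, InComp G F u e → M e ≤ 1) : IsConfig G τ sp F (M + Finsupp.single f 1) := by
  have hu' : OneMark G sp F (M + Finsupp.single f 1) u := by
    have key : ∀ e ∈ F, InComp G F u e → 2 ≤ (M + Finsupp.single f 1 : β →₀ ℕ) e → e = f := by
      intro e he hie h2
      by_contra hef
      rw [Finsupp.add_apply, Finsupp.single_eq_of_ne hef] at h2
      have := hM e he hie
      omega
    refine ⟨hu.sp_unique, fun v e hv hc => absurd hc (hsp v hv), fun e he hie => ?_,
      fun e he e' he' hie hie' h2 h2' => (key e he hie h2).trans (key e' he' hie' h2').symm⟩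
    rw [Finsupp.add_apply]
    have h1 := hM e he hie
    have h2 : Finsupp.single f 1 e ≤ 1 := by
      rw [Finsupp.single_apply]
      split_ifs <;> omega
    omega
  have h₁ : ∀ {x}, OneMark G sp F M x → OneMark G sp F (M + Finsupp.single f 1) x := by
    intro x hx
    by_cases hix : InComp G F x f
    · exact hu'.of_conn (hi.conn hix hf)
    · exact hx.add_single_of_not_inComp hix
  rcases h with ⟨u₁, hu₁, ho⟩ | ⟨u₁, u₂, r, r', hr, hu₁, hu₂, ho⟩
  · by_cases hiu : InComp G F u₁ f
    · refine isConfig_of_oneMark u fun x => ?_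
      by_cases hx : Conn G F u₁ x
      · exact hu'.of_conn ((hi.conn hiu hf).trans hx)
      · exact h₁ (ho x hx)
    · exact Or.inl ⟨u₁, hu₁.add_single_of_not_inComp hiu, fun x hx => h₁ (ho x hx)⟩
  · have h₂ : ∀ {r x}, OneOrTwo G τ sp F M r x →
        OneOrTwo G τ sp F (M + Finsupp.single f 1) r x := by
      rintro r x (h | h)
      · exact Or.inl (h₁ h)
      · by_cases hix : InComp G F x f
        · exact Or.inl (hu'.of_conn (hi.conn hix hf))
        · exact Or.inr (h.add_single_of_not_inComp hix)
    exact Or.inr ⟨u₁, u₂, r, r', hr, h₂ hu₁, hu₂.imp_right h₂, fun x hx hx' => h₁ (ho x hx hx')⟩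

/-! #### The mark of a component with one mark -/

/-- The mark of the component of `u` lies on `h`, and it empowers `m` in the direction of `y`. -/
structure IsMarkAt (G : Graph α β) (sp : α → Prop) (F : Finset β) (M : β →₀ ℕ) (u y h : α)
    (m : Multiset β) : Prop where
  conn : Conn G F u h
  toEdge : ToEdge G sp F h y m
  weighted : Weighted G F M u m
  sp_eq : ∀ x, sp x → Conn G F u x → x = h

/-- If the component of `u` has one mark, then it has a special vertex or an edge of weight two. -/
def Saturated (G : Graph α β) (sp : α → Prop) (F : Finset β) (M : β →₀ ℕ) (u : α) : Prop :=
  (∃ x, sp x ∧ Conn G F u x) ∨ ∃ e ∈ F, InComp G F u e ∧ 2 ≤ M e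

/-- The weights reveal the mark: it is the special vertex if there is one, and otherwise the end of
the edge of weight two away from `y`. The freedom in `y` matters: extending the configuration uses
several directions, and the smallest vertex is chosen only when a tree is rebuilt. -/
lemma OneMark.exists_isMarkAt (hM : ∀ e ∈ F, 1 ≤ M e)
    (h : OneMark G sp F M u) (hs : Saturated G sp F M u) (hy : Conn G F u y) :
    ∃ h m, IsMarkAt G sp F M u y h m := by
  by_cases hsp : ∃ x, sp x ∧ Conn G F u x
  · obtain ⟨x, hx, hux⟩ := hsp
    refine ⟨x, 0, hux, Or.inl ⟨hx, rfl⟩, fun e he hi => ?_,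
      fun x' hx' hux' => h.sp_unique x' x hx' hx hux' hux⟩
    have := h.sp_le x e hx hux he hi
    have := hM e he
    simp
    omega
  · obtain ⟨e, he, hi, h2⟩ := hs.resolve_left hsp
    push Not at hsp
    have hw : Weighted G F M u {e} := fun f hf hif => by
      by_cases hfe : f = e
      · subst hfe
        have := h.le_two f hf hif
        simp
        omega
      · rw [Multiset.count_eq_zero_of_notMem (by simpa using hfe)]
        have := hM f hf
        by_contra hne
        exact hfe (h.unique f hf e he hif hi (by omega) h2)
    have key : ∀ p q, G.IsLink e p q → Conn G (F.erase e) q y →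
        ∃ h m, IsMarkAt G sp F M u y h m := fun p q hl hc => by
      have hup := hi.conn_of_isLink he hl
      exact ⟨p, {e}, hup, Or.inr ⟨fun hp => hsp p hp hup, e, q, ⟨he, hl, Conn.refl p, hc⟩, rfl⟩,
        hw, fun x hx hc => absurd hc (hsp x hx)⟩
    have hi' := hi
    obtain ⟨p, q, hl, hup⟩ := hi'
    have hpy : Conn G F p y := hup.symm.trans hy
    rcases hpy.erase_cases hl with hc | ⟨-, hc⟩ | ⟨-, hc⟩
    · exact key q p hl.symm hc
    · exact key p q hl hc
    · exact key q p hl.symm hc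

/-- The second mark is put on `y` and raises the first edge on the way from `y` to `a`. Any special
vertex of the component is `a`, so `y` is normal. -/
lemma IsMarkAt.twoMarks_add_single (hτ : ∀ x, τ x < 3) (h : IsMarkAt G sp F M u y a m)
    (hy : Conn G F u y) (hne : τ a ≠ τ y) :
    ∃ f ∈ F, InComp G F u f ∧ ∃ r, τ a ≠ r ∧ τ y ≠ r ∧
      TwoMarks G τ sp F (M + Finsupp.single f 1) r u := by
  have hya : y ≠ a := fun h => hne (h ▸ rfl)
  have hay := h.conn.symm.trans hy
  obtain ⟨f, b, hd⟩ := exists_first_onDart hay.symm hya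
  obtain ⟨r, hr, hr₁, hr₂⟩ := exists_third hτ a y
  refine ⟨f, hd.mem, hd.inComp.trans hy, r, hr₁, hr₂, a, y, m, {f}, h.conn,
    ⟨hay, hne, hr₁, hr₂, hr, fun x hx hc => Or.inl (h.sp_eq x hx (h.conn.trans hc)), h.toEdge,
      Or.inr ⟨fun hy' => hya (h.sp_eq y hy' hy), f, b, hd, rfl⟩⟩, ?_⟩
  exact h.weighted.add_single.of_conn h.conn

/-- A component with one mark that has a vertex of type `r` and a vertex of another type can be
turned into a component with two marks, one of them of type `r`. -/
lemma OneMark.twoMarks_add_single (hτ : ∀ x, τ x < 3) (hM : ∀ e ∈ F, 1 ≤ M e)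
    (h : OneMark G sp F M u) (hs : Saturated G sp F M u) (hy : Conn G F u y) (hz : Conn G F u z)
    (hyr : τ y = r) (hzr : τ z ≠ r) :
    ∃ f ∈ F, InComp G F u f ∧ ∃ r', r ≠ r' ∧
      TwoMarks G τ sp F (M + Finsupp.single f 1) r' u := by
  obtain ⟨a, m, ha⟩ := h.exists_isMarkAt hM hs hy
  by_cases hay : τ a = τ y
  swap
  · obtain ⟨f, hf, hi, r', -, hr', h⟩ := ha.twoMarks_add_single hτ hy hay
    exact ⟨f, hf, hi, r', hyr ▸ hr', h⟩
  obtain ⟨b, m', hb⟩ := h.exists_isMarkAt hM hs hz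
  by_cases hbr : τ b = r
  · obtain ⟨f, hf, hi, r', hr', -, h⟩ := hb.twoMarks_add_single hτ hz
      (by rw [hbr]; exact Ne.symm hzr)
    exact ⟨f, hf, hi, r', hbr ▸ hr', h⟩
  -- In the remaining case the mark seen from `y` has type `r` and the one seen from `z` has not.
  -- They are then the two ends of the edge of weight two, and marking both ends raises that edge to
  -- weight three.
  have har : τ a = r := hay.trans hyr
  have hab : a ≠ b := by
    rintro rfl
    exact hbr har
  rcases ha.toEdge with ⟨hsa, -⟩ | ⟨hsa, e, c, hd, rfl⟩
  · exact absurd (hb.sp_eq a hsa ha.conn) hab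
  rcases hb.toEdge with ⟨hsb, -⟩ | ⟨hsb, e', c', hd', rfl⟩
  · exact absurd (ha.sp_eq b hsb hb.conn).symm hab
  have hie := hd.inComp.trans ha.conn
  have hee : e = e' := by
    have h1 := ha.weighted e hd.mem hie
    rw [hb.weighted e hd.mem hie, Multiset.count_singleton_self] at h1
    have : e ∈ ({e'} : Multiset β) := Multiset.count_pos.1 (by omega)
    exact Multiset.mem_singleton.1 this
  subst hee
  have hl : G.IsLink e a b := by
    rcases hd.isLink.eq_and_eq_or_eq_and_eq hd'.isLink with ⟨h, -⟩ | ⟨-, h⟩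
    · exact absurd h hab
    · exact h ▸ hd.isLink
  obtain ⟨r', hr, hr₁, hr₂⟩ := exists_third hτ a b
  refine ⟨e, hd.mem, hie, r', har ▸ hr₁, a, b, {e}, {e}, ha.conn,
    ⟨conn_of_isLink hd.mem hl, har ▸ Ne.symm hbr, hr₁, hr₂, hr,
      fun x hx hc => Or.inl (ha.sp_eq x hx (ha.conn.trans hc)),
      Or.inr ⟨hsa, e, b, ⟨hd.mem, hl, Conn.refl a, Conn.refl b⟩, rfl⟩,
      Or.inr ⟨hsb, e, a, ⟨hd.mem, hl.symm, Conn.refl b, Conn.refl a⟩, rfl⟩⟩, ?_⟩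
  exact ha.weighted.add_single.of_conn ha.conn

end Extension

section Insertion

variable {α β : Type*} [DecidableEq β] {G : Graph α β} {τ : α → ℕ} {sp : α → Prop}
  {F F' : Finset β} {M M' : β →₀ ℕ} {u u₀ v w x y z a b c h p q : α} {e f g : β}
  {m m' mv mw mz mp mq : Multiset β} {r : ℕ}

/-! #### Adding an edge -/

lemma Conn.of_insert (hc : Conn G (insert g F) v w) (hl : G.IsLink g p q) (hp : ¬ Conn G F v p)
    (hq : ¬ Conn G F v q) : Conn G F v w := by
  rcases hc.insert_cases hl with h | ⟨h, -⟩ | ⟨h, -⟩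
  exacts [h, absurd h hp, absurd h hq]

lemma InComp.of_insert (hi : InComp G (insert g F) v e) (hl : G.IsLink g p q)
    (hp : ¬ Conn G F v p) (hq : ¬ Conn G F v q) : InComp G F v e := by
  obtain ⟨a, b, hl', h⟩ := hi
  exact ⟨a, b, hl', h.of_insert hl hp hq⟩

omit [DecidableEq β] in
lemma InComp.ne_of_not_conn (hi : InComp G F v e) (hl : G.IsLink g p q)
    (hp : ¬ Conn G F v p) (hq : ¬ Conn G F v q) : e ≠ g := by
  rintro rfl
  obtain ⟨a, b, hl', h⟩ := hi
  rcases hl'.left_eq_or_eq hl with rfl | rfl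
  exacts [hp h, hq h]

omit [DecidableEq β] in
lemma add_single_apply_of_ne (h : e ≠ g) : (M + Finsupp.single g 1 : β →₀ ℕ) e = M e := by
  rw [Finsupp.add_apply, Finsupp.single_eq_of_ne h, add_zero]

lemma Weighted.insert_edge (h : Weighted G F M v m) (hl : G.IsLink g p q)
    (hp : ¬ Conn G F v p) (hq : ¬ Conn G F v q) :
    Weighted G (insert g F) (M + Finsupp.single g 1) v m := by
  intro e he hi
  have hi' := hi.of_insert hl hp hq
  have hne := hi'.ne_of_not_conn hl hp hq
  rw [add_single_apply_of_ne hne]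
  exact h e ((Finset.mem_insert.1 he).resolve_left hne) hi'

lemma OneMark.insert_edge (h : OneMark G sp F M v) (hl : G.IsLink g p q)
    (hp : ¬ Conn G F v p) (hq : ¬ Conn G F v q) :
    OneMark G sp (insert g F) (M + Finsupp.single g 1) v := by
  have key : ∀ e ∈ insert g F, InComp G (insert g F) v e →
      e ∈ F ∧ InComp G F v e ∧ (M + Finsupp.single g 1 : β →₀ ℕ) e = M e := by
    intro e he hi
    have hi' := hi.of_insert hl hp hq
    have hne := hi'.ne_of_not_conn hl hp hq
    exact ⟨(Finset.mem_insert.1 he).resolve_left hne, hi', add_single_apply_of_ne hne⟩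
  refine ⟨fun a b ha hb hca hcb => h.sp_unique a b ha hb (hca.of_insert hl hp hq)
    (hcb.of_insert hl hp hq), fun a e ha hc he hi => ?_, fun e he hi => ?_,
    fun e he e' he' hi hi' => ?_⟩
  · obtain ⟨he, hi, hM⟩ := key e he hi
    exact hM ▸ h.sp_le a e ha (hc.of_insert hl hp hq) he hi
  · obtain ⟨he, hi, hM⟩ := key e he hi
    exact hM ▸ h.le_two e he hi
  · obtain ⟨he, hi, hM⟩ := key e he hi
    obtain ⟨he', hi', hM'⟩ := key e' he' hi'
    rw [hM, hM']
    exact h.unique e he e' he' hi hi'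

lemma FirstDart.insert_edge (hF : IsForest G (insert g F)) {P : α → α → Prop}
    (h : FirstDart G F x y P e a b) : FirstDart G (insert g F) x y P e a b :=
  have hs := Finset.subset_insert g F
  ⟨h.dart.mono hs, h.prop, fun f c d hd =>
    h.first f c d (hd.restrict hF hs h.dart.conn_left)⟩

lemma IsPairAt.insert_edge (h : IsPairAt G τ sp F v w mv mw r)
    (hsp : ∀ x, sp x → Conn G (insert g F) v x → Conn G F v x) :
    IsPairAt G τ sp (insert g F) v w mv mw r :=
  have hs := Finset.subset_insert g F
  ⟨h.conn.mono hs, h.ne, h.ne_left, h.ne_right, h.lt, fun x hx hc => h.sp_mem x hx (hsp x hx hc),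
    h.left.mono hs, h.right.mono hs⟩

lemma IsTripodAt.insert_edge (h : IsTripodAt G τ sp F v w z mv mw mz)
    (hsp : ∀ x, sp x → Conn G (insert g F) v x → Conn G F v x) :
    IsTripodAt G τ sp (insert g F) v w z mv mw mz :=
  have hs := Finset.subset_insert g F
  ⟨h.conn₁.mono hs, h.conn₂.mono hs, h.ne₁, h.ne₂, h.ne₃,
    fun x hx hc => h.sp_mem x hx (hsp x hx hc), h.toEdge₁.mono hs, h.toEdge₂.mono hs,
    h.toEdge₃.mono hs, h.leaf₁.imp_right fun hb hb' => hb (hb'.restrict hs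
      (h.conn₁.symm.trans h.conn₂)), h.leaf₂.imp_right fun hb hb' => hb (hb'.restrict hs
      h.conn₂.symm), h.leaf₃.imp_right fun hb hb' => hb (hb'.restrict hs h.conn₁)⟩

lemma IsSandwichAt.insert_edge (hF : IsForest G (insert g F))
    (h : IsSandwichAt G τ sp F v w z mv mw e a b)
    (hsp : ∀ x, sp x → Conn G (insert g F) v x → Conn G F v x) :
    IsSandwichAt G τ sp (insert g F) v w z mv mw e a b :=
  have hs := Finset.subset_insert g F
  ⟨h.lt, h.btw.mono hF hs, h.mid, fun x hx hc => h.sp_mem x hx (hsp x hx hc),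
    h.left.mono hs, h.right.mono hs, h.first.insert_edge hF⟩

/-- Every configuration in the component of `u` remains one when an edge is added, provided the
weights and the special vertices of the component remain the same. -/
lemma TwoMarks.insert_edge (h : TwoMarks G τ sp F M r u)
    (hsp : ∀ x, sp x → Conn G (insert g F) u x → Conn G F u x)
    (hw : ∀ v m, Conn G F u v → (∀ f ∈ m, f ∈ F) → Weighted G F M v m →
      Weighted G (insert g F) M' v m) :
    TwoMarks G τ sp (insert g F) M' r u := by
  have hs := Finset.subset_insert g F
  obtain ⟨v, w, mv, mw, huv, hp, hvw⟩ := h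
  refine ⟨v, w, mv, mw, huv.mono hs, hp.insert_edge fun x hx hc =>
    huv.symm.trans (hsp x hx ((huv.mono hs).trans hc)), hw v _ huv (fun f hf => ?_) hvw⟩
  rcases Multiset.mem_add.1 hf with hf | hf
  exacts [(hp.left.exists_isLink hf).1, (hp.right.exists_isLink hf).1]

lemma ThreeMarks.insert_edge (hF : IsForest G (insert g F)) (h : ThreeMarks G τ sp F M u)
    (hsp : ∀ x, sp x → Conn G (insert g F) u x → Conn G F u x)
    (hw : ∀ v m, Conn G F u v → (∀ f ∈ m, f ∈ F) → Weighted G F M v m →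
      Weighted G (insert g F) M' v m) :
    ThreeMarks G τ sp (insert g F) M' u := by
  have hs := Finset.subset_insert g F
  rcases h with ⟨v, w, z, mv, mw, mz, huv, h, hvw⟩ | ⟨v, w, z, mv, mw, e₀, a, b, huv, h, hvw⟩
  · refine Or.inl ⟨v, w, z, mv, mw, mz, huv.mono hs, h.insert_edge fun x hx hc =>
      huv.symm.trans (hsp x hx ((huv.mono hs).trans hc)), hw v _ huv (fun f hf => ?_) hvw⟩
    rcases Multiset.mem_add.1 hf with hf | hf
    · rcases Multiset.mem_add.1 hf with hf | hf
      exacts [(h.toEdge₁.exists_isLink hf).1, (h.toEdge₂.exists_isLink hf).1]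
    · exact (h.toEdge₃.exists_isLink hf).1
  · refine Or.inr ⟨v, w, z, mv, mw, e₀, a, b, huv.mono hs, h.insert_edge hF fun x hx hc =>
      huv.symm.trans (hsp x hx ((huv.mono hs).trans hc)), hw v _ huv (fun f hf => ?_) hvw⟩
    rcases Multiset.mem_add.1 hf with hf | hf
    · rcases Multiset.mem_add.1 hf with hf | hf
      exacts [(h.left.exists_isLink hf).1, (h.right.exists_isLink hf).1]
    · rw [Multiset.mem_singleton.1 hf]
      exact h.first.dart.mem

lemma TwoMarks.insert_edge_of_not_conn (h : TwoMarks G τ sp F M r u) (hl : G.IsLink g p q)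
    (hp : ¬ Conn G F u p) (hq : ¬ Conn G F u q) :
    TwoMarks G τ sp (insert g F) (M + Finsupp.single g 1) r u :=
  h.insert_edge (fun _ _ hc => hc.of_insert hl hp hq) fun _ _ hc _ hw =>
    hw.insert_edge hl (fun h => hp (hc.trans h)) fun h => hq (hc.trans h)

/-- Joining two components by an edge. -/
lemma Weighted.join (hp : Weighted G F M p mp) (hq : Weighted G F M q mq)
    (hl : G.IsLink g p q) (hpq : ¬ Conn G F p q) (hMg : M g = 0)
    (hmp : ∀ f ∈ mp, f ∈ F ∧ InComp G F p f) (hmq : ∀ f ∈ mq, f ∈ F ∧ InComp G F q f) :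
    Weighted G (insert g F) (M + Finsupp.single g 1) p (mp + mq) := by
  have hg : g ∉ F := fun hg => hpq (conn_of_isLink hg hl)
  intro e he hi
  rw [Multiset.count_add]
  by_cases heg : e = g
  · subst heg
    rw [Finsupp.add_apply, hMg, Finsupp.single_eq_same,
      Multiset.count_eq_zero_of_notMem fun h => hg (hmp _ h).1,
      Multiset.count_eq_zero_of_notMem fun h => hg (hmq _ h).1]
  · have heF := (Finset.mem_insert.1 he).resolve_left heg
    rw [add_single_apply_of_ne heg]
    obtain ⟨a, b, hab, hpa⟩ := hi
    have : Conn G F p a ∨ Conn G F q a := by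
      rcases hpa.insert_cases hl with h | ⟨-, h⟩ | ⟨-, h⟩
      exacts [.inl h, .inr h, .inl h]
    rcases this with h | h
    · have hi : InComp G F p e := ⟨a, b, hab, h⟩
      rw [hp e heF hi, Multiset.count_eq_zero_of_notMem
        fun h => hpq (hi.conn (hmq e h).2 heF), add_zero]
    · have hi : InComp G F q e := ⟨a, b, hab, h⟩
      rw [hq e heF hi, Multiset.count_eq_zero_of_notMem
        fun h => hpq ((hmp e h).2.conn hi heF), zero_add]

/-- Attaching an isolated normal vertex. -/
lemma IsConfig.attach (hF : IsForest G F) (h : IsConfig G τ sp F M) (hl : G.IsLink g x y)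
    (hxy : x ≠ y) (hx : ∀ e ∈ F, ∀ z, ¬ G.IsLink e x z) (hsx : ¬ sp x) (hMg : M g = 0) :
    IsConfig G τ sp (insert g F) (M + Finsupp.single g 1) := by
  have hs := Finset.subset_insert g F
  have hiso : ∀ z, Conn G F x z → x = z := by
    intro z hz
    by_contra hne
    obtain ⟨e, he, c, -, hl⟩ := hz.eq_or_exists_isLink hne
    exact hx e he c hl
  have hnc : ¬ Conn G F y x := fun h => hxy (hiso y h.symm)
  have hF' : IsForest G (insert g F) := hF.insert_edge hl fun h => hnc h.symm
  -- `x` is a leaf of the new forest, so connections between other vertices do not use `g`.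
  have hback : ∀ v w, v ≠ x → w ≠ x → Conn G (insert g F) v w → Conn G F v w := by
    intro v w hv hw hc
    rcases hc.insert_cases hl with h | ⟨h, -⟩ | ⟨-, h⟩
    exacts [h, absurd (hiso v h.symm).symm hv, absurd (hiso w h).symm hw]
  have hgF : g ∉ F := fun hg => hx g hg y hl
  have h₁ : ∀ v, v ≠ x → OneMark G sp F M v →
      OneMark G sp (insert g F) (M + Finsupp.single g 1) v := by
    intro v hv ho
    have hsp : ∀ a, sp a → Conn G (insert g F) v a → Conn G F v a := fun a ha =>
      hback v a hv (by rintro rfl; exact hsx ha)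
    have key : ∀ e ∈ insert g F, InComp G (insert g F) v e → e ≠ g →
        e ∈ F ∧ InComp G F v e ∧ (M + Finsupp.single g 1 : β →₀ ℕ) e = M e := by
      rintro e he ⟨a, b, hab, hc⟩ hne
      have heF := (Finset.mem_insert.1 he).resolve_left hne
      exact ⟨heF, ⟨a, b, hab, hback v a hv (by rintro rfl; exact hx e heF b hab) hc⟩,
        add_single_apply_of_ne hne⟩
    have hg1 : (M + Finsupp.single g 1 : β →₀ ℕ) g = 1 := by simp [hMg]
    refine ⟨fun a b ha hb hca hcb => ho.sp_unique a b ha hb (hsp a ha hca) (hsp b hb hcb),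
      fun a e ha hc he hi => ?_, fun e he hi => ?_, fun e he e' he' hi hi' h2 h2' => ?_⟩
    · by_cases heg : e = g
      · rw [heg, hg1]
      · obtain ⟨he, hi, hM⟩ := key e he hi heg
        exact hM ▸ ho.sp_le a e ha (hsp a ha hc) he hi
    · by_cases heg : e = g
      · rw [heg, hg1]
        omega
      · obtain ⟨he, hi, hM⟩ := key e he hi heg
        exact hM ▸ ho.le_two e he hi
    · have heg : e ≠ g := by
        rintro rfl
        omega
      have heg' : e' ≠ g := by
        rintro rfl
        omega
      obtain ⟨he, hi, hM⟩ := key e he hi heg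
      obtain ⟨he', hi', hM'⟩ := key e' he' hi' heg'
      exact ho.unique e he e' he' hi hi' (hM ▸ h2) (hM' ▸ h2')
  have hyx : Conn G (insert g F) y x := (conn_of_isLink (Finset.mem_insert_self g F) hl).symm
  have h₁x : OneMark G sp F M y → OneMark G sp (insert g F) (M + Finsupp.single g 1) x :=
    fun h => (h₁ y hxy.symm h).of_conn hyx
  have hw : ∀ u, u ≠ x → ∀ v m, Conn G F u v → (∀ f ∈ m, f ∈ F) → Weighted G F M v m →
      Weighted G (insert g F) (M + Finsupp.single g 1) v m := by
    rintro u hu v m huv hm hw e he ⟨a, b, hab, hc⟩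
    have hv : v ≠ x := by
      rintro rfl
      exact hu (hiso u huv.symm).symm
    by_cases heg : e = g
    · subst heg
      rw [Finsupp.add_apply, hMg, Finsupp.single_eq_same,
        Multiset.count_eq_zero_of_notMem fun h => hgF (hm _ h)]
    · have heF := (Finset.mem_insert.1 he).resolve_left heg
      rw [add_single_apply_of_ne heg]
      exact hw e heF ⟨a, b, hab, hback v a hv (by rintro rfl; exact hx e heF b hab) hc⟩
  have hspu : ∀ u, u ≠ x → ∀ a, sp a → Conn G (insert g F) u a → Conn G F u a :=
    fun u hu a ha => hback u a hu (by rintro rfl; exact hsx ha)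
  -- A component with marks of two types is not the single vertex `x`.
  have h₂ : ∀ u r, TwoMarks G τ sp F M r u → u ≠ x := by
    rintro u r ⟨v, w, mv, mw, huv, hp, -⟩ rfl
    obtain rfl := hiso v huv
    exact hp.ne (congrArg τ (hiso w hp.conn))
  have h₃ : ∀ u, ThreeMarks G τ sp F M u → u ≠ x := by
    rintro u (⟨v, w, z, mv, mw, mz, huv, hp, -⟩ | ⟨v, w, z, mv, mw, e₀, a, b, huv, hp, -⟩) rfl
    · obtain rfl := hiso v huv
      exact hp.ne₁ (congrArg τ (hiso w hp.conn₁))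
    · obtain rfl := hiso v huv
      exact hp.lt.ne (congrArg τ (hiso w hp.btw.1))
  have hoth : ∀ u, (∀ v, ¬ Conn G F u v → OneMark G sp F M v) → ∀ v, ¬ Conn G (insert g F) u v →
      OneMark G sp (insert g F) (M + Finsupp.single g 1) v := by
    intro u ho v hv
    by_cases hvx : v = x
    · subst hvx
      exact h₁x (ho y fun h => hv ((h.mono hs).trans hyx))
    · exact h₁ v hvx (ho v fun h => hv (h.mono hs))
  rcases h.cases with ho | ⟨u, r, hu, ho⟩ | ⟨u, hu, ho⟩ | ⟨u, u', r, r', hr, -, hu, hu', ho⟩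
  · refine isConfig_of_oneMark x fun v => ?_
    by_cases hv : v = x
    exacts [hv ▸ h₁x (ho y), h₁ v hv (ho v)]
  · have hux := h₂ u r hu
    exact isConfig_of_twoMarks (hu.insert_edge (hspu u hux) (hw u hux)) (hoth u ho)
  · have hux := h₃ u hu
    exact Or.inl ⟨u, hu.insert_edge hF' (hspu u hux) (hw u hux), hoth u ho⟩
  · have hux := h₂ u r hu
    have hux' := h₂ u' r' hu'
    refine Or.inr ⟨u, u', r, r', hr, Or.inr (hu.insert_edge (hspu u hux) (hw u hux)),
      Or.inr (Or.inr (hu'.insert_edge (hspu u' hux') (hw u' hux'))), fun v hv hv' => ?_⟩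
    by_cases hvx : v = x
    · subst hvx
      exact h₁x (ho y (fun h => hv ((h.mono hs).trans hyx)) fun h => hv' ((h.mono hs).trans hyx))
    · exact h₁ v hvx (ho v (fun h => hv (h.mono hs)) fun h => hv' (h.mono hs))

/-- Joining two components with one mark each whose marks have different types. -/
lemma IsMarkAt.join (hτ : ∀ x, τ x < 3) (hF : IsForest G F) (hp : IsMarkAt G sp F M p p v mp)
    (hq : IsMarkAt G sp F M q q w mq) (hl : G.IsLink g p q) (hpq : ¬ Conn G F p q)
    (hMg : M g = 0) (hne : τ v ≠ τ w) :
    ∃ r, τ v ≠ r ∧ τ w ≠ r ∧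
      TwoMarks G τ sp (insert g F) (M + Finsupp.single g 1) r p := by
  have hs := Finset.subset_insert g F
  have hF' := hF.insert_edge hl hpq
  have hgF : g ∉ F := fun hg => hpq (conn_of_isLink hg hl)
  have hd : OnDart G (insert g F) v w g p q := by
    refine ⟨Finset.mem_insert_self g F, hl, ?_, ?_⟩
    · rw [Finset.erase_insert hgF]
      exact hp.conn.symm
    · rw [Finset.erase_insert hgF]
      exact hq.conn
  obtain ⟨r, hr, hr₁, hr₂⟩ := exists_third hτ v w
  refine ⟨r, hr₁, hr₂, v, w, mp, mq, hp.conn.mono hs, ⟨hd.conn, hne, hr₁, hr₂, hr,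
    fun x hx hc => ?_, (hp.toEdge.mono hs).to_btw hF' (hd.btw_left hF'),
    (hq.toEdge.mono hs).to_btw hF' (hd.btw_right hF').symm⟩, ?_⟩
  · rcases hc.insert_cases hl with h | ⟨-, h⟩ | ⟨-, h⟩
    · exact Or.inl (hp.sp_eq x hx (hp.conn.trans h))
    · exact Or.inr (hq.sp_eq x hx h)
    · exact Or.inl (hp.sp_eq x hx h)
  · refine (hp.weighted.join hq.weighted hl hpq hMg (fun f hf => ?_) fun f hf => ?_).of_conn
      (hp.conn.mono hs)
    · exact ⟨(hp.toEdge.exists_isLink hf).1, (hp.toEdge.inComp hf F).trans hp.conn⟩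
    · exact ⟨(hq.toEdge.exists_isLink hf).1, (hq.toEdge.inComp hf F).trans hq.conn⟩

end Insertion

/-! #### Adding a third mark -/

section ThirdMark

variable {α β : Type*} [DecidableEq β] {G : Graph α β} {τ : α → ℕ} {sp : α → Prop}
  {F F' : Finset β} {M M' : β →₀ ℕ} {u u₀ v w x y z a b c h p q o : α} {e f g : β}
  {m m' mv mw mz mp mq : Multiset β} {r : ℕ}

/-- On a path that has only vertices of the types `0` and `t`, there is a last vertex of type `0`
(or else one may take the first vertex of the path). -/
lemma exists_last_of_type_zero (hF : IsForest G F) {t : ℕ} (hc : Conn G F v w)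
    (h : ∀ y, Btw G F v w y → τ y = 0 ∨ τ y = t) :
    ∃ y, Btw G F v w y ∧ (y = v ∨ τ y = 0) ∧ ∀ f c d, OnDart G F y w f c d → τ d = t := by
  have key : ∀ S ⊆ F, ∀ y, Btw G F v w y → (y = v ∨ τ y = 0) → Conn G S y w →
      ∃ y, Btw G F v w y ∧ (y = v ∨ τ y = 0) ∧ ∀ f c d, OnDart G F y w f c d → τ d = t := by
    intro S
    induction S using Finset.strongInduction with
    | H S ih =>
      intro hS y hy hy' hyw
      by_cases hg : ∀ f c d, OnDart G F y w f c d → τ d = t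
      · exact ⟨y, hy, hy', hg⟩
      -- A later vertex whose type is not `t` has type `0`; the search restarts from it with fewer
      -- edges.
      · push Not at hg
        obtain ⟨f, c, d, hd, hdt⟩ := hg
        have hd' := hd.restrict hF hS hyw
        have hvd := hy.trans_right (hd.btw_right hF)
        exact ih _ (Finset.erase_ssubset hd'.mem) ((Finset.erase_subset _ _).trans hS) d hvd
          (Or.inr ((h d hvd).resolve_right hdt)) hd'.right
  exact key F subset_rfl v (btw_left hc) (Or.inl rfl) hc

/-- The weights are given and a legal position of three marks has to be found. If no mark is between
the others, or `v` is between them and special, this is a tripod. If `v` is normal and between `w`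
and `z`, it becomes the middle mark, and its own edge is admissible at once: `v` does not have the
type of `w`, and its next vertex, lying between `v` and `w`, does not have the type of `z`. The same
works for `w` between `v` and `z` provided that the type of `v` is smaller than that of `z`. -/
lemma threeMarks_of_off_path (hF : IsForest G F) (hτ : ∀ x, τ x < 3) (hsp₀ : ∀ x, sp x → τ x ≠ 0)
    (hvw : Conn G F v w) (hvz : Conn G F v z) (hτw : τ w = 0) (hτv : τ v ≠ 0) (hτz : τ z ≠ 0)
    (hne : τ v ≠ τ z) (hsp : ∀ x, sp x → Conn G F v x → x = v ∨ x = w ∨ x = z)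
    (hv : ToEdge G sp F v w mv) (hw : ToEdge G sp F w v mw) (hz : ToEdge G sp F z v mz)
    (hpath : ∀ y, Btw G F v w y → τ y ≠ τ z) (hW : Weighted G F M v (mv + mw + mz)) :
    ThreeMarks G τ sp F M v := by
  have hne_zw : z ≠ w := fun h => hτz (h ▸ hτw)
  have hne_zv : z ≠ v := fun h => hne (h ▸ rfl)
  have hne_vw : v ≠ w := fun h => hτv (h ▸ hτw)
  have hsw : ¬ sp w := fun h => hsp₀ w h hτw
  have hzpath : ¬ Btw G F v w z := fun h => hpath z h rfl
  have hzw : ToEdge G sp F z w mz :=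
    hz.of_not_btw hF (hvz.symm.trans hvw) hne_zw.symm (Or.inr hzpath)
  by_cases hbv : Btw G F w z v
  · rcases hv with ⟨hsv, rfl⟩ | ⟨hsv, e, v', hd, rfl⟩
    · refine Or.inl ⟨v, w, z, 0, mw, mz, Conn.refl v, ⟨hvw, hvz, by omega, by omega,
        hne.symm, hsp, Or.inl ⟨hsv, rfl⟩, hw.to_btw hF hbv, hz, Or.inl hsv,
        Or.inr fun hb => hne_vw (hbv.antisymm hF hb), Or.inr hzpath⟩, hW⟩
    · refine Or.inr ⟨w, z, v, mw, mz, e, v, v', hvw, ⟨by omega, hbv,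
        Or.inl ⟨hsv, by omega, hne⟩, fun x hx hc => ?_, hw.to_btw hF hbv, hzw, hd,
        ⟨?_, by omega⟩, fun f c d hd => absurd hd (OnDart.not_self hF)⟩, ?_⟩
      · rcases hsp x hx (hvw.trans hc) with rfl | h
        exacts [absurd hx hsv, h]
      · exact hpath v' (hd.btw_right hF)
      · rw [add_assoc, add_comm] at hW
        exact hW.of_conn hvw
  · by_cases hbw : Btw G F z v w
    · obtain ⟨-, e, w', hd, rfl⟩ := hw.resolve_left fun h => hsw h.1
      have hw'path := (hd.btw_right hF).symm
      have hz2 := hτ z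
      have hv2 := hτ v
      by_cases hlt : τ v < τ z
      · refine Or.inr ⟨v, z, w, mv, mz, e, w, w', Conn.refl v, ⟨hlt, hbw.symm,
          Or.inl ⟨hsw, by omega, by omega⟩, fun x hx hc => ?_, hv.to_btw hF hbw.symm, hz, hd,
          ⟨hpath w' hw'path, by omega⟩, fun f c d hd => absurd hd (OnDart.not_self hF)⟩, ?_⟩
        · rcases hsp x hx hc with rfl | rfl | h
          exacts [.inl rfl, absurd hx hsw, .inr h]
        · rwa [add_right_comm] at hW
      -- Now the middle edge is searched for in the direction of `z`, whereas the edge `e` of `w`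
      -- points to `v`. The middle mark is moved to the last vertex `y` of type `0` on the way from
      -- `v` to `w'`, or to `v` itself as an extra mark. From `y` to `w'` every edge ends in a
      -- vertex of type `2`, so `e` is the first admissible edge.
      · have hv2 : τ v = 2 := by omega
        have hz1 : τ z = 1 := by omega
        have htypes : ∀ y, Btw G F v w' y → τ y = 0 ∨ τ y = 2 := by
          intro y hy
          have h1 : τ y ≠ τ z := hpath y (hw'path.trans_left hy)
          have h2 : τ y < 3 := hτ y
          rw [hz1] at h1
          clear * - h1 h2
          omega
        obtain ⟨y, hy, hy', hlast⟩ := exists_last_of_type_zero hF hw'path.conn_left htypes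
        have hyv : Btw G F v w y := hw'path.trans_left hy
        have hdart : OnDart G F y z e w' w := by
          have hd' := hd.symm.trans_left hF hbw.symm
          exact ⟨hd.mem, hd.isLink.symm,
            (hy.symm.2 _ (Finset.erase_subset e F) hd.right).symm, hd'.right⟩
        refine Or.inr ⟨z, v, y, mz, mv, e, w', w, hvz, ⟨by omega, hbw.trans_right hyv.symm,
          ?_, fun x hx hc => ?_, hz, hv.to_btw hF hbw.symm, hdart, ⟨by omega, ?_⟩,
          fun f c d hd h => h.1 ((hlast f c d hd).trans hv2.symm)⟩, ?_⟩
        · by_cases hyv' : y = v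
          · exact Or.inr ⟨hyv', hz1, hv2⟩
          · have hy0 := hy'.resolve_left hyv'
            exact Or.inl ⟨fun h => hsp₀ y h hy0, by rw [hy0]; exact hτz.symm,
              by rw [hy0]; exact hτv.symm⟩
        · rcases hsp x hx (hvz.trans hc) with rfl | rfl | h
          exacts [.inr rfl, absurd hx hsw, .inl h]
        · exact hpath w' hw'path
        · rw [add_right_comm, add_comm mv mz] at hW
          exact hW.of_conn hvz
    · have hwz : ToEdge G sp F w z mw :=
        hw.of_not_btw hF (hvw.symm.trans hvz) hne_zw (Or.inr fun h => hbw h.symm)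
      exact Or.inl ⟨v, w, z, mv, mw, mz, Conn.refl v, ⟨hvw, hvz, by omega, by omega, hne.symm,
        hsp, hv, hwz, hz, Or.inr hbv, Or.inr hbw, Or.inr hzpath⟩, hW⟩

/-- The path from `z` to `v` has an edge passing from a type other than that of `v` to the type of
`v`. This edge is admissible, so a first admissible edge exists, and the third mark raises its
weight. -/
lemma IsPairAt.exists_sandwich (hF : IsForest G F) (h : IsPairAt G τ sp F v w mv mw r)
    (hlt : τ v < τ w) (hz : Btw G F v w z)
    (hmid : (¬ sp z ∧ τ z ≠ τ v ∧ τ z ≠ τ w) ∨ (z = w ∧ τ v = 1 ∧ τ w = 2))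
    (hW : Weighted G F M v (mv + mw)) :
    ∃ f ∈ F, InComp G F v f ∧ ThreeMarks G τ sp F (M + Finsupp.single f 1) v := by
  have hzv : τ z ≠ τ v := by
    rcases hmid with h | ⟨rfl, -⟩
    exacts [h.2.1, hlt.ne']
  obtain ⟨e, a, b, hd, ha, hb⟩ :=
    exists_onDart_switch (P := fun x => τ x ≠ τ v) hF hz.conn_left.symm hzv (by simp)
  obtain ⟨f, c, d, hf⟩ := exists_firstDart (P := fun a b => τ b ≠ τ w ∧ τ a ≠ τ v) hF hd
    ⟨by rw [not_not.1 hb]; exact hlt.ne, ha⟩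
  exact ⟨f, hf.dart.mem, hf.dart.inComp.trans hz.conn_left, Or.inr ⟨v, w, z, mv, mw, f, c, d,
    Conn.refl v, ⟨hlt, hz, hmid, h.sp_mem, h.left, h.right, hf⟩, hW.add_single⟩⟩

/-- If a component with two marks contains a vertex of the third type, or the types of the marks
are `1` and `2`, then a third mark can be added. -/
lemma IsPairAt.exists_threeMarks (hF : IsForest G F) (hτ : ∀ x, τ x < 3)
    (hsp₀ : ∀ x, sp x → τ x ≠ 0) (h : IsPairAt G τ sp F v w mv mw r)
    (hW : Weighted G F M v (mv + mw)) (hr : r = 0 ∨ ∃ z, Conn G F v z ∧ τ z = r) :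
    ∃ f ∈ F, InComp G F v f ∧ ThreeMarks G τ sp F (M + Finsupp.single f 1) v := by
  wlog hlt : τ v < τ w generalizing v w mv mw
  · obtain ⟨f, hf, hi, ht⟩ := this h.symm (by rw [add_comm]; exact hW.of_conn h.conn)
      (hr.imp_right fun ⟨z, hz, hzr⟩ => ⟨z, h.conn.symm.trans hz, hzr⟩)
      (lt_of_le_of_ne (not_lt.1 hlt) h.ne.symm)
    refine ⟨f, hf, hi.trans h.conn, ?_⟩
    rcases ht with ⟨a, b, c, ma, mb, mc, hwa, ht⟩ | ⟨a, b, c, ma, mb, e, p, q, hwa, ht⟩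
    exacts [Or.inl ⟨a, b, c, ma, mb, mc, h.conn.trans hwa, ht⟩,
      Or.inr ⟨a, b, c, ma, mb, e, p, q, h.conn.trans hwa, ht⟩]
  have hv := hτ v
  have hw := hτ w
  have hv' := h.ne_left
  have hw' := h.ne_right
  have hr3 := h.lt
  -- For `r = 0` the marks have types `1` and `2`, and an extra mark on `w` is available.
  by_cases hr0 : r = 0
  · exact h.exists_sandwich hF hlt (btw_right h.conn) (Or.inr ⟨rfl, by omega, by omega⟩) hW
  obtain ⟨z, hz, hzr⟩ := hr.resolve_left hr0
  by_cases hpath : ∃ y, Btw G F v w y ∧ τ y = r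
  · obtain ⟨y, hy, hyr⟩ := hpath
    refine h.exists_sandwich hF hlt hy (Or.inl ⟨fun hs => ?_, by omega, by omega⟩) hW
    rcases h.sp_mem y hs hy.conn_left with rfl | rfl
    exacts [hv' hyr, hw' hyr]
  · push Not at hpath
    have hzw : z ≠ w := by
      rintro rfl
      exact hw' hzr
    have hzv : z ≠ v := by
      rintro rfl
      exact hv' hzr
    have hsz : ¬ sp z := fun hs => by
      rcases h.sp_mem z hs hz with h | h
      exacts [hzv h, hzw h]
    have hwz := h.conn.symm.trans hz
    obtain ⟨f, b, hd⟩ := exists_first_onDart hwz.symm hzw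
    refine ⟨f, hd.mem, hd.inComp.trans hz, ?_⟩
    -- The roles of `v` and `w` are exchanged: since `r ≠ 0` and `τ v < τ w`, it is `v` that has
    -- type `0`.
    have ht : ThreeMarks G τ sp F (M + Finsupp.single f 1) w := by
      refine threeMarks_of_off_path hF hτ hsp₀ h.conn.symm hwz (by omega) (by omega) (by omega)
        (by omega) (fun x hx hc => ?_) h.right h.left (Or.inr ⟨hsz, f, b, hd, rfl⟩)
        (fun y hy => by rw [hzr]; exact hpath y hy.symm) ?_
      · rcases h.sp_mem x hx (h.conn.trans hc) with h | h
        exacts [.inr (.inl h), .inl h]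
      · rw [add_comm mw]
        exact hW.add_single.of_conn h.conn
    rcases ht with ⟨a, b, c, ma, mb, mc, hwa, ht⟩ | ⟨a, b, c, ma, mb, e, p, q, hwa, ht⟩
    exacts [Or.inl ⟨a, b, c, ma, mb, mc, h.conn.trans hwa, ht⟩,
      Or.inr ⟨a, b, c, ma, mb, e, p, q, h.conn.trans hwa, ht⟩]

/-! #### Configurations with fewer than two additional marks -/

/-- The configuration remains one when it is multiplied by a variable. -/
def Extends (G : Graph α β) (τ : α → ℕ) (sp : α → Prop) (A : Set β) (F : Finset β)
    (M : β →₀ ℕ) : Prop :=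
  (∃ f ∈ F, IsConfig G τ sp F (M + Finsupp.single f 1)) ∨
    ∃ g ∈ A, ∃ p q, G.IsLink g p q ∧ ¬ Conn G F p q ∧
      IsConfig G τ sp (insert g F) (M + Finsupp.single g 1)

/-- A second mark is placed so that one of the two has type `r`. The type missing there is then
different from `r`, hence compatible with the pair that the component of `u₀` may carry. -/
lemma OneMark.extends {A : Set β} (hτ : ∀ x, τ x < 3) (hM : ∀ e ∈ F, 1 ≤ M e)
    (hu₀ : OneOrTwo G τ sp F M r u₀) (ho : ∀ x, ¬ Conn G F u₀ x → OneMark G sp F M x)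
    (hs : Saturated G sp F M u) (hu : ¬ Conn G F u₀ u) (hy : Conn G F u y) (hz : Conn G F u z)
    (hyr : τ y = r) (hzr : τ z ≠ r) : Extends G τ sp A F M := by
  obtain ⟨f, hf, hi, r', hr', ht⟩ := (ho u hu).twoMarks_add_single hτ hM hs hy hz hyr hzr
  have hfar : ∀ x, ¬ Conn G F u x → ¬ InComp G F x f := fun x hx hix => hx (hi.conn hix hf)
  have hu' : ¬ Conn G F u u₀ := fun h => hu h.symm
  refine Or.inl ⟨f, hf, Or.inr ⟨u₀, u, r, r', hr', ?_, Or.inr (Or.inr ht), fun x hx hx' => ?_⟩⟩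
  · rcases hu₀ with hu₀ | hu₀
    exacts [Or.inl (hu₀.add_single_of_not_inComp (hfar u₀ hu')),
      Or.inr (hu₀.add_single_of_not_inComp (hfar u₀ hu'))]
  · exact (ho x hx).add_single_of_not_inComp (hfar x hx')

/-- If one of the components of `p` and `q` contains vertices of type `r` and of another type, a
second mark fits into it. Otherwise the mark seen from `p` has type `r`, the mark seen from `q` has
not, and joining the components along `g` yields a pair. Looking from `p` and `q` guarantees that
both empowered edges still aim at the other mark after joining. -/
lemma extends_of_isLink {A : Set β} (hF : IsForest G F) (hτ : ∀ x, τ x < 3)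
    (hM : ∀ e ∈ F, 1 ≤ M e) (hM₀ : ∀ e ∉ F, M e = 0)
    (hu₀ : OneOrTwo G τ sp F M r u₀) (ho : ∀ x, ¬ Conn G F u₀ x → OneMark G sp F M x)
    (hsp : Saturated G sp F M p) (hsq : Saturated G sp F M q)
    (hp : ¬ Conn G F u₀ p) (hq : ¬ Conn G F u₀ q) (hg : g ∈ A) (hl : G.IsLink g p q)
    (hpr : τ p = r) (hqr : τ q ≠ r) : Extends G τ sp A F M := by
  by_cases hpq : Conn G F p q
  · exact OneMark.extends hτ hM hu₀ ho hsp hp (Conn.refl p) hpq hpr hqr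
  obtain ⟨v, mp, hv⟩ := (ho p hp).exists_isMarkAt hM hsp (Conn.refl p)
  obtain ⟨w, mq, hw⟩ := (ho q hq).exists_isMarkAt hM hsq (Conn.refl q)
  by_cases hvr : τ v = r
  swap
  · exact OneMark.extends hτ hM hu₀ ho hsp hp (Conn.refl p) hv.conn hpr hvr
  by_cases hwr : τ w = r
  · exact OneMark.extends hτ hM hu₀ ho hsq hq hw.conn (Conn.refl q) hwr hqr
  obtain ⟨r', hr', -, ht⟩ := hv.join hτ hF hw hl hpq
    (hM₀ g fun hg => hpq (conn_of_isLink hg hl)) (fun h => hwr (h ▸ hvr))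
  have hs := Finset.subset_insert g F
  refine Or.inr ⟨g, hg, p, q, hl, hpq, Or.inr ⟨u₀, p, r, r', hvr ▸ hr', ?_, Or.inr (Or.inr ht),
    fun x hx hx' => ?_⟩⟩
  · rcases hu₀ with hu₀ | hu₀
    exacts [Or.inl (hu₀.insert_edge hl hp hq), Or.inr (hu₀.insert_edge_of_not_conn hl hp hq)]
  · refine (ho x fun h => hx (h.mono hs)).insert_edge hl (fun h => hx' (Conn.mono h.symm hs))
      fun h => hx' ((conn_of_isLink (Finset.mem_insert_self g F) hl).trans (Conn.mono h.symm hs))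

/-- Either the component of `p` has vertices of several types and becomes a second pair, or its mark
has type `r` and is added to the pair along `g`. In the second case one mark of the pair has type
`0`, because `r ≠ 0`, and the absence of type `r` from the component of the pair permits
`threeMarks_of_off_path`. -/
lemma TwoMarks.extends_of_isLink {A : Set β} (hF : IsForest G F) (hτ : ∀ x, τ x < 3)
    (hsp₀ : ∀ x, sp x → τ x ≠ 0) (hM : ∀ e ∈ F, 1 ≤ M e) (hM₀ : ∀ e ∉ F, M e = 0)
    (h : TwoMarks G τ sp F M r u) (ho : ∀ x, ¬ Conn G F u x → OneMark G sp F M x)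
    (hr : r ≠ 0) (hfree : ∀ z, Conn G F u z → τ z ≠ r) (hsp : Saturated G sp F M p)
    (hq : Conn G F u q) (hg : g ∈ A) (hl : G.IsLink g p q) (hpr : τ p = r) :
    Extends G τ sp A F M := by
  have hp : ¬ Conn G F u p := fun h => hfree p h hpr
  obtain ⟨z, mz, hz⟩ := (ho p hp).exists_isMarkAt hM hsp (Conn.refl p)
  by_cases hzr : τ z = r
  swap
  · exact OneMark.extends hτ hM (Or.inr h) ho hsp hp (Conn.refl p) hz.conn hpr hzr
  have hpq : ¬ Conn G F p q := fun h => hp (hq.trans h.symm)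
  obtain ⟨v, w, mv, mw, huv, hvw, hW⟩ := h
  wlog hw0 : τ w = 0 generalizing v w mv mw
  · have h1 := hvw.ne_left
    have h2 := hvw.ne_right
    have h3 := hvw.ne
    have h4 := hτ v
    have h5 := hτ w
    have h6 := hvw.lt
    exact this w v mw mv (huv.trans hvw.conn) hvw.symm
      (by rw [add_comm]; exact hW.of_conn hvw.conn) (by omega)
  have hs := Finset.subset_insert g F
  have hF' := hF.insert_edge hl hpq
  have hgF : g ∉ F := fun hg => hpq (conn_of_isLink hg hl)
  have hqv : Conn G F q v := hq.symm.trans huv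
  have hd : OnDart G (insert g F) z v g p q := by
    refine ⟨Finset.mem_insert_self g F, hl, ?_, ?_⟩
    · rw [Finset.erase_insert hgF]
      exact hz.conn.symm
    · rw [Finset.erase_insert hgF]
      exact hqv
  have hpv : Conn G (insert g F) p v :=
    (conn_of_isLink hd.mem hl).trans hd.conn_right
  have hW' := hz.weighted.join (hW.of_conn hqv.symm) hl hpq (hM₀ g hgF)
    (fun f hf => ⟨(hz.toEdge.exists_isLink hf).1, (hz.toEdge.inComp hf F).trans hz.conn⟩)
    (fun f hf => by
      rcases Multiset.mem_add.1 hf with hf | hf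
      · exact ⟨(hvw.left.exists_isLink hf).1, (hvw.left.inComp hf F).trans hqv⟩
      · exact ⟨(hvw.right.exists_isLink hf).1,
          (hvw.right.inComp hf F).trans (hqv.trans hvw.conn)⟩)
  have hv0 : τ v ≠ 0 := fun h => hvw.ne (h.trans hw0.symm)
  have ht : ThreeMarks G τ sp (insert g F) (M + Finsupp.single g 1) v := by
    refine threeMarks_of_off_path hF' hτ hsp₀ (hvw.conn.mono hs) hd.conn.symm hw0 hv0
      (hzr ▸ hr) (hzr ▸ hvw.ne_left) (fun x hx hc => ?_) (hvw.left.mono hs) (hvw.right.mono hs)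
      ((hz.toEdge.mono hs).to_btw hF' (hd.btw_left hF')) (fun y hy => ?_) ?_
    · rcases hc.insert_cases hl with h | ⟨-, h⟩ | ⟨-, h⟩
      · exact (hvw.sp_mem x hx h).imp_right Or.inl
      · exact (hvw.sp_mem x hx (hqv.symm.trans h)).imp_right Or.inl
      · exact Or.inr (Or.inr (hz.sp_eq x hx h))
    · rw [hzr]
      exact hfree y (huv.trans (hy.restrict hs hvw.conn).conn_left)
    · rw [add_comm (mv + mw)]
      exact hW'.of_conn hpv
  refine Or.inr ⟨g, hg, p, q, hl, hpq, Or.inl ⟨v, ht, fun x hx => ?_⟩⟩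
  refine (ho x fun h => hx (Conn.mono (huv.symm.trans h) hs)).insert_edge hl (fun h => hx ?_)
    fun h => hx (Conn.mono (hqv.symm.trans h.symm) hs)
  exact hpv.symm.trans (Conn.mono h.symm hs)

/-- A configuration that cannot be multiplied by a variable has two additional marks. -/
lemma IsConfig.extends_or {A : Set β} (hF : IsForest G F) (hτ : ∀ x, τ x < 3)
    (hsp₀ : ∀ x, sp x → τ x ≠ 0) (hM : ∀ e ∈ F, 1 ≤ M e) (hM₀ : ∀ e ∉ F, M e = 0)
    (hA : ∀ g ∈ A, ∀ p q, G.IsLink g p q →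
      ¬ Conn G F o p ∧ (OneMark G sp F M p → Saturated G sp F M p))
    (hA' : ∀ r ≠ 0, r < 3 → ∃ g ∈ A, ∃ p q, G.IsLink g p q ∧ τ p = r ∧ τ q ≠ r)
    (h : IsConfig G τ sp F M) : Extends G τ sp A F M ∨
      (∃ u, ThreeMarks G τ sp F M u ∧ ∀ x, ¬ Conn G F u x → OneMark G sp F M x) ∨
      (∃ u u' r r', r ≠ r' ∧ ¬ Conn G F u u' ∧ TwoMarks G τ sp F M r u ∧
        TwoMarks G τ sp F M r' u' ∧
        ∀ x, ¬ Conn G F u x → ¬ Conn G F u' x → OneMark G sp F M x) := by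
  rcases h.cases with ho | ⟨u, r, hu, ho⟩ | h | h
  · obtain ⟨g, hg, p, q, hl, hpr, hqr⟩ := hA' 1 (by omega) (by omega)
    obtain ⟨hp, hsp⟩ := hA g hg p q hl
    obtain ⟨hq, hsq⟩ := hA g hg q p hl.symm
    -- The vertex `o` serves as a dummy exceptional component with one mark, so the missing type
    -- assigned to it is a free choice.
    exact Or.inl (extends_of_isLink hF hτ hM hM₀ (Or.inl (ho o)) (fun x _ => ho x) (hsp (ho p))
      (hsq (ho q)) hp hq hg hl hpr hqr)
  · left
    by_cases hr : r = 0 ∨ ∃ z, Conn G F u z ∧ τ z = r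
    · obtain ⟨v, w, mv, mw, huv, hvw, hW⟩ := hu
      obtain ⟨f, hf, hi, ht⟩ := hvw.exists_threeMarks hF hτ hsp₀ hW
        (hr.imp_right fun ⟨z, hz, hzr⟩ => ⟨z, huv.symm.trans hz, hzr⟩)
      refine Or.inl ⟨f, hf, Or.inl ⟨v, ht, fun x hx => ?_⟩⟩
      exact (ho x fun h => hx (huv.symm.trans h)).add_single_of_not_inComp
        fun hix => hx (hi.conn hix hf)
    · rw [not_or] at hr
      obtain ⟨hr, hfree⟩ := hr
      push Not at hfree
      have hr3 : r < 3 := by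
        obtain ⟨v, w, mv, mw, -, hvw, -⟩ := hu
        exact hvw.lt
      obtain ⟨g, hg, p, q, hl, hpr, hqr⟩ := hA' r hr hr3
      have hp : ¬ Conn G F u p := fun h => hfree p h hpr
      have hsp := (hA g hg p q hl).2 (ho p hp)
      by_cases hq : Conn G F u q
      · exact hu.extends_of_isLink hF hτ hsp₀ hM hM₀ ho hr hfree hsp hq hg hl hpr
      · exact extends_of_isLink hF hτ hM hM₀ (Or.inr hu) ho hsp
          ((hA g hg q p hl.symm).2 (ho q hq)) hp hq hg hl hpr hqr
  · exact Or.inr (Or.inl h)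
  · exact Or.inr (Or.inr h)

end ThirdMark

namespace TriconedGraph

/-! ### The smallest spanning tree -/

section Cone

variable {α β : Type*} [LinearOrder α] [LinearOrder β] (T : TriconedGraph α β) {B₀ : Finset β}
  {e e' f g : β} {u v w x y z : α} {i j : Fin 3} {r : ℕ}

lemma c_ne (h : i ≠ j) : T.c i ≠ T.c j := T.special_lt.injective.ne h

/-- `u` is one of the special vertices `1` and `2`. -/
def IsApex (x : α) : Prop := x = T.c 1 ∨ x = T.c 2

/-- The edge `e` joins `u` to its parent `v` in the breadth-first search tree. -/
def IsConeLink (e : β) (v u : α) : Prop :=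
  T.graph.IsLink e v u ∧ (v = T.c 0 ∨ (v = T.c 1 ∧ IsHeightTwo T.graph T.c u) ∨
    (v = T.c 2 ∧ IsHeightTwo T.graph T.c u ∧ ¬ T.graph.Adj (T.c 1) u))

variable {T}

/-- Loops are defined by spanning trees: an edge that is not a loop lies in one of them, and its
ends are therefore distinct. -/
lemma ne_of_isLink (h : T.graph.IsLink e x y) : x ≠ y := by
  have := T.no_loop e
  simp only [IsLoop, not_and, not_forall, not_not] at this
  obtain ⟨B, hB, he⟩ := this h.edge_mem
  exact IsForest.ne hB.acyclic he h

lemma not_isHeightTwo_c (i : Fin 3) : ¬ IsHeightTwo T.graph T.c (T.c i) := by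
  rintro ⟨-, h0, h⟩
  fin_cases i
  exacts [h0 rfl, h T.adj_one, h T.adj_two]

lemma c_mem (i : Fin 3) : T.c i ∈ V(T.graph) := by
  fin_cases i
  exacts [T.adj_one.left_mem, T.adj_one.right_mem, T.adj_two.right_mem]

lemma IsConeLink.exists_eq (h : T.IsConeLink e v u) : ∃ i, v = T.c i := by
  rcases h.2 with h | ⟨h, -⟩ | ⟨h, -⟩
  exacts [⟨0, h⟩, ⟨1, h⟩, ⟨2, h⟩]

lemma IsConeLink.ne_zero (h : T.IsConeLink e v u) : u ≠ T.c 0 := by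
  rcases h.2 with rfl | ⟨-, h⟩ | ⟨-, h, -⟩
  exacts [(ne_of_isLink h.1).symm, h.2.1, h.2.1]

lemma IsConeLink.not_swap (h : T.IsConeLink e v u) : ¬ T.IsConeLink e' u v := by
  intro h'
  have hH : IsHeightTwo T.graph T.c u := by
    rcases h.2 with rfl | ⟨-, h⟩ | ⟨-, h, -⟩
    exacts [absurd rfl h'.ne_zero, h, h]
  obtain ⟨i, rfl⟩ := h'.exists_eq
  exact not_isHeightTwo_c i hH

lemma IsConeLink.eq_of_isLink (h : T.IsConeLink e v u) (h' : T.IsConeLink e y x) :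
    v = y ∧ u = x := by
  rcases h.1.eq_and_eq_or_eq_and_eq h'.1 with h | ⟨rfl, rfl⟩
  exacts [h, absurd h' h.not_swap]

/-- The three kinds of parents exclude each other by the adjacency of `u` to `0` and `1`, and there
are no parallel edges at a special vertex. -/
lemma IsConeLink.unique (h : T.IsConeLink e v u) (h' : T.IsConeLink e' y u) :
    v = y ∧ e = e' := by
  have hvy : v = y := by
    rcases h.2 with rfl | ⟨rfl, hu⟩ | ⟨rfl, hu, hu'⟩ <;>
      rcases h'.2 with rfl | ⟨rfl, hy⟩ | ⟨rfl, hy, hy'⟩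
    · rfl
    · exact absurd h.1.adj hy.2.2
    · exact absurd h.1.adj hy.2.2
    · exact absurd h'.1.adj hu.2.2
    · rfl
    · exact absurd h.1.adj hy'
    · exact absurd h'.1.adj hu.2.2
    · exact absurd h'.1.adj hu'
    · rfl
  subst hvy
  obtain ⟨i, rfl⟩ := h.exists_eq
  exact ⟨rfl, T.no_parallel i u e e' h.1 h'.1⟩

lemma exists_isConeLink (hx : x ∈ V(T.graph)) (hx0 : x ≠ T.c 0) : ∃ e v, T.IsConeLink e v x := by
  by_cases h0 : T.graph.Adj (T.c 0) x
  · obtain ⟨e, he⟩ := h0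
    exact ⟨e, T.c 0, he, Or.inl rfl⟩
  · have hH : IsHeightTwo T.graph T.c x := ⟨hx, hx0, h0⟩
    by_cases h1 : T.graph.Adj (T.c 1) x
    · obtain ⟨e, he⟩ := h1
      exact ⟨e, T.c 1, he, Or.inr (Or.inl ⟨rfl, hH⟩)⟩
    · obtain ⟨i, e, he⟩ := T.dominated x hx fun i h => not_isHeightTwo_c i (h ▸ hH)
      fin_cases i
      · exact absurd he.adj h0
      · exact absurd he.adj h1
      · exact ⟨e, T.c 2, he, Or.inr (Or.inr ⟨rfl, hH, h1⟩)⟩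

lemma edgeBlock_lt_iff : edgeBlock T.graph T.c e < 3 ↔ ∃ v u, T.IsConeLink e v u := by
  unfold edgeBlock
  constructor
  · intro h
    split_ifs at h with h0 h1 h2
    · obtain ⟨x, hx⟩ := h0
      exact ⟨T.c 0, x, hx, Or.inl rfl⟩
    · obtain ⟨x, hx, hl⟩ := h1
      exact ⟨T.c 1, x, hl, Or.inr (Or.inl ⟨rfl, hx⟩)⟩
    · obtain ⟨x, hx, hx', hl⟩ := h2
      exact ⟨T.c 2, x, hl, Or.inr (Or.inr ⟨rfl, hx, hx'⟩)⟩
    · omega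
  · rintro ⟨v, u, hl, rfl | ⟨rfl, hu⟩ | ⟨rfl, hu, hu'⟩⟩
    · rw [if_pos hl.inc_left]
      omega
    · split_ifs with h0 h1
      · omega
      · omega
      · exact absurd ⟨u, hu, hl⟩ h1
      · exact absurd ⟨u, hu, hl⟩ h1
    · split_ifs with h0 h1 h2
      · omega
      · omega
      · omega
      · exact absurd ⟨u, hu, hu', hl⟩ h2

variable (T) in
/-- The vertices of a triconed graph. -/
noncomputable def verts : Finset α := T.finite_vertexSet.toFinset

variable (T) in
lemma coe_verts : (T.verts : Set α) = V(T.graph) := Set.Finite.coe_toFinset _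

lemma mem_verts : x ∈ T.verts ↔ x ∈ V(T.graph) := Set.Finite.mem_toFinset _

variable (T) in
open Classical in
/-- The edges of the breadth-first search tree. -/
noncomputable def coneEdges : Finset β :=
  T.finite_edgeSet.toFinset.filter fun e => ∃ v u, T.IsConeLink e v u

lemma mem_coneEdges : e ∈ T.coneEdges ↔ ∃ v u, T.IsConeLink e v u := by
  classical
  rw [coneEdges, Finset.mem_filter, Set.Finite.mem_toFinset, and_iff_right_iff_imp]
  rintro ⟨v, u, h⟩
  exact h.1.edge_mem

lemma conn_coneEdges (hx : x ∈ V(T.graph)) : Conn T.graph T.coneEdges (T.c 0) x := by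
  have key : ∀ {e v u}, T.IsConeLink e v u → Conn T.graph T.coneEdges v u :=
    fun h => conn_of_isLink (mem_coneEdges.2 ⟨_, _, h⟩) h.1
  have hc : ∀ i, Conn T.graph T.coneEdges (T.c 0) (T.c i) := by
    intro i
    fin_cases i
    · exact Conn.refl _
    · obtain ⟨e, he⟩ := T.adj_one
      exact key ⟨he, Or.inl rfl⟩
    · obtain ⟨e, he⟩ := T.adj_two
      exact key ⟨he, Or.inl rfl⟩
  by_cases hx0 : x = T.c 0
  · exact hx0 ▸ Conn.refl _
  · obtain ⟨e, v, h⟩ := exists_isConeLink hx hx0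
    obtain ⟨i, rfl⟩ := h.exists_eq
    exact (hc i).trans (key h)

/-- Sending an edge to its child is injective and misses `0`, so there are fewer edges than
vertices; as they connect everything, counting gives a forest. -/
lemma isForest_coneEdges : IsForest T.graph T.coneEdges := by
  refine isForest_of_card T.coe_verts (fun x hx y hy => (conn_coneEdges (mem_verts.1 hx)).symm.trans
    (conn_coneEdges (mem_verts.1 hy))) ?_
  have h0 : T.c 0 ∈ T.verts := mem_verts.2 (c_mem 0)
  have hch : ∀ e, ∃ u, e ∈ T.coneEdges → ∃ v, T.IsConeLink e v u := by
    intro e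
    by_cases he : e ∈ T.coneEdges
    · obtain ⟨v, u, h⟩ := mem_coneEdges.1 he
      exact ⟨u, fun _ => ⟨v, h⟩⟩
    · exact ⟨T.c 0, fun h => absurd h he⟩
  choose ch hch using hch
  have hle : T.coneEdges.card ≤ (T.verts.erase (T.c 0)).card := by
    refine Finset.card_le_card_of_injOn ch (fun e he => ?_) fun e he e' he' hee => ?_
    · obtain ⟨v, h⟩ := hch e he
      exact Finset.mem_coe.2 (Finset.mem_erase.2 ⟨h.ne_zero, mem_verts.2 h.1.right_mem⟩)
    · obtain ⟨v, h⟩ := hch e he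
      obtain ⟨v', h'⟩ := hch e' he'
      rw [hee] at h
      exact (h.unique h').2
  rw [Finset.card_erase_of_mem h0] at hle
  have := Finset.card_pos.2 ⟨_, h0⟩
  omega

/-- The smallest spanning tree is the breadth-first search tree. -/
lemma eq_coneEdges (hB₀ : IsLexSmallestTree T.graph B₀) : B₀ = T.coneEdges := by
  have hS : IsSpanningTree T.graph T.coneEdges :=
    ⟨fun e he => by
      obtain ⟨v, u, h⟩ := mem_coneEdges.1 (Finset.mem_coe.1 he)
      exact h.1.edge_mem,
    fun x hx y hy => (conn_coneEdges hx).symm.trans (conn_coneEdges hy), isForest_coneEdges⟩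
  by_contra hne
  obtain ⟨e, he, hlt⟩ := hB₀.2 _ hS (Ne.symm hne)
  obtain ⟨he₀, he⟩ := Finset.mem_sdiff.1 he
  have heE := hB₀.1.subset (Finset.mem_coe.2 he₀)
  by_cases hsub : T.coneEdges ⊆ B₀
  · obtain ⟨a, b, hl⟩ := T.graph.exists_isLink_of_mem_edgeSet heE
    refine hB₀.1.acyclic e he₀ a b hl ((hS.connected a hl.left_mem b hl.right_mem).mono ?_)
    exact fun _ _ h => ⟨h.1, h.2.imp fun f hf =>
      ⟨Finset.mem_erase.2 ⟨fun h => he (h ▸ hf.1), hsub hf.1⟩, hf.2⟩⟩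
  · obtain ⟨f, hf, hf₀⟩ := Finset.not_subset.1 hsub
    have h1 := edgeBlock_lt_iff.2 (mem_coneEdges.1 hf)
    -- The breadth-first edges make up the first three blocks, so `f` precedes `e`, contrary to the
    -- minimality of `B₀`.
    have h2 : ¬ edgeBlock T.graph T.c e < 3 := fun h => he (mem_coneEdges.2 (edgeBlock_lt_iff.1 h))
    have h3 := T.edge_lt f (hS.subset (Finset.mem_coe.2 hf)) e heE (by omega)
    exact lt_asymm h3 (hlt f (Finset.mem_sdiff.2 ⟨hf, hf₀⟩))

variable (T) in
/-- The special vertex `r`. -/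
def apex (r : ℕ) : α := if r = 1 then T.c 1 else if r = 2 then T.c 2 else T.c 0

lemma vtype_lt (x : α) : T.vtype B₀ x < 3 := by
  unfold vtype
  split_ifs <;> omega

lemma vtype_one : T.vtype B₀ (T.c 1) = 1 := by
  unfold vtype
  rw [if_pos (Or.inl rfl)]

lemma not_isConeLink_of_isApex (hu : T.IsApex u) (h : T.IsConeLink e v u) : v = T.c 0 := by
  rcases h.2 with rfl | ⟨-, h⟩ | ⟨-, h, -⟩
  · rfl
  · rcases hu with rfl | rfl
    exacts [absurd h (not_isHeightTwo_c 1), absurd h (not_isHeightTwo_c 2)]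
  · rcases hu with rfl | rfl
    exacts [absurd h (not_isHeightTwo_c 1), absurd h (not_isHeightTwo_c 2)]

lemma exists_spanningTree_not_mem (he : e ∈ E(T.graph)) :
    ∃ B, IsSpanningTree T.graph B ∧ e ∉ B := by
  have := T.no_coloop e
  simp only [IsColoop, not_and, not_forall] at this
  obtain ⟨B, hB, he⟩ := this he
  exact ⟨B, hB, he⟩

variable (hB₀ : IsLexSmallestTree T.graph B₀)
include hB₀

lemma mem_tree_iff : e ∈ B₀ ↔ ∃ v u, T.IsConeLink e v u := by
  rw [eq_coneEdges hB₀, mem_coneEdges]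

lemma IsConeLink.mem_tree (h : T.IsConeLink e v u) : e ∈ B₀ := (mem_tree_iff hB₀).2 ⟨v, u, h⟩

lemma dist_of_adj (hx : T.graph.Adj (T.c 0) x) :
    (edgeGraph T.graph B₀).dist (T.c 0) x = 1 := by
  obtain ⟨e, he⟩ := hx
  rw [SimpleGraph.dist_eq_one_iff_adj]
  exact ⟨ne_of_isLink he, e, IsConeLink.mem_tree hB₀ ⟨he, Or.inl rfl⟩, he⟩

lemma dist_of_isHeightTwo (hx : IsHeightTwo T.graph T.c x) :
    (edgeGraph T.graph B₀).dist (T.c 0) x = 2 := by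
  obtain ⟨e, v, h⟩ := exists_isConeLink hx.1 hx.2.1
  have hv : T.graph.Adj (T.c 0) v := by
    rcases h.2 with rfl | ⟨rfl, -⟩ | ⟨rfl, -⟩
    exacts [absurd h.1.adj hx.2.2, T.adj_one, T.adj_two]
  have hvx : (edgeGraph T.graph B₀).Adj v x := ⟨ne_of_isLink h.1, e, h.mem_tree hB₀, h.1⟩
  obtain ⟨f, hf⟩ := hv
  have h0v : (edgeGraph T.graph B₀).Adj (T.c 0) v :=
    ⟨ne_of_isLink hf, f, IsConeLink.mem_tree hB₀ ⟨hf, Or.inl rfl⟩, hf⟩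
  have hle := SimpleGraph.dist_le (SimpleGraph.Walk.cons h0v (SimpleGraph.Walk.cons hvx .nil))
  simp only [SimpleGraph.Walk.length_cons, SimpleGraph.Walk.length_nil] at hle
  have h1 : (edgeGraph T.graph B₀).dist (T.c 0) x ≠ 1 := by
    rw [Ne, SimpleGraph.dist_eq_one_iff_adj]
    rintro ⟨-, g, -, hg⟩
    exact hx.2.2 hg.adj
  have h0 : 0 < (edgeGraph T.graph B₀).dist (T.c 0) x :=
    (h0v.reachable.trans hvx.reachable).pos_dist_of_ne hx.2.1.symm
  omega

lemma IsConeLink.dist_eq (h : T.IsConeLink e v u) :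
    (edgeGraph T.graph B₀).dist (T.c 0) u = (edgeGraph T.graph B₀).dist (T.c 0) v + 1 := by
  rcases h.2 with rfl | ⟨rfl, hu⟩ | ⟨rfl, hu, -⟩
  · rw [dist_of_adj hB₀ h.1.adj, SimpleGraph.dist_self]
  · rw [dist_of_isHeightTwo hB₀ hu, dist_of_adj hB₀ T.adj_one]
  · rw [dist_of_isHeightTwo hB₀ hu, dist_of_adj hB₀ T.adj_two]

lemma isConeEdge_iff : T.IsConeEdge B₀ e v u ↔ T.IsConeLink e v u := by
  constructor
  · rintro ⟨he, hl, hd⟩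
    obtain ⟨y, x, h⟩ := (mem_tree_iff hB₀).1 he
    rcases hl.eq_and_eq_or_eq_and_eq h.1 with ⟨rfl, rfl⟩ | ⟨rfl, rfl⟩
    · exact h
    · have := h.dist_eq hB₀
      omega
  · exact fun h => ⟨h.mem_tree hB₀, h.1, h.dist_eq hB₀⟩

lemma isChild_iff : T.IsChild B₀ u v ↔ ∃ e, T.IsConeLink e v u := by
  simp only [IsChild, isConeEdge_iff hB₀]

lemma vtype_two : T.vtype B₀ (T.c 2) = 2 := by
  unfold vtype
  rw [if_neg, if_pos (Or.inl rfl)]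
  rintro (h | h)
  · exact T.c_ne (by decide) h
  · obtain ⟨e, h⟩ := (isChild_iff hB₀).1 h
    exact T.c_ne (by decide) (not_isConeLink_of_isApex (Or.inr rfl) h)

lemma vtype_zero : T.vtype B₀ (T.c 0) = 0 := by
  unfold vtype
  rw [if_neg, if_neg]
  · rintro (h | h)
    · exact T.c_ne (by decide) h
    · obtain ⟨e, h⟩ := (isChild_iff hB₀).1 h
      exact h.ne_zero rfl
  · rintro (h | h)
    · exact T.c_ne (by decide) h
    · obtain ⟨e, h⟩ := (isChild_iff hB₀).1 h
      exact h.ne_zero rfl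

lemma apex_vtype (hx : T.IsApex x) : T.apex (T.vtype B₀ x) = x := by
  rcases hx with rfl | rfl
  · rw [vtype_one]
    rfl
  · rw [vtype_two hB₀]
    rfl

lemma vtype_ne_zero_of_isApex (hx : T.IsApex x) : T.vtype B₀ x ≠ 0 := by
  rcases hx with rfl | rfl
  · rw [vtype_one]
    omega
  · rw [vtype_two hB₀]
    omega

lemma IsConeLink.eq_apex (h : T.IsConeLink e v u) (hu : ¬ T.IsApex u) :
    v = T.apex (T.vtype B₀ u) := by
  unfold IsApex at hu
  push Not at hu
  unfold vtype
  by_cases h1 : T.IsChild B₀ u (T.c 1)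
  · rw [if_pos (Or.inr h1)]
    obtain ⟨e', h'⟩ := (isChild_iff hB₀).1 h1
    exact (h.unique h').1
  · rw [if_neg (not_or.2 ⟨hu.1, h1⟩)]
    by_cases h2 : T.IsChild B₀ u (T.c 2)
    · rw [if_pos (Or.inr h2)]
      obtain ⟨e', h'⟩ := (isChild_iff hB₀).1 h2
      exact (h.unique h').1
    · rw [if_neg (not_or.2 ⟨hu.2, h2⟩)]
      rcases h.2 with rfl | ⟨rfl, -⟩ | ⟨rfl, -⟩
      · rfl
      · exact absurd ((isChild_iff hB₀).2 ⟨e, h⟩) h1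
      · exact absurd ((isChild_iff hB₀).2 ⟨e, h⟩) h2

lemma ne_zero_of_not_mem_tree (he : e ∉ B₀) (hl : T.graph.IsLink e x y) : x ≠ T.c 0 := by
  rintro rfl
  exact he (IsConeLink.mem_tree hB₀ ⟨hl, Or.inl rfl⟩)

/-- Every normal vertex has an edge outside of the smallest spanning tree. -/
lemma exists_isLink_of_normal (hx : x ∈ V(T.graph)) (hx0 : x ≠ T.c 0) (hxa : ¬ T.IsApex x) :
    ∃ g ∈ E(T.graph), g ∉ B₀ ∧ ∃ y, T.graph.IsLink g x y := by
  obtain ⟨e, v, h⟩ := exists_isConeLink hx hx0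
  obtain ⟨B, hB, he⟩ := exists_spanningTree_not_mem h.1.edge_mem
  have hc : Conn T.graph B x (T.c 0) := hB.connected x hx _ (c_mem 0)
  obtain ⟨g, hg, y, -, hl⟩ := hc.eq_or_exists_isLink hx0
  -- At the normal vertex `x` the only edge of `B₀` is its parent edge `e`, which `B` avoids.
  refine ⟨g, hl.edge_mem, fun hg₀ => ?_, y, hl⟩
  obtain ⟨v', u', h'⟩ := (mem_tree_iff hB₀).1 hg₀
  rcases hl.left_eq_or_eq h'.1 with rfl | rfl
  · obtain ⟨i, rfl⟩ := h'.exists_eq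
    fin_cases i
    exacts [hx0 rfl, hxa (Or.inl rfl), hxa (Or.inr rfl)]
  · exact he ((h.unique h').2 ▸ hg)

/-- Some edge outside of the smallest spanning tree leaves the vertices of type `r`. -/
lemma exists_isLink_of_vtype (hr : r ≠ 0) (hr3 : r < 3) :
    ∃ g ∈ E(T.graph), g ∉ B₀ ∧ ∃ p q, T.graph.IsLink g p q ∧ T.vtype B₀ p = r ∧
      T.vtype B₀ q ≠ r := by
  obtain ⟨x, hx, hxr⟩ : ∃ x, T.IsApex x ∧ T.vtype B₀ x = r := by
    obtain rfl | rfl : r = 1 ∨ r = 2 := by omega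
    exacts [⟨T.c 1, Or.inl rfl, vtype_one⟩, ⟨T.c 2, Or.inr rfl, vtype_two hB₀⟩]
  obtain ⟨e, hl⟩ : T.graph.Adj (T.c 0) x := by
    rcases hx with rfl | rfl
    exacts [T.adj_one, T.adj_two]
  obtain ⟨B, hB, he⟩ := exists_spanningTree_not_mem hl.edge_mem
  have hc : Conn T.graph B x (T.c 0) := hB.connected x hl.right_mem _ (c_mem 0)
  obtain ⟨g, hg, p, q, hpq, -, hp, hq⟩ := hc.exists_switch (P := fun y => T.vtype B₀ y = r) hxr
    (by rw [vtype_zero hB₀]; exact hr.symm)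
  refine ⟨g, hpq.edge_mem, fun hg₀ => ?_, p, q, hpq, hp, hq⟩
  have hapex : T.apex r = x := by rw [← hxr, apex_vtype hB₀ hx]
  -- Within `B₀` the vertices of type `r` are joined to the others only by the edge `0x`, which is
  -- not in `B`. The two lemmas treat the two orientations of `g`.
  have key : ∀ v u, T.IsConeLink g v u → T.vtype B₀ u = r → T.vtype B₀ v ≠ r → False := by
    intro v u h hu hv
    by_cases hua : T.IsApex u
    · have h1 : u = x := by rw [← apex_vtype hB₀ hua, hu, hapex]
      have h2 := not_isConeLink_of_isApex hua h
      subst h1 h2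
      exact he (T.no_parallel 0 _ _ _ h.1 hl ▸ hg)
    · have := h.eq_apex hB₀ hua
      rw [hu, hapex] at this
      exact hv (this ▸ hxr)
  have key' : ∀ v u, T.IsConeLink g v u → T.vtype B₀ v = r → T.vtype B₀ u ≠ r → False := by
    intro v u h hv hu
    by_cases hua : T.IsApex u
    · have h2 := not_isConeLink_of_isApex hua h
      rw [h2, vtype_zero hB₀] at hv
      exact hr hv.symm
    · have hva := h.eq_apex hB₀ hua
      have := vtype_lt (T := T) (B₀ := B₀) u
      obtain h0 | h1 | h2 : T.vtype B₀ u = 0 ∨ T.vtype B₀ u = 1 ∨ T.vtype B₀ u = 2 := by omega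
      · rw [h0] at hva
        have : v = T.c 0 := hva
        rw [this, vtype_zero hB₀] at hv
        exact hr hv.symm
      · rw [h1] at hva
        have : v = T.c 1 := hva
        rw [this, vtype_one, ← h1] at hv
        exact hu hv
      · rw [h2] at hva
        have : v = T.c 2 := hva
        rw [this, vtype_two hB₀, ← h2] at hv
        exact hu hv
  obtain ⟨v, u, h⟩ := (mem_tree_iff hB₀).1 hg₀
  rcases hpq.eq_and_eq_or_eq_and_eq h.1 with ⟨rfl, rfl⟩ | ⟨rfl, rfl⟩
  · exact key' p q h hp hq
  · exact key q p h hp hq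

end Cone

end TriconedGraph

namespace TriconedGraph

/-! ### The edges empowered by the marks of a component -/

section Empowers

variable {α β : Type*} [LinearOrder α] [LinearOrder β] {T : TriconedGraph α β} {B₀ : Finset β}
  {N : MarkedForest α β} {M : β →₀ ℕ} {e e₀ : β} {u v w x y z a b : α} {m m' m₁ m₂ m₃ : Mark α}
  {mv mw mz : Multiset β} {r : ℕ}

omit [LinearOrder α] in
-- Both edges come from the first admissible dart in the list of one path, and a forest has no
-- parallel edges.
lemma FirstDart.unique {G : Graph α β} {F : Finset β} {P : α → α → Prop} (hF : IsForest G F)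
    (h : FirstDart G F x y P e a b) {c d : α} (h' : FirstDart G F x y P e₀ c d) : e = e₀ := by
  obtain ⟨p, hp⟩ := h.dart.conn.exists_isPath
  obtain ⟨d₁, ⟨hd₁, l₁, l₂, heq, hl⟩, rfl, rfl⟩ :=
    h.exists_isFirstDart hF hp (P := fun d => P d.fst d.snd) (fun _ => Iff.rfl)
  obtain ⟨d₂, ⟨hd₂, l₃, l₄, heq', hl'⟩, rfl, rfl⟩ :=
    h'.exists_isFirstDart hF hp (P := fun d => P d.fst d.snd) (fun _ => Iff.rfl)
  have : d₁ = d₂ := by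
    rw [heq, List.append_eq_append_iff] at heq'
    rcases heq' with ⟨l, rfl, h⟩ | ⟨l, rfl, h⟩
    · cases l with
      | nil => simp only [List.nil_append, List.cons.injEq] at h; exact h.1
      | cons d l =>
        simp only [List.cons_append, List.cons.injEq] at h
        exact absurd (h.1 ▸ hd₁) (hl' d (by simp))
    · cases l with
      | nil => simp only [List.nil_append, List.cons.injEq] at h; exact h.1.symm
      | cons d l =>
        simp only [List.cons_append, List.cons.injEq] at h
        exact absurd (h.1 ▸ hd₂) (hl d (by simp))
  subst this
  by_contra hne
  exact hF e h.dart.mem _ _ h.dart.isLink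
    (conn_of_isLink (Finset.mem_erase.2 ⟨Ne.symm hne, h'.dart.mem⟩) h'.dart.isLink)

lemma isEndEdge_iff (hF : IsForest T.graph N.edges) :
    T.IsEndEdge N v w e ↔ ∃ b, OnDart T.graph N.edges v w e v b := by
  constructor
  · rintro ⟨p, hp, d, l, hd, he, hl⟩
    cases p with
    | nil => simp at hd
    | cons h p =>
      rw [SimpleGraph.Walk.darts_cons, List.cons.injEq] at hd
      obtain ⟨rfl, -⟩ := hd
      exact ⟨_, onDart_of_isPath_cons hp he hl⟩
  · rintro ⟨b, hd⟩
    obtain ⟨p, hp⟩ := hd.conn.exists_isPath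
    cases p with
    | nil => exact (OnDart.not_self hF hd).elim
    | cons h p =>
      have h' := h
      obtain ⟨-, f, hf, hl⟩ := h'
      obtain ⟨rfl, rfl⟩ := (onDart_of_isPath_cons hp hf hl).first_unique hF hd
      exact ⟨_, hp, ⟨(_, _), h⟩, p.darts, SimpleGraph.Walk.darts_cons h p, hf, hl⟩

lemma onPath_iff (hF : IsForest T.graph N.edges) :
    T.OnPath N v w z ↔ Btw T.graph N.edges v w z := by
  constructor
  · rintro ⟨p, hp, hz⟩
    exact btw_of_mem_support hF hp hz
  · intro h
    obtain ⟨p, hp⟩ := h.1.exists_isPath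
    exact ⟨p, hp, h.mem_support hF hp⟩

lemma isMiddleEdge_iff (hF : IsForest T.graph N.edges) :
    T.IsMiddleEdge B₀ N v w z e ↔ ∃ a b, FirstDart T.graph N.edges z v
      (fun a b => T.vtype B₀ b ≠ T.vtype B₀ w ∧ T.vtype B₀ a ≠ T.vtype B₀ v) e a b := by
  constructor
  · rintro ⟨p, hp, d, hd, he, hl⟩
    exact ⟨_, _, firstDart_of_isFirstDart hF hp (fun _ => Iff.rfl) hd he hl⟩
  · rintro ⟨a, b, h⟩
    obtain ⟨p, hp⟩ := h.dart.conn.exists_isPath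
    obtain ⟨d, hd, rfl, rfl⟩ := h.exists_isFirstDart hF hp (P := fun d => T.vtype B₀ d.snd ≠
      T.vtype B₀ w ∧ T.vtype B₀ d.fst ≠ T.vtype B₀ v) (fun _ => Iff.rfl)
    exact ⟨p, hp, d, hd, h.dart.mem, h.dart.isLink⟩

lemma mem_componentMarks : m' ∈ T.componentMarks N m ↔
    m' ∈ N.marks ∧ Conn T.graph N.edges m.vertex m'.vertex := Iff.rfl

lemma componentMarks_eq (h : Conn T.graph N.edges m.vertex m'.vertex) :
    T.componentMarks N m = T.componentMarks N m' := by
  ext m''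
  exact and_congr_right fun _ => ⟨fun h' => h.symm.trans h', fun h' => h.trans h'⟩

lemma IsTriple.componentMarks_right (h : T.IsTriple N m₁ m₂ m₃) :
    T.componentMarks N m₂ = {m₁, m₂, m₃} := by
  have : m₂ ∈ T.componentMarks N m₁ := by
    rw [h.marks_eq]
    simp
  rw [← componentMarks_eq (mem_componentMarks.1 this).2, h.marks_eq]

lemma IsTriple.componentMarks_mid (h : T.IsTriple N m₁ m₂ m₃) :
    T.componentMarks N m₃ = {m₁, m₂, m₃} := by
  have : m₃ ∈ T.componentMarks N m₁ := by
    rw [h.marks_eq]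
    simp
  rw [← componentMarks_eq (mem_componentMarks.1 this).2, h.marks_eq]

lemma Empowers.inComp (hF : IsForest T.graph N.edges) (h : T.Empowers B₀ N m e) :
    e ∈ N.edges ∧ InComp T.graph N.edges m.vertex e := by
  have key : ∀ {v w}, T.IsEndEdge N v w e → e ∈ N.edges ∧ InComp T.graph N.edges v e := by
    intro v w h
    obtain ⟨b, hd⟩ := (isEndEdge_iff hF).1 h
    exact ⟨hd.mem, hd.inComp⟩
  cases h with
  | one _ x _ _ _ he => exact key he
  | two _ _ _ _ _ _ he => exact key he
  | leaf _ _ _ _ _ _ _ _ _ he => exact key he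
  | left _ _ _ _ _ _ he => exact key he
  | right _ _ _ _ _ _ he => exact key he
  | middle _ _ _ _ _ _ he =>
    obtain ⟨a, b, hd⟩ := (isMiddleEdge_iff hF).1 he
    exact ⟨hd.dart.mem, hd.dart.inComp⟩

lemma phi₂_apply_of_not_mem (he : e ∉ N.edges) : T.phi₂ B₀ N e = 0 := by
  classical
  simp [phi₂, he]

/-- A mark empowers only edges of its own component, so only the marks of that component need to be
counted. -/
lemma phi₂_apply (hF : IsForest T.graph N.edges) (he : e ∈ N.edges)
    (hi : InComp T.graph N.edges u e) : T.phi₂ B₀ N e =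
      1 + {m ∈ T.componentMarks N (.usual u) | T.Empowers B₀ N m e}.ncard := by
  classical
  have : {m ∈ N.marks | T.Empowers B₀ N m e} =
      {m ∈ T.componentMarks N (.usual u) | T.Empowers B₀ N m e} := by
    ext m
    refine ⟨fun ⟨hm, hem⟩ => ⟨⟨hm, ?_⟩, hem⟩, fun ⟨hm, hem⟩ => ⟨hm.1, hem⟩⟩
    exact hi.conn (hem.inComp hF).2 he
  rw [← this]
  simp [phi₂, he]

omit [LinearOrder α] in
lemma not_three_mem_pair (h₁₂ : m₁ ≠ m₂) (h₁₃ : m₁ ≠ m₃) (h₂₃ : m₂ ≠ m₃)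
    (h₁ : m₁ ∈ ({m, m'} : Set (Mark α))) (h₂ : m₂ ∈ ({m, m'} : Set (Mark α)))
    (h₃ : m₃ ∈ ({m, m'} : Set (Mark α))) : False := by
  simp only [Set.mem_insert_iff, Set.mem_singleton_iff] at h₁ h₂ h₃
  rcases h₁ with rfl | rfl <;> rcases h₂ with rfl | rfl <;> rcases h₃ with rfl | rfl <;>
    simp_all

lemma IsTriple.false_of_pair (h : T.IsTriple N m₁ m₂ m₃) (hm : T.componentMarks N m₁ = {m, m'}) :
    False := by
  have hm' := h.marks_eq.symm.trans hm
  refine not_three_mem_pair (m := m) (m' := m') h.ne₁ h.ne₂ h.ne₃ ?_ ?_ ?_ <;> rw [← hm'] <;> simp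

/-- A component with one mark. -/
lemma empowers_iff_of_one (hF : IsForest T.graph N.edges)
    (hm : T.componentMarks N (.usual v) = {.usual v}) (hx : IsRoot T.graph N.edges x)
    (hvx : Conn T.graph N.edges v x) :
    T.Empowers B₀ N (.usual v) e ↔ ∃ b, OnDart T.graph N.edges v x e v b := by
  have hleast : IsLeast {y | (edgeGraph T.graph N.edges).Reachable v y} x :=
    ⟨hvx, fun y hy => hx y (hvx.symm.trans hy)⟩
  have hno : ∀ m₁ m₂, m₁ ≠ m₂ → m₁ ∈ T.componentMarks N (.usual v) →
      m₂ ∈ T.componentMarks N (.usual v) → False := by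
    intro m₁ m₂ hne h₁ h₂
    rw [hm, Set.mem_singleton_iff] at h₁ h₂
    exact hne (h₁.trans h₂.symm)
  rw [← isEndEdge_iff hF]
  constructor
  · intro h
    cases h with
    | one _ y _ _ hy he =>
      obtain rfl := hy.unique hleast
      exact he
    | two _ m' _ hne hm' _ _ =>
      exact (hno _ m' hne (by simp [hm']) (by simp [hm'])).elim
    | leaf _ m' _ _ h =>
      exact (hno _ m' h.ne₁ (by simp [h.marks_eq]) (by simp [h.marks_eq])).elim
    | left _ w z _ h =>
      have h := h.triple
      exact (hno _ _ h.ne₁ (by simp [h.marks_eq]) (by simp [h.marks_eq])).elim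
    | right w _ z _ h =>
      have h := h.triple
      exact (hno _ _ h.ne₁ (by simp [h.componentMarks_right])
        (by simp [h.componentMarks_right])).elim
    | middle w z _ _ h =>
      have h := h.triple
      exact (hno _ _ h.ne₁ (by simp [h.componentMarks_mid])
        (by simp [h.componentMarks_mid])).elim
  · exact fun h => .one _ x e hm hleast h

lemma mem_iff_of_toEdge (hF : IsForest T.graph N.edges)
    (h : ToEdge T.graph T.IsApex N.edges v w mv) :
    e ∈ mv ↔ ¬ T.IsApex v ∧ ∃ b, OnDart T.graph N.edges v w e v b := by
  constructor
  · intro he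
    refine ⟨h.not_sp he, ?_⟩
    rcases h with ⟨-, rfl⟩ | ⟨-, f, b, hd, rfl⟩
    · simp at he
    · rw [Multiset.mem_singleton.1 he]
      exact ⟨b, hd⟩
  · rintro ⟨hv, b, hd⟩
    obtain ⟨-, f, c, hd', rfl⟩ := h.resolve_left fun h => hv h.1
    rw [Multiset.mem_singleton]
    exact (hd.first_unique hF hd').1

lemma mayEmpower_usual_iff : T.MayEmpower (.usual v) ↔ ¬ T.IsApex v := by
  simp [MayEmpower, IsApex]

/-- A component with two marks. -/
lemma empowers_iff_of_two (hF : IsForest T.graph N.edges) (hvw : v ≠ w)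
    (hm : T.componentMarks N (.usual v) = {.usual v, .usual w})
    (h : ToEdge T.graph T.IsApex N.edges v w mv) :
    T.Empowers B₀ N (.usual v) e ↔ e ∈ mv := by
  have hne : (Mark.usual v : Mark α) ≠ .usual w := by simpa using hvw
  have hno : ∀ m₁ m₂ m₃, T.IsTriple N m₁ m₂ m₃ →
      T.componentMarks N m₁ = T.componentMarks N (.usual v) → False :=
    fun _ _ _ h heq => h.false_of_pair (heq.trans hm)
  rw [mem_iff_of_toEdge hF h, ← isEndEdge_iff hF, ← mayEmpower_usual_iff]
  constructor
  · intro h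
    cases h with
    | one _ y _ hm' =>
      have : (Mark.usual w : Mark α) ∈ T.componentMarks N (.usual v) := by simp [hm]
      rw [hm', Set.mem_singleton_iff] at this
      exact absurd this.symm hne
    | two _ m' _ hne' hm' hn he =>
      have : m' ∈ T.componentMarks N (.usual v) := by simp [hm']
      rw [hm] at this
      rcases this with rfl | rfl
      · exact absurd rfl hne'
      · exact ⟨hn, he⟩
    | leaf _ m' _ _ h => exact (hno _ _ _ h rfl).elim
    | left _ w z _ h => exact (hno _ _ _ h.triple rfl).elim
    | right w _ z _ h =>
      exact (hno _ _ _ h.triple (h.triple.marks_eq.trans h.triple.componentMarks_right.symm)).elim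
    | middle w z _ _ h =>
      exact (hno _ _ _ h.triple (h.triple.marks_eq.trans h.triple.componentMarks_mid.symm)).elim
  · exact fun h => .two _ _ e hne hm h.1 h.2

lemma OnPath.symm (h : T.OnPath N v w z) : T.OnPath N w v z := by
  obtain ⟨p, hp, hz⟩ := h
  exact ⟨p.reverse, hp.reverse, by simpa using hz⟩

lemma Empowers.mayEmpower (h : T.Empowers B₀ N m e) (hm : m' ∈ T.componentMarks N m)
    (hne : m' ≠ m) : T.MayEmpower m := by
  cases h with
  | one _ _ _ hm' =>
    rw [hm', Set.mem_singleton_iff] at hm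
    exact absurd hm hne
  | two _ _ _ _ _ hn => exact hn
  | leaf _ _ _ _ _ _ _ _ hn => exact hn
  | left _ _ _ _ _ hn => exact hn
  | right _ _ _ _ _ hn => exact hn
  | middle _ _ _ _ _ hn => exact hn

/-- The edges empowered by the mark `m` in a component with two other marks `m₂` and `m₃`. -/
lemma Empowers.cases_of_isTriple (h : T.Empowers B₀ N m e) (ht : T.IsTriple N m m₂ m₃) :
    T.MayEmpower m ∧
    ((¬ T.OnPath N m₂.vertex m₃.vertex m.vertex ∧ ¬ T.OnPath N m.vertex m₃.vertex m₂.vertex ∧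
        ¬ T.OnPath N m.vertex m₂.vertex m₃.vertex ∧
        (T.IsEndEdge N m.vertex m₂.vertex e ∨ T.IsEndEdge N m.vertex m₃.vertex e)) ∨
      (T.OnPath N m.vertex m₂.vertex m₃.vertex ∧ T.IsEndEdge N m.vertex m₂.vertex e ∧
        ∃ v w, m = .usual v ∧ m₂ = .usual w) ∨
      (T.OnPath N m.vertex m₃.vertex m₂.vertex ∧ T.IsEndEdge N m.vertex m₃.vertex e ∧
        ∃ v w, m = .usual v ∧ m₃ = .usual w) ∨
      (∃ v w, (m₂ = .usual v ∧ m₃ = .usual w ∨ m₂ = .usual w ∧ m₃ = .usual v) ∧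
        T.IsSandwiched B₀ N v w m ∧ T.IsMiddleEdge B₀ N v w m.vertex e)) := by
  have key : ∀ {m' m''}, T.componentMarks N m = {m, m', m''} → m ≠ m' → m ≠ m'' → m' ≠ m'' →
      (m' = m₂ ∧ m'' = m₃) ∨ (m' = m₃ ∧ m'' = m₂) := by
    intro m' m'' hm h1 h2 h3
    have h' : m' ∈ T.componentMarks N m := by simp [hm]
    have h'' : m'' ∈ T.componentMarks N m := by simp [hm]
    rw [ht.marks_eq] at h' h''
    simp only [Set.mem_insert_iff, Set.mem_singleton_iff, h1.symm, h2.symm, false_or] at h' h''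
    rcases h' with rfl | rfl <;> rcases h'' with rfl | rfl <;> simp_all
  have hm₂ : m₂ ∈ T.componentMarks N m := by simp [ht.marks_eq]
  refine ⟨h.mayEmpower hm₂ ht.ne₁.symm, ?_⟩
  cases h with
  | one _ _ _ hm' =>
    rw [hm', Set.mem_singleton_iff] at hm₂
    exact absurd hm₂ ht.ne₁.symm
  | two _ _ _ _ hm' => exact (ht.false_of_pair hm').elim
  | leaf _ v w _ h h₁ h₂ h₃ _ he =>
    rcases key h.marks_eq h.ne₁ h.ne₂ h.ne₃ with ⟨rfl, rfl⟩ | ⟨rfl, rfl⟩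
    · exact .inl ⟨h₁, h₂, h₃, .inl he⟩
    · exact .inl ⟨fun h => h₁ h.symm, h₃, h₂, .inr he⟩
  | left v w z _ h _ he =>
    rcases key h.triple.marks_eq h.triple.ne₁ h.triple.ne₂ h.triple.ne₃ with
      ⟨rfl, rfl⟩ | ⟨rfl, rfl⟩
    · exact .inr (.inl ⟨h.onPath, he, v, w, rfl, rfl⟩)
    · exact .inr (.inr (.inl ⟨h.onPath, he, v, w, rfl, rfl⟩))
  | right v w z _ h _ he =>
    have hm := h.triple.componentMarks_right
    rw [Set.insert_comm] at hm
    rcases key hm h.triple.ne₁.symm h.triple.ne₃ h.triple.ne₂ with ⟨rfl, rfl⟩ | ⟨rfl, rfl⟩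
    · exact .inr (.inl ⟨h.onPath.symm, he, w, v, rfl, rfl⟩)
    · exact .inr (.inr (.inl ⟨h.onPath.symm, he, w, v, rfl, rfl⟩))
  | middle v w _ _ h _ he =>
    have hm : T.componentMarks N m = {m, .usual v, .usual w} := by
      rw [h.triple.componentMarks_mid]
      ext x
      simp only [Set.mem_insert_iff, Set.mem_singleton_iff]
      tauto
    refine .inr (.inr (.inr ⟨v, w, ?_, h, he⟩))
    rcases key hm h.triple.ne₂.symm h.triple.ne₃.symm h.triple.ne₁ with ⟨rfl, rfl⟩ | ⟨rfl, rfl⟩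
    · exact .inl ⟨rfl, rfl⟩
    · exact .inr ⟨rfl, rfl⟩

lemma IsTriple.swap (h : T.IsTriple N m₁ m₂ m₃) : T.IsTriple N m₂ m₁ m₃ :=
  ⟨h.ne₁.symm, h.ne₃, h.ne₂, by rw [h.componentMarks_right, Set.insert_comm]⟩

lemma IsTriple.swap_right (h : T.IsTriple N m₁ m₂ m₃) : T.IsTriple N m₁ m₃ m₂ :=
  ⟨h.ne₂, h.ne₁, h.ne₃.symm, by rw [h.marks_eq, Set.pair_comm]⟩

/-- The edges empowered by an outer mark. -/
lemma empowers_iff_of_btw (hF : IsForest T.graph N.edges)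
    (ht : T.IsTriple N (.usual v) (.usual w) m) (hb : Btw T.graph N.edges v w m.vertex)
    (hτ : T.vtype B₀ v ≠ T.vtype B₀ w) (hm : ∀ z, m = .usual z → z ≠ v ∧ z ≠ w)
    (h : ToEdge T.graph T.IsApex N.edges v w mv) :
    T.Empowers B₀ N (.usual v) e ↔ e ∈ mv := by
  rw [mem_iff_of_toEdge hF h, ← isEndEdge_iff hF, ← mayEmpower_usual_iff]
  have hb' := (onPath_iff hF).2 hb
  constructor
  · intro he
    -- The order of the marks along the path rules out every role of `v` but that of an outer mark.
    obtain ⟨hn, ⟨-, -, h, -⟩ | ⟨-, he, -⟩ | ⟨h, -, -, z, -, rfl⟩ | ⟨v', w', hvw, h, -⟩⟩ :=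
      he.cases_of_isTriple ht
    · exact absurd hb' h
    · exact ⟨hn, he⟩
    · exact absurd (Btw.antisymm hF ((onPath_iff hF).1 h.symm) hb).symm (hm z rfl).2
    · obtain ⟨z, rfl⟩ : ∃ z, m = .usual z := by
        rcases hvw with ⟨-, h⟩ | ⟨-, h⟩
        exacts [⟨_, h⟩, ⟨_, h⟩]
      have h' : Btw T.graph N.edges w z v := by
        rcases hvw with ⟨hw, hz⟩ | ⟨hw, hz⟩ <;> cases hw <;> cases hz
        · exact (onPath_iff hF).1 h.onPath
        · exact ((onPath_iff hF).1 h.onPath).symm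
      exact absurd (Btw.antisymm hF h'.symm hb.symm).symm (hm z rfl).1
  · rintro ⟨hn, he⟩
    rcases hτ.lt_or_gt with hlt | hlt
    · exact .left v w m e ⟨ht, hlt, hb'⟩ hn he
    · exact .right w v m e ⟨ht.swap, hlt, hb'.symm⟩ hn he

/-- The edges empowered by the middle mark. -/
lemma empowers_iff_of_sandwich (hF : IsForest T.graph N.edges)
    (ht : T.IsTriple N (.usual v) (.usual w) m) (hb : Btw T.graph N.edges v w m.vertex)
    (hτ : T.vtype B₀ v < T.vtype B₀ w) (hm : ∀ z, m = .usual z → z ≠ v ∧ z ≠ w)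
    (hn : T.MayEmpower m) (h : FirstDart T.graph N.edges m.vertex v
      (fun a b => T.vtype B₀ b ≠ T.vtype B₀ w ∧ T.vtype B₀ a ≠ T.vtype B₀ v) e₀ a b) :
    T.Empowers B₀ N m e ↔ e = e₀ := by
  have hb' := (onPath_iff hF).2 hb
  have ht' : T.IsTriple N m (.usual v) (.usual w) := ht.swap_right.swap
  have hs : T.IsSandwiched B₀ N v w m := ⟨ht, hτ, hb'⟩
  constructor
  · intro he
    obtain ⟨hn, ⟨h, -⟩ | h | h | ⟨v', w', hvw, h', he⟩⟩ := he.cases_of_isTriple ht'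
    · exact absurd hb' h
    · obtain ⟨h, -, z, _, rfl, -⟩ := h
      exact absurd (Btw.antisymm hF hb.symm ((onPath_iff hF).1 h).symm) (hm z rfl).2
    · obtain ⟨h, -, z, _, rfl, -⟩ := h
      exact absurd (Btw.antisymm hF hb ((onPath_iff hF).1 h).symm) (hm z rfl).1
    · obtain ⟨rfl, rfl⟩ : v' = v ∧ w' = w := by
        rcases hvw with ⟨h1, h2⟩ | ⟨h1, h2⟩ <;> cases h1 <;> cases h2
        · exact ⟨rfl, rfl⟩
        · exact absurd h'.type_lt hτ.not_gt
      obtain ⟨_, _, h'⟩ := (isMiddleEdge_iff hF).1 he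
      exact FirstDart.unique hF h' h
  · rintro rfl
    exact .middle v w m e hs hn ((isMiddleEdge_iff hF).2 ⟨a, b, h⟩)

/-- The edges empowered by a usual mark in the tripod case. -/
lemma empowers_iff_of_tripod (hF : IsForest T.graph N.edges)
    (h : IsTripodAt T.graph (T.vtype B₀) T.IsApex N.edges v w z mv mw mz)
    (ht : T.IsTriple N (.usual v) (.usual w) (.usual z)) :
    T.Empowers B₀ N (.usual v) e ↔ e ∈ mv := by
  have hvw : v ≠ w := fun h' => h.ne₁ (h' ▸ rfl)
  have hwz : w ≠ z := fun h' => h.ne₂ (h' ▸ rfl)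
  have hzv : z ≠ v := fun h' => h.ne₃ (h' ▸ rfl)
  have hvz : ToEdge T.graph T.IsApex N.edges v z mv :=
    h.toEdge₁.of_not_btw hF h.conn₂ hzv h.leaf₁
  -- A special vertex of a tripod may lie between the other two marks. Then `v` is an outer mark in
  -- the sense of the sandwich rule, with the same edge.
  by_cases hz : Btw T.graph N.edges v w z
  · refine empowers_iff_of_btw hF ht hz h.ne₁ (fun x hx => ?_) h.toEdge₁
    cases hx
    exact ⟨hzv, hwz.symm⟩
  by_cases hw : Btw T.graph N.edges v z w
  · refine empowers_iff_of_btw hF ht.swap_right hw h.ne₃.symm (fun x hx => ?_) hvz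
    cases hx
    exact ⟨hvw.symm, hwz⟩
  by_cases hv : T.IsApex v
  · refine iff_of_false (fun he => ?_) fun he => h.toEdge₁.not_sp he hv
    exact mayEmpower_usual_iff.1 (he.cases_of_isTriple ht).1 hv
  have hb : ¬ Btw T.graph N.edges w z v := h.leaf₁.resolve_left hv
  constructor
  · intro he
    obtain ⟨-, ⟨-, -, -, he⟩ | ⟨h, -⟩ | ⟨h, -⟩ | ⟨v', w', hvw, h', he⟩⟩ := he.cases_of_isTriple ht
    · rcases he with he | he
      · exact (mem_iff_of_toEdge hF h.toEdge₁).2 ⟨hv, (isEndEdge_iff hF).1 he⟩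
      · exact (mem_iff_of_toEdge hF hvz).2 ⟨hv, (isEndEdge_iff hF).1 he⟩
    · exact absurd ((onPath_iff hF).1 h) hz
    · exact absurd ((onPath_iff hF).1 h) hw
    · have := (onPath_iff hF).1 h'.onPath
      rcases hvw with ⟨h1, h2⟩ | ⟨h1, h2⟩ <;> cases h1 <;> cases h2
      · exact absurd this hb
      · exact absurd this.symm hb
  · intro he
    exact .leaf _ _ _ e ht (fun h => hb ((onPath_iff hF).1 h)) (fun h => hw ((onPath_iff hF).1 h))
      (fun h => hz ((onPath_iff hF).1 h)) (mayEmpower_usual_iff.2 hv)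
      ((isEndEdge_iff hF).2 ((mem_iff_of_toEdge hF h.toEdge₁).1 he).2)

/-! ### The weights of a component -/

lemma count_of_toEdge (h : ToEdge T.graph T.IsApex N.edges v w mv) [Decidable (e ∈ mv)] :
    mv.count e = if e ∈ mv then 1 else 0 := by
  split_ifs with he
  · rw [h.eq_singleton he, Multiset.count_singleton_self]
  · exact Multiset.count_eq_zero_of_notMem he

omit [LinearOrder α] in
lemma ncard_sep_insert {P : Mark α → Prop} {S : Set (Mark α)} (hm : m ∉ S) (hS : S.Finite)
    [Decidable (P m)] :
    {x ∈ insert m S | P x}.ncard = (if P m then 1 else 0) + {x ∈ S | P x}.ncard := by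
  split_ifs with h
  · have : {x ∈ insert m S | P x} = insert m {x ∈ S | P x} := by
      ext x
      simp only [Set.mem_ofPred_eq, Set.mem_insert_iff]
      constructor
      · rintro ⟨rfl | hx, hP⟩
        exacts [.inl rfl, .inr ⟨hx, hP⟩]
      · rintro (rfl | hx)
        exacts [⟨.inl rfl, h⟩, ⟨.inr hx.1, hx.2⟩]
    rw [this, Set.ncard_insert_of_notMem (fun h => hm h.1) (hS.subset fun x hx => hx.1), add_comm]
  · have : {x ∈ insert m S | P x} = {x ∈ S | P x} := by
      ext x
      simp only [Set.mem_ofPred_eq, Set.mem_insert_iff]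
      constructor
      · rintro ⟨rfl | hx, hP⟩
        exacts [absurd hP h, ⟨hx, hP⟩]
      · exact fun hx => ⟨.inr hx.1, hx.2⟩
    rw [this, zero_add]

omit [LinearOrder α] in
lemma ncard_sep_singleton {P : Mark α → Prop} [Decidable (P m)] :
    {x ∈ ({m} : Set (Mark α)) | P x}.ncard = if P m then 1 else 0 := by
  have := ncard_sep_insert (P := P) (m := m) (S := ∅) (by simp) Set.finite_empty
  simpa using this

lemma phi₂_of_one (hF : IsForest T.graph N.edges) (he : e ∈ N.edges)
    (hi : InComp T.graph N.edges v e)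
    (hm : T.componentMarks N (.usual v) = {.usual v}) (hx : IsRoot T.graph N.edges x)
    (hvx : Conn T.graph N.edges v x) [Decidable (∃ b, OnDart T.graph N.edges v x e v b)] :
    T.phi₂ B₀ N e = 1 + if ∃ b, OnDart T.graph N.edges v x e v b then 1 else 0 := by
  classical
  rw [phi₂_apply hF he hi, hm, ncard_sep_singleton]
  simp only [empowers_iff_of_one hF hm hx hvx]

lemma weighted_phi₂_of_two (hF : IsForest T.graph N.edges) (hvw : v ≠ w)
    (hm : T.componentMarks N (.usual v) = {.usual v, .usual w})
    (h : ToEdge T.graph T.IsApex N.edges v w mv) (h' : ToEdge T.graph T.IsApex N.edges w v mw) :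
    Weighted T.graph N.edges (T.phi₂ B₀ N) v (mv + mw) := by
  classical
  intro e he hi
  have hc : T.componentMarks N (.usual w) = {.usual w, .usual v} := by
    have : Mark.usual w ∈ T.componentMarks N (.usual v) := by simp [hm]
    rw [← componentMarks_eq (mem_componentMarks.1 this).2, hm, Set.pair_comm]
  rw [phi₂_apply hF he hi, hm, ncard_sep_insert (by simpa using hvw) (Set.finite_singleton _),
    ncard_sep_singleton, Multiset.count_add, count_of_toEdge h, count_of_toEdge h']
  simp only [empowers_iff_of_two hF hvw hm h, empowers_iff_of_two hF hvw.symm hc h']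

lemma weighted_phi₂_of_tripod (hF : IsForest T.graph N.edges)
    (h : IsTripodAt T.graph (T.vtype B₀) T.IsApex N.edges v w z mv mw mz)
    (ht : T.IsTriple N (.usual v) (.usual w) (.usual z)) :
    Weighted T.graph N.edges (T.phi₂ B₀ N) v (mv + mw + mz) := by
  classical
  intro e he hi
  have h1 := empowers_iff_of_tripod (e := e) hF h ht
  have h2 := empowers_iff_of_tripod (e := e) hF h.rotate ht.swap.swap_right
  have h3 := empowers_iff_of_tripod (e := e) hF h.rotate.rotate ht.swap_right.swap
  rw [phi₂_apply hF he hi, ht.marks_eq, ncard_sep_insert (by simp [ht.ne₁, ht.ne₂]) (by simp),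
    ncard_sep_insert (by simp [ht.ne₃]) (by simp),
    ncard_sep_singleton, Multiset.count_add, Multiset.count_add, count_of_toEdge h.toEdge₁,
    count_of_toEdge h.toEdge₂, count_of_toEdge h.toEdge₃]
  simp only [h1, h2, h3, add_assoc]

lemma weighted_phi₂_of_sandwich (hF : IsForest T.graph N.edges)
    (h : IsSandwichAt T.graph (T.vtype B₀) T.IsApex N.edges v w z mv mw e₀ a b)
    (ht : T.IsTriple N (.usual v) (.usual w) m) (hz : m.vertex = z)
    (hm : ∀ z, m = .usual z → z ≠ v ∧ z ≠ w) (hn : T.MayEmpower m) :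
    Weighted T.graph N.edges (T.phi₂ B₀ N) v (mv + mw + {e₀}) := by
  classical
  intro e he hi
  subst hz
  have h1 := empowers_iff_of_btw (e := e) hF ht h.btw h.lt.ne hm h.left
  have h2 := empowers_iff_of_btw (e := e) hF ht.swap h.btw.symm h.lt.ne'
    (fun z hz => (hm z hz).symm) h.right
  have h3 := empowers_iff_of_sandwich (e := e) hF ht h.btw h.lt hm hn h.first
  rw [phi₂_apply hF he hi, ht.marks_eq, ncard_sep_insert (by simp [ht.ne₁, ht.ne₂]) (by simp),
    ncard_sep_insert (by simp [ht.ne₃]) (by simp),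
    ncard_sep_singleton, Multiset.count_add, Multiset.count_add, count_of_toEdge h.left,
    count_of_toEdge h.right, Multiset.count_singleton]
  simp only [h1, h2, h3, add_assoc]

end Empowers

end TriconedGraph

namespace TriconedGraph

/-! ### The marks of a spanning tree -/

section Marks

variable {α β : Type*} [LinearOrder α] [LinearOrder β] {T : TriconedGraph α β} {B₀ B S : Finset β}
  {e f g : β} {u v w x y z u₀ u₁ u₂ v₀ v₁ v₂ w₀ w₁ w₂ : α} {r s t : ℕ}

/-- There is no edge outside of the smallest spanning tree at the vertex `0`. -/
lemma conn_zero (hB₀ : IsLexSmallestTree T.graph B₀) (hS : ∀ e ∈ S, e ∉ B₀)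
    (h : Conn T.graph S x (T.c 0)) : x = T.c 0 := by
  by_contra hx
  obtain ⟨e, he, y, -, hl⟩ := Conn.eq_or_exists_isLink h.symm (Ne.symm hx)
  exact ne_zero_of_not_mem_tree hB₀ (hS e he) hl rfl

lemma isMarked_iff (hB₀ : IsLexSmallestTree T.graph B₀) : T.IsMarked B₀ B u ↔
    T.IsApex u ∨ (¬ T.IsApex u ∧ ∃ e ∈ B, ∃ v, T.IsConeLink e v u) := by
  unfold IsMarked
  constructor
  · rintro (h | h | ⟨e, he, -, -, v, h⟩)
    · exact .inl (.inl h)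
    · exact .inl (.inr h)
    · by_cases hu : T.IsApex u
      · exact .inl hu
      · exact .inr ⟨hu, e, (Finset.mem_inter.1 he).1, v, (isConeEdge_iff hB₀).1 h⟩
  · rintro ((h | h) | ⟨hu, e, he, v, h⟩)
    · exact .inl h
    · exact .inr (.inl h)
    · refine .inr (.inr ⟨e, Finset.mem_inter.2 ⟨he, h.mem_tree hB₀⟩, fun hl => hu (.inl ?_),
        fun hl => hu (.inr ?_), v, (isConeEdge_iff hB₀).2 h⟩)
      · exact (h.eq_of_isLink ⟨hl, .inl rfl⟩).2
      · exact (h.eq_of_isLink ⟨hl, .inl rfl⟩).2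

lemma IsMarked.of_isApex (hB₀ : IsLexSmallestTree T.graph B₀) (h : T.IsApex u) :
    T.IsMarked B₀ B u := (isMarked_iff hB₀).2 (.inl h)

lemma IsMarked.exists_isConeLink (hB₀ : IsLexSmallestTree T.graph B₀) (h : T.IsMarked B₀ B u)
    (hu : ¬ T.IsApex u) : ∃ e ∈ B, T.IsConeLink e (T.apex (T.vtype B₀ u)) u := by
  obtain ⟨-, e, he, v, h⟩ := ((isMarked_iff hB₀).1 h).resolve_left hu
  exact ⟨e, he, h.eq_apex hB₀ hu ▸ h⟩

lemma IsMarked.mem_vertexSet (hB₀ : IsLexSmallestTree T.graph B₀) (h : T.IsMarked B₀ B u) :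
    u ∈ V(T.graph) := by
  rcases (isMarked_iff hB₀).1 h with (rfl | rfl) | ⟨-, e, -, v, h⟩
  exacts [c_mem 1, c_mem 2, h.1.right_mem]

/-- A marked vertex is joined to the special vertex of its type, without its own edge of the
smallest spanning tree if it is special. -/
lemma IsMarked.conn_apex (hB₀ : IsLexSmallestTree T.graph B₀) (h : T.IsMarked B₀ B u)
    (he : T.IsConeLink e y w) (hw : w = u → T.IsApex u) :
    Conn T.graph (B.erase e) u (T.apex (T.vtype B₀ u)) := by
  by_cases hu : T.IsApex u
  · rw [apex_vtype hB₀ hu]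
  · obtain ⟨f, hf, hl⟩ := h.exists_isConeLink hB₀ hu
    refine (conn_of_isLink (Finset.mem_erase.2 ⟨?_, hf⟩) hl.1).symm
    rintro rfl
    exact hu (hw (he.eq_of_isLink hl).2)

lemma sdiff_subset_erase (hB₀ : IsLexSmallestTree T.graph B₀) (he : T.IsConeLink e y w) :
    B \ B₀ ⊆ B.erase e := fun _ hf =>
  Finset.mem_erase.2 ⟨fun h => (Finset.mem_sdiff.1 hf).2 (h ▸ he.mem_tree hB₀),
    (Finset.mem_sdiff.1 hf).1⟩

/-- Two marked vertices of a component join the special vertices of their types. -/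
lemma conn_apex_apex (hB₀ : IsLexSmallestTree T.graph B₀) (he : T.IsConeLink e y w)
    (hu : T.IsMarked B₀ B u) (hv : T.IsMarked B₀ B v) (huv : Conn T.graph (B \ B₀) u v)
    (hwu : w = u → T.IsApex u) (hwv : w = v → T.IsApex v) :
    Conn T.graph (B.erase e) (T.apex (T.vtype B₀ u)) (T.apex (T.vtype B₀ v)) :=
  ((hu.conn_apex hB₀ he hwu).symm.trans (huv.mono (sdiff_subset_erase hB₀ he))).trans
    (hv.conn_apex hB₀ he hwv)

/-- Without the edge of the smallest spanning tree below a normal marked vertex `u`, the special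
vertices of the types of two marks of its component are not connected. -/
lemma not_conn_apex (hB₀ : IsLexSmallestTree T.graph B₀) (hB : IsForest T.graph B)
    (hv : T.IsMarked B₀ B v) (hne : u ≠ v)
    (huv : Conn T.graph (B \ B₀) u v) (heB : e ∈ B)
    (he : T.IsConeLink e (T.apex (T.vtype B₀ u)) u) :
    ¬ Conn T.graph (B.erase e) (T.apex (T.vtype B₀ u)) (T.apex (T.vtype B₀ v)) := fun hc =>
  hB e heB _ _ he.1 ((hc.trans (hv.conn_apex hB₀ he (fun h => absurd h hne)).symm).trans
    (huv.mono (sdiff_subset_erase hB₀ he)).symm)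

/-- The marks of a component have different types. -/
lemma IsMarked.vtype_ne (hB₀ : IsLexSmallestTree T.graph B₀) (hB : IsForest T.graph B)
    (hu : T.IsMarked B₀ B u) (hv : T.IsMarked B₀ B v) (hne : u ≠ v)
    (huv : Conn T.graph (B \ B₀) u v) : T.vtype B₀ u ≠ T.vtype B₀ v := by
  intro ht
  by_cases hua : T.IsApex u
  · by_cases hva : T.IsApex v
    · rw [← apex_vtype hB₀ hua, ht, apex_vtype hB₀ hva] at hne
      exact hne rfl
    · obtain ⟨e, he, hl⟩ := hv.exists_isConeLink hB₀ hva
      refine not_conn_apex hB₀ hB hu hne.symm huv.symm he hl ?_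
      rw [ht]
  · obtain ⟨e, he, hl⟩ := hu.exists_isConeLink hB₀ hua
    refine not_conn_apex hB₀ hB hv hne huv he hl ?_
    rw [ht]

variable (T B₀ B) in
/-- The component of `x` has a mark of type `t`. -/
def HasType (x : α) (t : ℕ) : Prop :=
  ∃ u, T.IsMarked B₀ B u ∧ Conn T.graph (B \ B₀) x u ∧ T.vtype B₀ u = t

/-- Two components do not have marks of the same two types. -/
lemma HasType.conn (hB₀ : IsLexSmallestTree T.graph B₀) (hB : IsForest T.graph B) (hst : s ≠ t)
    (hxs : T.HasType B₀ B x s) (hxt : T.HasType B₀ B x t) (hys : T.HasType B₀ B y s)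
    (hyt : T.HasType B₀ B y t) : Conn T.graph (B \ B₀) x y := by
  obtain ⟨u, hu, hxu, rfl⟩ := hxs
  obtain ⟨v, hv, hxv, rfl⟩ := hxt
  obtain ⟨u', hu', hyu', htu⟩ := hys
  obtain ⟨v', hv', hyv', htv⟩ := hyt
  by_contra hxy
  have huv : u ≠ v := fun h => hst (h ▸ rfl)
  have huv' : u' ≠ v' := fun h => hst (by rw [← htu, ← htv, h])
  have huu : u ≠ u' := fun h => hxy (hxu.trans (h ▸ hyu'.symm))
  have huv₁ : u ≠ v' := fun h => hst (by rw [← htv, h])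
  have huv₂ : u' ≠ v := fun h => hst (by rw [← htu, h])
  have hc := hxu.symm.trans hxv
  have hc' := hyu'.symm.trans hyv'
  -- At least one of `u`, `u'` is normal, having the same type. Without its parent edge the marks of
  -- the other component still join the special vertices `s` and `t`, so that edge lies on a cycle.
  by_cases hua : T.IsApex u
  · have hua' : ¬ T.IsApex u' := fun h => huu (by
      rw [← apex_vtype hB₀ hua, ← htu, apex_vtype hB₀ h])
    obtain ⟨e, he, hl⟩ := hu'.exists_isConeLink hB₀ hua'
    refine not_conn_apex hB₀ hB hv' huv' hc' he hl ?_
    rw [htu, htv]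
    exact conn_apex_apex hB₀ hl hu hv hc (fun h => absurd h.symm huu) fun h => absurd h huv₂
  · obtain ⟨e, he, hl⟩ := hu.exists_isConeLink hB₀ hua
    refine not_conn_apex hB₀ hB hv huv hc he hl ?_
    rw [← htu, ← htv]
    exact conn_apex_apex hB₀ hl hu' hv' hc' (fun h => absurd h huu) fun h => absurd h huv₁

lemma not_isApex_of_vtype (hB₀ : IsLexSmallestTree T.graph B₀) (h : T.vtype B₀ u = 0) :
    ¬ T.IsApex u := fun hu => vtype_ne_zero_of_isApex hB₀ hu h

/-- A component with marks of type `0` and `r`, when the types `0` and `r` are joined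
otherwise. -/
lemma HasType.false_of_conn (hB₀ : IsLexSmallestTree T.graph B₀) (hB : IsForest T.graph B)
    (hr : r ≠ 0) (hx0 : T.HasType B₀ B x 0) (hxr : T.HasType B₀ B x r)
    (h : ∀ e u, T.vtype B₀ u = 0 → ¬ T.IsApex u → T.IsMarked B₀ B u → Conn T.graph (B \ B₀) x u →
      T.IsConeLink e (T.c 0) u → Conn T.graph (B.erase e) (T.c 0) (T.apex r)) : False := by
  obtain ⟨u, hu, hxu, h0⟩ := hx0
  obtain ⟨v, hv, hxv, rfl⟩ := hxr
  have hua := not_isApex_of_vtype hB₀ h0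
  obtain ⟨e, he, hl⟩ := hu.exists_isConeLink hB₀ hua
  refine not_conn_apex hB₀ hB hv (fun h => hr (h ▸ h0)) (hxu.symm.trans hxv) he hl ?_
  rw [h0] at hl ⊢
  exact h e u h0 hua hu hxu hl

/-- The types `s` and `t` of two marks of a component are joined. -/
lemma HasType.conn_apex (hB₀ : IsLexSmallestTree T.graph B₀) (hys : T.HasType B₀ B y s)
    (hyt : T.HasType B₀ B y t) (hl : T.IsConeLink e z u)
    (hu : ∀ v, Conn T.graph (B \ B₀) y v → v = u → T.IsApex v ∨ T.vtype B₀ v ≠ s ∧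
      T.vtype B₀ v ≠ t) :
    Conn T.graph (B.erase e) (T.apex s) (T.apex t) := by
  obtain ⟨v, hv, hyv, rfl⟩ := hys
  obtain ⟨w, hw, hyw, rfl⟩ := hyt
  exact conn_apex_apex hB₀ hl hv hw (hyv.symm.trans hyw)
    (fun h => (hu v hyv h.symm).resolve_right fun h => h.1 rfl)
    (fun h => (hu w hyw h.symm).resolve_right fun h => h.2 rfl)

/-- Three components do not have marks of the types `0, 1` and `1, 2` and `0, 2`. -/
lemma HasType.false_of_three (hB₀ : IsLexSmallestTree T.graph B₀) (hB : IsForest T.graph B)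
    (hx0 : T.HasType B₀ B x 0) (hx1 : T.HasType B₀ B x 1) (hy1 : T.HasType B₀ B y 1)
    (hy2 : T.HasType B₀ B y 2) (hz0 : T.HasType B₀ B z 0) (hz2 : T.HasType B₀ B z 2)
    (hxz : ¬ Conn T.graph (B \ B₀) x z) : False := by
  refine hx0.false_of_conn hB₀ hB one_ne_zero hx1 fun e u h0 hua hu hxu hl => ?_
  -- Without the edge `0u` the component of `z` still joins `0` to `2`, and that of `y` joins `2` to
  -- `1`.
  have h1 := hz0.conn_apex hB₀ hz2 hl fun v hv h => absurd (hxu.trans (h ▸ hv.symm)) hxz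
  have h2 := hy2.conn_apex hB₀ hy1 hl fun v hv h => .inr (by rw [h, h0]; decide)
  exact h1.trans h2

lemma conn_zero_apex (h : T.IsConeLink f (T.c 0) w) (hf : f ∈ B) (he : T.IsConeLink e y u)
    (hwu : w ≠ u) : Conn T.graph (B.erase e) (T.c 0) w :=
  conn_of_isLink (Finset.mem_erase.2 ⟨fun h' => hwu (h.eq_of_isLink (h' ▸ he)).2, hf⟩) h.1

/-- If the edge `0r` belongs to the spanning tree, then no component has marks of the types `0` and
`r`. -/
lemma HasType.false_of_mem (hB₀ : IsLexSmallestTree T.graph B₀) (hB : IsForest T.graph B)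
    (hw : T.IsApex w) (hf : f ∈ B) (hl : T.IsConeLink f (T.c 0) w) (hx0 : T.HasType B₀ B x 0)
    (hxw : T.HasType B₀ B x (T.vtype B₀ w)) : False := by
  refine hx0.false_of_conn hB₀ hB (vtype_ne_zero_of_isApex hB₀ hw) hxw fun e u h0 hua hu hxu he => ?_
  rw [apex_vtype hB₀ hw]
  exact conn_zero_apex hl hf he fun h => hua (h ▸ hw)

/-- If the edge `02` belongs to the spanning tree, then there are no two components with marks of
the types `0, 1` and `1, 2`. -/
lemma HasType.false_of_mem_two (hB₀ : IsLexSmallestTree T.graph B₀) (hB : IsForest T.graph B)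
    (hf : f ∈ B) (hl : T.IsConeLink f (T.c 0) (T.c 2)) (hx0 : T.HasType B₀ B x 0)
    (hx1 : T.HasType B₀ B x 1) (hy1 : T.HasType B₀ B y 1) (hy2 : T.HasType B₀ B y 2) : False := by
  refine hx0.false_of_conn hB₀ hB one_ne_zero hx1 fun e u h0 hua hu hxu he => ?_
  have h1 := conn_zero_apex hl hf he fun h => hua (h ▸ .inr rfl)
  have h2 := hy2.conn_apex hB₀ hy1 he fun v hv h => .inr (by rw [h, h0]; decide)
  exact h1.trans h2

/-- A path in the spanning tree leaves a component at a mark. -/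
lemma exists_isMarked_of_not_conn (hB₀ : IsLexSmallestTree T.graph B₀) {S' : Finset β}
    (hS : S ⊆ B) (hS' : ∀ e ∈ S, e ∉ S' → e ∈ B₀) (hS₀ : ∀ e ∈ S', e ∉ B₀)
    (hx : x ≠ T.c 0) (h : Conn T.graph S x y) (h' : ¬ Conn T.graph S' x y) :
    ∃ u, T.IsMarked B₀ B u ∧ Conn T.graph S' x u := by
  obtain ⟨e, he, a, b, hl, -, ha, hb⟩ := h.exists_switch (P := Conn T.graph S' x) (Conn.refl x) h'
  have he' : e ∉ S' := fun he => hb (ha.trans (conn_of_isLink he hl))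
  refine ⟨a, ?_, ha⟩
  rw [isMarked_iff hB₀]
  by_cases haa : T.IsApex a
  · exact .inl haa
  · obtain ⟨v, u, h⟩ := (mem_tree_iff hB₀).1 (hS' e he he')
    -- The path leaves along an edge of `B₀`. If `a` is its child, `a` is marked; if `a` is the
    -- parent, it is special, and `0` is excluded because it is isolated in `S'`.
    rcases hl.eq_and_eq_or_eq_and_eq h.1 with ⟨rfl, rfl⟩ | ⟨rfl, rfl⟩
    · obtain ⟨i, rfl⟩ := h.exists_eq
      fin_cases i
      · exact absurd (conn_zero hB₀ hS₀ ha) hx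
      · exact absurd (.inl rfl) haa
      · exact absurd (.inr rfl) haa
    · exact .inr ⟨haa, e, hS he, _, h⟩

lemma not_mem_of_mem_sdiff (e : β) (he : e ∈ B \ B₀) : e ∉ B₀ := (Finset.mem_sdiff.1 he).2

/-- Every component has a mark. -/
lemma exists_isMarked (hB₀ : IsLexSmallestTree T.graph B₀) (hB : IsSpanningTree T.graph B)
    (hx : x ∈ V(T.graph)) (hx0 : x ≠ T.c 0) :
    ∃ u, T.IsMarked B₀ B u ∧ Conn T.graph (B \ B₀) x u := by
  refine exists_isMarked_of_not_conn hB₀ subset_rfl (fun e he he' => ?_) not_mem_of_mem_sdiff hx0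
    (hB.connected x hx _ (c_mem 0)) fun h => hx0 (conn_zero hB₀ not_mem_of_mem_sdiff h)
  by_contra h
  exact he' (Finset.mem_sdiff.2 ⟨he, h⟩)

end Marks

end TriconedGraph

namespace TriconedGraph

/-! ### The extra mark -/

section ExtraMark

variable {α β : Type*} [LinearOrder α] [LinearOrder β] {T : TriconedGraph α β} {B₀ B S : Finset β}
  {e f g : β} {u v w x y z a b : α} {r s t : ℕ}

lemma isConeLink_two (h : T.graph.IsLink f (T.c 0) (T.c 2)) : T.IsConeLink f (T.c 0) (T.c 2) :=
  ⟨h, .inl rfl⟩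

/-- Children of `2` are no parents in `B₀`, and the only edge of `B₀` from `2` to its parent is
`02`. So without `02` the part of `B ∩ B₀` around `2` is a star. -/
lemma conn_two_cases (hB₀ : IsLexSmallestTree T.graph B₀)
    (hf : T.graph.IsLink f (T.c 0) (T.c 2)) (h : Conn T.graph ((B ∩ B₀).erase f) (T.c 2) y) :
    y = T.c 2 ∨ ∃ e ∈ B, T.IsConeLink e (T.c 2) y := by
  refine h.induction (P := fun y => y = T.c 2 ∨ ∃ e ∈ B, T.IsConeLink e (T.c 2) y) (.inl rfl)
    fun e he a b hl _ ha => ?_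
  obtain ⟨hef, he⟩ := Finset.mem_erase.1 he
  obtain ⟨heB, he₀⟩ := Finset.mem_inter.1 he
  obtain ⟨v, u, h⟩ := (mem_tree_iff hB₀).1 he₀
  rcases ha with rfl | ⟨e', -, h'⟩
  · rcases hl.eq_and_eq_or_eq_and_eq h.1 with ⟨rfl, rfl⟩ | ⟨rfl, rfl⟩
    · exact .inr ⟨e, heB, h⟩
    · exact absurd (h.unique (isConeLink_two hf)).2 hef
  · rcases hl.eq_and_eq_or_eq_and_eq h.1 with ⟨rfl, rfl⟩ | ⟨rfl, rfl⟩
    · exfalso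
      obtain ⟨i, rfl⟩ := h.exists_eq
      rcases h'.2 with h' | ⟨-, h'⟩ | ⟨-, h', -⟩
      · exact T.c_ne (by decide) h'
      · exact not_isHeightTwo_c i h'
      · exact not_isHeightTwo_c i h'
    · exact .inl (h.unique h').1

lemma IsConeLink.vtype_eq_two (hB₀ : IsLexSmallestTree T.graph B₀)
    (h : T.IsConeLink e (T.c 2) u) : ¬ T.IsApex u ∧ T.vtype B₀ u = 2 := by
  have hu : ¬ T.IsApex u := fun hu => T.c_ne (by decide) (not_isConeLink_of_isApex hu h)
  refine ⟨hu, ?_⟩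
  have h' := h.eq_apex hB₀ hu
  unfold apex at h'
  split_ifs at h' with h1 h2
  · exact absurd h' (T.c_ne (by decide))
  · exact h2
  · exact absurd h' (T.c_ne (by decide))

/-- Before its first edge outside `B₀` the path stays in the star around `2`, so `u` is `2` or a
marked child of `2`. After that edge it reaches `1` within the component or leaves the component at
another mark `v`. The type of `v` is not `2`, as types are distinct, and not `0`, as `02` would
close a cycle; so it is `1`. -/
lemma IsDoublyMarked.spec (hB₀ : IsLexSmallestTree T.graph B₀) (hB : IsSpanningTree T.graph B)
    (h : T.IsDoublyMarked B₀ B u) : (∃ f ∈ B, T.IsConeLink f (T.c 0) (T.c 2)) ∧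
      T.IsMarked B₀ B u ∧ T.vtype B₀ u = 2 ∧ T.HasType B₀ B u 1 := by
  obtain ⟨⟨f, hf, hl⟩, p, hp, hfp, d, hd, rfl⟩ := h
  have hBF : IsForest T.graph B := hB.acyclic
  obtain ⟨e, he, hel⟩ := hd.1
  obtain ⟨heB, he₀⟩ := Finset.mem_sdiff.1 he
  have hd := firstDart_of_isFirstDart (Q := fun a b => ∃ e ∈ B \ B₀, T.graph.IsLink e a b) hBF hp
    (fun _ => Iff.rfl) hd heB hel
  have hS : Conn T.graph ((B ∩ B₀).erase f) (T.c 2) d.fst := by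
    by_contra hS
    obtain ⟨g, a, b, hg, ha, hb⟩ := exists_onDart_switch (P := Conn T.graph _ (T.c 2)) hBF
      hd.dart.conn_left (Conn.refl _) hS
    have hg' : g ∉ (B ∩ B₀).erase f := fun h => hb (ha.trans (conn_of_isLink h hg.isLink))
    have hg₀ : g ∈ B₀ := by
      by_contra hg₀
      exact hd.first _ _ _ hg ⟨g, Finset.mem_sdiff.2 ⟨hg.mem, hg₀⟩, hg.isLink⟩
    obtain rfl : g = f := by
      by_contra hgf
      exact hg' (Finset.mem_erase.2 ⟨hgf, Finset.mem_inter.2 ⟨hg.mem, hg₀⟩⟩)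
    obtain ⟨d', hd', h1, h2⟩ :=
      (hg.trans_left hBF (hd.dart.btw_left hBF)).exists_mem_darts hBF hp
    refine hfp (List.mem_map.2 ⟨d', hd', ?_⟩)
    change s(d'.fst, d'.snd) = _
    rw [h1, h2, Sym2.eq_iff]
    exact hg.isLink.eq_and_eq_or_eq_and_eq hl
  obtain ⟨hu, hu2⟩ : T.IsMarked B₀ B d.fst ∧ T.vtype B₀ d.fst = 2 := by
    rcases conn_two_cases hB₀ hl hS with h | ⟨g, hg, h⟩
    · rw [h]
      exact ⟨.of_isApex hB₀ (.inr rfl), vtype_two hB₀⟩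
    · obtain ⟨h1, h2⟩ := h.vtype_eq_two hB₀
      exact ⟨(isMarked_iff hB₀).2 (.inr ⟨h1, g, hg, _, h⟩), h2⟩
  refine ⟨⟨f, hf, isConeLink_two hl⟩, hu, hu2, ?_⟩
  have key : ∃ v, T.IsMarked B₀ B v ∧ Conn T.graph ((B \ B₀).erase e) d.snd v := by
    by_cases hc : Conn T.graph ((B \ B₀).erase e) d.snd (T.c 1)
    · exact ⟨T.c 1, .of_isApex hB₀ (.inl rfl), hc⟩
    · refine exists_isMarked_of_not_conn hB₀ (Finset.erase_subset e B) (fun g hg hg' => ?_)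
        (fun g hg => not_mem_of_mem_sdiff g (Finset.mem_of_mem_erase hg))
        (ne_zero_of_not_mem_tree hB₀ he₀ hel.symm) hd.dart.right hc
      by_contra hg₀
      exact hg' (Finset.mem_erase.2 ⟨(Finset.mem_erase.1 hg).1,
        Finset.mem_sdiff.2 ⟨(Finset.mem_erase.1 hg).2, hg₀⟩⟩)
  obtain ⟨v, hv, hvc⟩ := key
  have hvu : v ≠ d.fst := by
    rintro rfl
    exact hBF.subset Finset.sdiff_subset e he _ _ hel.symm hvc
  have huv : Conn T.graph (B \ B₀) d.fst v :=
    (conn_of_isLink he hel).trans (hvc.mono (Finset.erase_subset e _))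
  refine ⟨v, hv, huv, ?_⟩
  have := vtype_lt (T := T) (B₀ := B₀) v
  obtain h2 | h0 | h1 : T.vtype B₀ v = 2 ∨ T.vtype B₀ v = 0 ∨ T.vtype B₀ v = 1 := by omega
  · exact absurd (hu2.trans h2.symm) (hu.vtype_ne hB₀ hBF hv hvu.symm huv)
  · refine (HasType.false_of_mem (x := d.fst) hB₀ hBF (.inr rfl) hf (isConeLink_two hl)
      ⟨v, hv, huv, h0⟩ ⟨_, hu, Conn.refl _, ?_⟩).elim
    rw [hu2, vtype_two hB₀]
  · exact h1

/-- If the edge `02` belongs to the spanning tree, then a mark of type `2` which has a mark of type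
`1` in its component is a double mark. -/
lemma IsMarked.isDoublyMarked (hB₀ : IsLexSmallestTree T.graph B₀) (hB : IsSpanningTree T.graph B)
    (hf : f ∈ B) (hl : T.graph.IsLink f (T.c 0) (T.c 2)) (hv : T.IsMarked B₀ B v)
    (hw : T.IsMarked B₀ B w) (hvw : Conn T.graph (B \ B₀) v w) (htv : T.vtype B₀ v = 1)
    (htw : T.vtype B₀ w = 2) : T.IsDoublyMarked B₀ B w := by
  have hBF : IsForest T.graph B := hB.acyclic
  have hc : Conn T.graph (B.erase f) (T.c 2) (T.c 1) := by
    have := conn_apex_apex hB₀ (isConeLink_two hl) hw hv hvw.symm (fun h => h ▸ .inr rfl)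
      (fun h => h ▸ .inr rfl)
    rwa [htv, htw] at this
  obtain ⟨p', hp'⟩ := hc.exists_isPath
  have hle : edgeGraph T.graph (B.erase f) ≤ edgeGraph T.graph B :=
    fun _ _ h => ⟨h.1, h.2.imp fun e he => ⟨Finset.mem_of_mem_erase he.1, he.2⟩⟩
  set p := p'.mapLe hle with hpdef
  have hp : p.IsPath := hp'.mapLe hle
  have hfp : s(T.c 0, T.c 2) ∉ p.edges := by
    rw [hpdef, SimpleGraph.Walk.edges_mapLe_eq_edges]
    intro h
    obtain ⟨-, g, hg, hgl⟩ := p'.adj_of_mem_edges h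
    exact (Finset.mem_erase.1 hg).1 (T.no_parallel 0 _ _ _ hgl hl)
  have hd : ∃ e a b, OnDart T.graph B (T.c 2) (T.c 1) e a b ∧
      ∃ e ∈ B \ B₀, T.graph.IsLink e a b := by
    have hno : ¬ Conn T.graph ((B ∩ B₀).erase f) (T.c 2) (T.c 1) := by
      intro h
      rcases conn_two_cases hB₀ hl h with h | ⟨g, -, h⟩
      · exact T.c_ne (by decide) h
      · exact (h.vtype_eq_two hB₀).1 (.inl rfl)
    obtain ⟨e, a, b, hd, ha, hb⟩ := exists_onDart_switch
      (P := Conn T.graph ((B ∩ B₀).erase f) (T.c 2))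
      (hBF.subset (Finset.erase_subset f B)) hc (Conn.refl _) hno
    obtain ⟨hef, heB⟩ := Finset.mem_erase.1 hd.mem
    refine ⟨e, a, b, hd.mono (Finset.erase_subset f B), e, Finset.mem_sdiff.2 ⟨heB, fun he₀ => ?_⟩,
      hd.isLink⟩
    exact hb (ha.trans (conn_of_isLink
      (Finset.mem_erase.2 ⟨hef, Finset.mem_inter.2 ⟨heB, he₀⟩⟩) hd.isLink))
  obtain ⟨e, a, b, hd, hQ⟩ := hd
  obtain ⟨_, _, _, hd⟩ := exists_firstDart
    (P := fun a b => ∃ e ∈ B \ B₀, T.graph.IsLink e a b) hBF hd hQ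
  obtain ⟨d, hd, -, -⟩ := hd.exists_isFirstDart hBF hp
    (P := fun d => ∃ e ∈ B \ B₀, T.graph.IsLink e d.fst d.snd) (fun _ => Iff.rfl)
  -- Some vertex is doubly marked. It has type `2` and a mark of type `1` in its component, and
  -- these types determine first the component and then the vertex, which is `w`.
  have hdm : T.IsDoublyMarked B₀ B d.fst := ⟨⟨f, hf, hl⟩, p, hp, hfp, d, hd, rfl⟩
  obtain ⟨-, hu, hu2, hu1⟩ := hdm.spec hB₀ hB
  have huw : Conn T.graph (B \ B₀) d.fst w := HasType.conn hB₀ hBF (by decide) hu1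
    ⟨_, hu, Conn.refl _, hu2⟩ ⟨v, hv, hvw.symm, htv⟩ ⟨w, hw, Conn.refl _, htw⟩
  by_cases h : d.fst = w
  · exact h ▸ hdm
  · exact absurd (hu2.trans htw.symm) (hu.vtype_ne hB₀ hBF hw h huw)

end ExtraMark

end TriconedGraph

namespace TriconedGraph

/-! ### The weights of a spanning tree -/

section Weights

variable {α β : Type*} [LinearOrder α] [LinearOrder β] {T : TriconedGraph α β} {B₀ B : Finset β}
  {e f g : β} {u v w x y z a b : α} {r s t : ℕ} {mv mw mz : Multiset β}

lemma vtype_cases {i j k l : ℕ} (hi : i < 3) (hj : j < 3) (hk : k < 3) (hl : l < 3) (hij : i ≠ j)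
    (hjk : j ≠ k) (hki : k ≠ i) : l = i ∨ l = j ∨ l = k := by omega

lemma isForest_sdiff (hB : IsSpanningTree T.graph B) : IsForest T.graph (B \ B₀) :=
  IsForest.subset hB.acyclic Finset.sdiff_subset

lemma isForest_phi₁ (hB : IsSpanningTree T.graph B) : IsForest T.graph (T.phi₁ B₀ B).edges :=
  isForest_sdiff hB

lemma IsMarked.eq_of_vtype_eq (hB₀ : IsLexSmallestTree T.graph B₀) (hB : IsSpanningTree T.graph B)
    (hu : T.IsMarked B₀ B u) (hv : T.IsMarked B₀ B v) (huv : Conn T.graph (B \ B₀) u v)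
    (h : T.vtype B₀ u = T.vtype B₀ v) : u = v := by
  by_contra hne
  exact hu.vtype_ne hB₀ hB.acyclic hv hne huv h

/-- The marks of a component with three usual marks. -/
lemma isTriple_usual (hB₀ : IsLexSmallestTree T.graph B₀) (hB : IsSpanningTree T.graph B)
    (hv : T.IsMarked B₀ B v) (hw : T.IsMarked B₀ B w) (hz : T.IsMarked B₀ B z)
    (hvw : Conn T.graph (B \ B₀) v w) (hvz : Conn T.graph (B \ B₀) v z)
    (h₁ : T.vtype B₀ v ≠ T.vtype B₀ w) (h₂ : T.vtype B₀ w ≠ T.vtype B₀ z)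
    (h₃ : T.vtype B₀ z ≠ T.vtype B₀ v) :
    T.IsTriple (T.phi₁ B₀ B) (.usual v) (.usual w) (.usual z) := by
  have ht : ∀ y, T.vtype B₀ y = T.vtype B₀ v ∨ T.vtype B₀ y = T.vtype B₀ w ∨
      T.vtype B₀ y = T.vtype B₀ z :=
    fun y => vtype_cases (vtype_lt v) (vtype_lt w) (vtype_lt z) (vtype_lt y) h₁ h₂ h₃
  have hhas : ∀ y, T.HasType B₀ B v (T.vtype B₀ y) := fun y => by
    rcases ht y with h | h | h
    exacts [⟨v, hv, Conn.refl _, h.symm⟩, ⟨w, hw, hvw, h.symm⟩, ⟨z, hz, hvz, h.symm⟩]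
  refine ⟨fun h => ?_, fun h => ?_, fun h => ?_, ?_⟩
  · cases h
    exact h₁ rfl
  · cases h
    exact h₃ rfl
  · cases h
    exact h₂ rfl
  · ext m
    simp only [Set.mem_insert_iff, Set.mem_singleton_iff]
    constructor
    · rintro ⟨hm, hc⟩
      cases m with
      | usual y =>
        have hm : T.IsMarked B₀ B y := hm
        have hc : Conn T.graph (B \ B₀) v y := hc
        rcases ht y with h | h | h
        · exact .inl (congrArg _ (hm.eq_of_vtype_eq hB₀ hB hv hc.symm h))
        · exact .inr (.inl (congrArg _ (hm.eq_of_vtype_eq hB₀ hB hw (hc.symm.trans hvw) h)))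
        · exact .inr (.inr (congrArg _ (hm.eq_of_vtype_eq hB₀ hB hz (hc.symm.trans hvz) h)))
      | extra y =>
        -- An extra mark requires `02` in `B`, which is incompatible with marks of types `0` and `2`
        -- in one component.
        obtain ⟨⟨f, hf, hl⟩, -⟩ := IsDoublyMarked.spec hB₀ hB hm
        have h0 := hhas (T.c 0)
        rw [vtype_zero hB₀] at h0
        exact (HasType.false_of_mem hB₀ hB.acyclic (.inr rfl) hf hl h0 (hhas (T.c 2))).elim
    · rintro (rfl | rfl | rfl)
      exacts [⟨hv, Conn.refl _⟩, ⟨hw, hvw⟩, ⟨hz, hvz⟩]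

/-- The marks of a component with an extra mark. -/
lemma isTriple_extra (hB₀ : IsLexSmallestTree T.graph B₀) (hB : IsSpanningTree T.graph B)
    (hv : T.IsMarked B₀ B v) (hw : T.IsDoublyMarked B₀ B w) (hvw : Conn T.graph (B \ B₀) v w)
    (htv : T.vtype B₀ v = 1) :
    T.IsTriple (T.phi₁ B₀ B) (.usual v) (.usual w) (.extra w) := by
  obtain ⟨⟨f, hf, hl⟩, hw', htw, -⟩ := hw.spec hB₀ hB
  refine ⟨fun h => ?_, by simp, by simp, ?_⟩
  · cases h
    omega
  · ext m
    simp only [Set.mem_insert_iff, Set.mem_singleton_iff]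
    constructor
    · rintro ⟨hm, hc⟩
      cases m with
      | usual y =>
        have hm : T.IsMarked B₀ B y := hm
        have hc : Conn T.graph (B \ B₀) v y := hc
        have := vtype_lt (T := T) (B₀ := B₀) y
        obtain h | h | h : T.vtype B₀ y = 0 ∨ T.vtype B₀ y = 1 ∨ T.vtype B₀ y = 2 := by omega
        · refine (HasType.false_of_mem (x := v) hB₀ hB.acyclic (.inr rfl) hf hl ⟨y, hm, hc, h⟩
            ⟨w, hw', hvw, ?_⟩).elim
          rw [htw, vtype_two hB₀]
        · exact .inl (congrArg _ (hm.eq_of_vtype_eq hB₀ hB hv hc.symm (h.trans htv.symm)))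
        · exact .inr (.inl (congrArg _ (hm.eq_of_vtype_eq hB₀ hB hw' (hc.symm.trans hvw)
            (h.trans htw.symm))))
      | extra y =>
        have hc : Conn T.graph (B \ B₀) v y := hc
        obtain ⟨-, hy, hty, -⟩ := IsDoublyMarked.spec hB₀ hB hm
        exact .inr (.inr (congrArg _ (hy.eq_of_vtype_eq hB₀ hB hw' (hc.symm.trans hvw)
          (hty.trans htw.symm))))
    · rintro (rfl | rfl | rfl)
      exacts [⟨hv, Conn.refl _⟩, ⟨hw', hvw⟩, ⟨hw, hvw⟩]

lemma weighted_phi_of_tripod (hB₀ : IsLexSmallestTree T.graph B₀)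
    (hB : IsSpanningTree T.graph B) (hv : T.IsMarked B₀ B v) (hw : T.IsMarked B₀ B w)
    (hz : T.IsMarked B₀ B z)
    (h : IsTripodAt T.graph (T.vtype B₀) T.IsApex (B \ B₀) v w z mv mw mz) :
    Weighted T.graph (B \ B₀) (T.phi B₀ B) v (mv + mw + mz) :=
  weighted_phi₂_of_tripod (isForest_phi₁ hB) h
    (isTriple_usual hB₀ hB hv hw hz h.conn₁ h.conn₂ h.ne₁ h.ne₂ h.ne₃)

lemma weighted_phi_of_sandwich (hB₀ : IsLexSmallestTree T.graph B₀)
    (hB : IsSpanningTree T.graph B) (hv : T.IsMarked B₀ B v) (hw : T.IsMarked B₀ B w)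
    (hz : T.IsMarked B₀ B z) (hza : ¬ T.IsApex z) (htv : T.vtype B₀ z ≠ T.vtype B₀ v)
    (htw : T.vtype B₀ z ≠ T.vtype B₀ w)
    (h : IsSandwichAt T.graph (T.vtype B₀) T.IsApex (B \ B₀) v w z mv mw e a b) :
    Weighted T.graph (B \ B₀) (T.phi B₀ B) v (mv + mw + {e}) := by
  refine weighted_phi₂_of_sandwich (isForest_phi₁ hB) h
    (isTriple_usual hB₀ hB hv hw hz h.btw.1 h.btw.conn_left h.lt.ne htw.symm htv) rfl
    (fun x hx => ?_) (mayEmpower_usual_iff.2 hza)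
  cases hx
  exact ⟨fun h => htv (h ▸ rfl), fun h => htw (h ▸ rfl)⟩

lemma weighted_phi_of_extra (hB₀ : IsLexSmallestTree T.graph B₀)
    (hB : IsSpanningTree T.graph B) (hv : T.IsMarked B₀ B v) (hw : T.IsDoublyMarked B₀ B w)
    (htv : T.vtype B₀ v = 1)
    (h : IsSandwichAt T.graph (T.vtype B₀) T.IsApex (B \ B₀) v w w mv mw e a b) :
    Weighted T.graph (B \ B₀) (T.phi B₀ B) v (mv + mw + {e}) :=
  weighted_phi₂_of_sandwich (isForest_phi₁ hB) h (isTriple_extra hB₀ hB hv hw h.btw.1 htv) rfl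
    (fun _ hx => by cases hx) trivial

lemma weighted_phi_of_pair (hB : IsSpanningTree T.graph B)
    (hv : T.IsMarked B₀ B v) (hw : T.IsMarked B₀ B w)
    (h : IsPairAt T.graph (T.vtype B₀) T.IsApex (B \ B₀) v w mv mw r)
    (hm : ∀ u, T.IsMarked B₀ B u → Conn T.graph (B \ B₀) v u → u = v ∨ u = w)
    (hd : ∀ u, T.IsDoublyMarked B₀ B u → ¬ Conn T.graph (B \ B₀) v u) :
    Weighted T.graph (B \ B₀) (T.phi B₀ B) v (mv + mw) := by
  refine weighted_phi₂_of_two (isForest_phi₁ hB) (fun h' => h.ne (h' ▸ rfl)) ?_ h.left h.right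
  ext m
  simp only [Set.mem_insert_iff, Set.mem_singleton_iff]
  constructor
  · rintro ⟨hm', hc⟩
    cases m with
    | usual y => exact (hm y hm' hc).imp (congrArg _) (congrArg _)
    | extra y => exact absurd hc (hd y hm')
  · rintro (rfl | rfl)
    exacts [⟨hv, Conn.refl _⟩, ⟨hw, h.conn⟩]

lemma phi_of_one (hB : IsSpanningTree T.graph B) (hu : T.IsMarked B₀ B u)
    (hm : ∀ v, T.IsMarked B₀ B v → Conn T.graph (B \ B₀) u v → v = u)
    (hd : ∀ v, T.IsDoublyMarked B₀ B v → ¬ Conn T.graph (B \ B₀) u v)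
    (hx : IsRoot T.graph (B \ B₀) x) (hux : Conn T.graph (B \ B₀) u x) (he : e ∈ B \ B₀)
    (hi : InComp T.graph (B \ B₀) u e) [Decidable (∃ b, OnDart T.graph (B \ B₀) u x e u b)] :
    T.phi B₀ B e = 1 + if ∃ b, OnDart T.graph (B \ B₀) u x e u b then 1 else 0 := by
  let : Decidable (∃ b, OnDart T.graph (T.phi₁ B₀ B).edges u x e u b) :=
    ‹Decidable (∃ b, OnDart T.graph (B \ B₀) u x e u b)›
  refine phi₂_of_one (B₀ := B₀) (N := T.phi₁ B₀ B) (isForest_phi₁ hB) he hi ?_ hx hux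
  ext m
  simp only [Set.mem_singleton_iff]
  constructor
  · rintro ⟨hm', hc⟩
    cases m with
    | usual y => exact congrArg _ (hm y hm' hc)
    | extra y => exact absurd hc (hd y hm')
  · rintro rfl
    exact ⟨hu, Conn.refl _⟩

/-! ### The weights of a spanning tree are those of a configuration -/

omit [LinearOrder α] in
lemma exists_toEdge {G : Graph α β} {sp : α → Prop} {F : Finset β} (h : Conn G F v w)
    (hvw : v ≠ w) : ∃ m, ToEdge G sp F v w m := by
  by_cases hv : sp v
  · exact ⟨0, .inl ⟨hv, rfl⟩⟩
  · obtain ⟨e, b, hd⟩ := exists_first_onDart h hvw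
    exact ⟨{e}, .inr ⟨hv, e, b, hd, rfl⟩⟩

lemma exists_isSandwichAt {F : Finset β} (hF : IsForest T.graph F)
    (hlt : T.vtype B₀ v < T.vtype B₀ w) (hb : Btw T.graph F v w z)
    (hmid : (¬ T.IsApex z ∧ T.vtype B₀ z ≠ T.vtype B₀ v ∧ T.vtype B₀ z ≠ T.vtype B₀ w) ∨
      (z = w ∧ T.vtype B₀ v = 1 ∧ T.vtype B₀ w = 2))
    (hsp : ∀ x, T.IsApex x → Conn T.graph F v x → x = v ∨ x = w) :
    ∃ mv mw e a b, IsSandwichAt T.graph (T.vtype B₀) T.IsApex F v w z mv mw e a b := by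
  have hvw : v ≠ w := fun h => hlt.ne (h ▸ rfl)
  obtain ⟨mv, hmv⟩ := exists_toEdge (sp := T.IsApex) hb.1 hvw
  obtain ⟨mw, hmw⟩ := exists_toEdge (sp := T.IsApex) hb.symm.1 hvw.symm
  have hz : T.vtype B₀ z ≠ T.vtype B₀ v := by
    rcases hmid with ⟨-, h, -⟩ | ⟨rfl, -⟩
    exacts [h, hlt.ne']
  obtain ⟨e, a, b, hd, ha, hb'⟩ := exists_onDart_switch (P := fun y => T.vtype B₀ y ≠ T.vtype B₀ v)
    hF hb.conn_left.symm hz (not_not.2 rfl)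
  have hb' : T.vtype B₀ b = T.vtype B₀ v := not_not.1 hb'
  obtain ⟨f, c, d, h⟩ := exists_firstDart
    (P := fun a b => T.vtype B₀ b ≠ T.vtype B₀ w ∧ T.vtype B₀ a ≠ T.vtype B₀ v) hF hd
    ⟨hb' ▸ hlt.ne, ha⟩
  exact ⟨mv, mw, f, c, d, hlt, hb, hmid, hsp, hmv, hmw, h⟩

lemma IsMarked.eq_or_eq_or_eq (hB₀ : IsLexSmallestTree T.graph B₀)
    (hB : IsSpanningTree T.graph B)
    (hv : T.IsMarked B₀ B v) (hw : T.IsMarked B₀ B w) (hz : T.IsMarked B₀ B z)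
    (hvw : Conn T.graph (B \ B₀) v w) (hvz : Conn T.graph (B \ B₀) v z)
    (h₁ : T.vtype B₀ v ≠ T.vtype B₀ w) (h₂ : T.vtype B₀ w ≠ T.vtype B₀ z)
    (h₃ : T.vtype B₀ z ≠ T.vtype B₀ v) (hu : T.IsMarked B₀ B u)
    (hc : Conn T.graph (B \ B₀) v u) : u = v ∨ u = w ∨ u = z := by
  have h4 := vtype_lt (T := T) (B₀ := B₀)
  rcases vtype_cases (h4 v) (h4 w) (h4 z) (h4 u) h₁ h₂ h₃ with h | h | h
  exacts [.inl (hu.eq_of_vtype_eq hB₀ hB hv hc.symm h),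
    .inr (.inl (hu.eq_of_vtype_eq hB₀ hB hw (hc.symm.trans hvw) h)),
    .inr (.inr (hu.eq_of_vtype_eq hB₀ hB hz (hc.symm.trans hvz) h))]

/-- A component with three usual marks one of which is normal and lies between the others. -/
lemma threeMarks_of_btw (hB₀ : IsLexSmallestTree T.graph B₀) (hB : IsSpanningTree T.graph B)
    (hv : T.IsMarked B₀ B v) (hw : T.IsMarked B₀ B w) (hz : T.IsMarked B₀ B z)
    (hb : Btw T.graph (B \ B₀) v w z) (hza : ¬ T.IsApex z)
    (h₁ : T.vtype B₀ v ≠ T.vtype B₀ w) (h₂ : T.vtype B₀ w ≠ T.vtype B₀ z)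
    (h₃ : T.vtype B₀ z ≠ T.vtype B₀ v) :
    ThreeMarks T.graph (T.vtype B₀) T.IsApex (B \ B₀) (T.phi B₀ B) v := by
  have hsp : ∀ x, T.IsApex x → Conn T.graph (B \ B₀) v x → x = v ∨ x = w := by
    intro x hx hc
    rcases IsMarked.eq_or_eq_or_eq hB₀ hB hv hw hz hb.1 hb.conn_left h₁ h₂ h₃
      (.of_isApex hB₀ hx) hc with h | h | h
    exacts [.inl h, .inr h, absurd (h ▸ hx) hza]
  rcases h₁.lt_or_gt with hlt | hlt
  · obtain ⟨mv, mw, e, a, b, h⟩ := exists_isSandwichAt (isForest_sdiff hB) hlt hb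
      (.inl ⟨hza, h₃, h₂.symm⟩) hsp
    exact .inr ⟨v, w, z, mv, mw, e, a, b, Conn.refl _, h,
      weighted_phi_of_sandwich hB₀ hB hv hw hz hza h₃ h₂.symm h⟩
  · obtain ⟨mv, mw, e, a, b, h⟩ := exists_isSandwichAt (isForest_sdiff hB) hlt hb.symm
      (.inl ⟨hza, h₂.symm, h₃⟩) fun x hx hc => (hsp x hx (hb.1.trans hc)).symm
    exact .inr ⟨w, v, z, mv, mw, e, a, b, hb.1, h,
      weighted_phi_of_sandwich hB₀ hB hw hv hz hza h₂.symm h₃ h⟩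

omit [LinearOrder α] in
lemma ThreeMarks.of_conn {G : Graph α β} {τ : α → ℕ} {sp : α → Prop} {F : Finset β} {M : β →₀ ℕ}
    (h : ThreeMarks G τ sp F M u) (hx : Conn G F x u) : ThreeMarks G τ sp F M x := by
  rcases h with ⟨v, w, z, mv, mw, mz, hc, h⟩ | ⟨v, w, z, mv, mw, e, a, b, hc, h⟩
  exacts [.inl ⟨v, w, z, mv, mw, mz, hx.trans hc, h⟩, .inr ⟨v, w, z, mv, mw, e, a, b, hx.trans hc, h⟩]

/-- A normal mark between the two others gives a sandwich; if there is none, the marks form a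
tripod, possibly with a special vertex in between. -/
lemma threeMarks_of_isMarked (hB₀ : IsLexSmallestTree T.graph B₀)
    (hB : IsSpanningTree T.graph B)
    (hv : T.IsMarked B₀ B v) (hw : T.IsMarked B₀ B w) (hz : T.IsMarked B₀ B z)
    (hvw : Conn T.graph (B \ B₀) v w) (hvz : Conn T.graph (B \ B₀) v z)
    (h₁ : T.vtype B₀ v ≠ T.vtype B₀ w) (h₂ : T.vtype B₀ w ≠ T.vtype B₀ z)
    (h₃ : T.vtype B₀ z ≠ T.vtype B₀ v) :
    ThreeMarks T.graph (T.vtype B₀) T.IsApex (B \ B₀) (T.phi B₀ B) v := by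
  by_cases hz' : T.IsApex z ∨ ¬ Btw T.graph (B \ B₀) v w z
  swap
  · push Not at hz'
    exact threeMarks_of_btw hB₀ hB hv hw hz hz'.2 hz'.1 h₁ h₂ h₃
  by_cases hw' : T.IsApex w ∨ ¬ Btw T.graph (B \ B₀) z v w
  swap
  · push Not at hw'
    exact ThreeMarks.of_conn (threeMarks_of_btw hB₀ hB hz hv hw hw'.2 hw'.1 h₃ h₁ h₂) hvz
  by_cases hv' : T.IsApex v ∨ ¬ Btw T.graph (B \ B₀) w z v
  swap
  · push Not at hv'
    exact ThreeMarks.of_conn (threeMarks_of_btw hB₀ hB hw hz hv hv'.2 hv'.1 h₂ h₃ h₁) hvw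
  have hne : ∀ {x y}, T.vtype B₀ x ≠ T.vtype B₀ y → x ≠ y := fun h h' => h (h' ▸ rfl)
  obtain ⟨mv, hmv⟩ := exists_toEdge (sp := T.IsApex) hvw (hne h₁)
  obtain ⟨mw, hmw⟩ := exists_toEdge (sp := T.IsApex) (hvw.symm.trans hvz) (hne h₂)
  obtain ⟨mz, hmz⟩ := exists_toEdge (sp := T.IsApex) hvz.symm (hne h₃)
  have h : IsTripodAt T.graph (T.vtype B₀) T.IsApex (B \ B₀) v w z mv mw mz :=
    ⟨hvw, hvz, h₁, h₂, h₃, fun x hx hc => IsMarked.eq_or_eq_or_eq hB₀ hB hv hw hz hvw hvz h₁ h₂ h₃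
      (.of_isApex hB₀ hx) hc, hmv, hmw, hmz, hv', hw', hz'⟩
  exact .inl ⟨v, w, z, mv, mw, mz, Conn.refl _, h, weighted_phi_of_tripod hB₀ hB hv hw hz h⟩

lemma threeMarks_of_isDoublyMarked (hB₀ : IsLexSmallestTree T.graph B₀)
    (hB : IsSpanningTree T.graph B) (hw : T.IsDoublyMarked B₀ B w) :
    ThreeMarks T.graph (T.vtype B₀) T.IsApex (B \ B₀) (T.phi B₀ B) w := by
  obtain ⟨⟨f, hf, hl⟩, hw', htw, v, hv, hwv, htv⟩ := hw.spec hB₀ hB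
  have ht := isTriple_extra hB₀ hB hv hw hwv.symm htv
  obtain ⟨mv, mw, e, a, b, h⟩ := exists_isSandwichAt (B₀ := B₀) (z := w) (isForest_sdiff hB)
    (by omega) (btw_right hwv.symm) (.inr ⟨rfl, htv, htw⟩) fun x hx hc => by
      have : Mark.usual x ∈ T.componentMarks (T.phi₁ B₀ B) (.usual v) :=
        ⟨IsMarked.of_isApex hB₀ hx, hc⟩
      rw [ht.marks_eq] at this
      simpa using this
  exact .inr ⟨v, w, w, mv, mw, e, a, b, hwv, h, weighted_phi_of_extra hB₀ hB hv hw htv h⟩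

end Weights

end TriconedGraph

namespace TriconedGraph

/-! ### Spanning trees yield configurations -/

section IsConfig

variable {α β : Type*} [LinearOrder α] [LinearOrder β] {T : TriconedGraph α β} {B₀ B : Finset β}
  {e f g : β} {u v w x y z a b : α} {r s t : ℕ}

/-- A special vertex which is the only one of its component is the smallest vertex. -/
lemma IsApex.isRoot {F : Finset β} (hB₀ : IsLexSmallestTree T.graph B₀) (hF : ∀ e ∈ F, e ∉ B₀)
    (hu : T.IsApex u) (h : ∀ v, T.IsApex v → Conn T.graph F u v → v = u) : IsRoot T.graph F u := by
  intro y hy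
  have hV : u ∈ V(T.graph) := by
    rcases hu with rfl | rfl
    exacts [c_mem 1, c_mem 2]
  by_cases hya : T.IsApex y
  · exact (h y hya hy).ge
  · have hu2 : u ≤ T.c 2 := by
      rcases hu with rfl | rfl
      exacts [(T.special_lt (by decide)).le, le_rfl]
    refine hu2.trans (T.lt_normal y (hy.mem_vertexSet hV) fun i hi => ?_).le
    subst hi
    fin_cases i
    · have := conn_zero hB₀ hF hy
      rcases hu with rfl | rfl
      exacts [T.c_ne (by decide) this, T.c_ne (by decide) this]
    · exact hya (.inl rfl)
    · exact hya (.inr rfl)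

lemma InComp.mem_vertexSet {F : Finset β} (h : InComp T.graph F x e) : x ∈ V(T.graph) := by
  obtain ⟨a, b, hl, hc⟩ := h
  exact Conn.mem_vertexSet hc.symm hl.left_mem

lemma InComp.ne_zero {F : Finset β} (hB₀ : IsLexSmallestTree T.graph B₀) (hF : ∀ e ∈ F, e ∉ B₀)
    (he : e ∈ F) (h : InComp T.graph F x e) : x ≠ T.c 0 := by
  rintro rfl
  obtain ⟨a, b, hl, hc⟩ := h
  rw [conn_zero hB₀ hF hc.symm] at hl
  exact ne_zero_of_not_mem_tree hB₀ (hF e he) hl rfl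

/-- A single mark empowers at most one edge. A special vertex in the component carries the mark and
is also the smallest vertex, so in that case nothing is empowered. -/
lemma oneMark_phi (hB₀ : IsLexSmallestTree T.graph B₀) (hB : IsSpanningTree T.graph B)
    (hm : ∀ u v, T.IsMarked B₀ B u → T.IsMarked B₀ B v → Conn T.graph (B \ B₀) x u →
      Conn T.graph (B \ B₀) x v → u = v)
    (hd : ∀ v, T.IsDoublyMarked B₀ B v → ¬ Conn T.graph (B \ B₀) x v) :
    OneMark T.graph T.IsApex (B \ B₀) (T.phi B₀ B) x := by
  classical
  have hF : ∀ e ∈ B \ B₀, e ∉ B₀ := not_mem_of_mem_sdiff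
  have hsp : ∀ v w, T.IsApex v → T.IsApex w → Conn T.graph (B \ B₀) x v →
      Conn T.graph (B \ B₀) x w → v = w :=
    fun v w hv hw => hm v w (.of_isApex hB₀ hv) (.of_isApex hB₀ hw)
  by_cases hx : x ∈ V(T.graph) ∧ x ≠ T.c 0
  · obtain ⟨u, hu, hxu⟩ := exists_isMarked hB₀ hB hx.1 hx.2
    obtain ⟨y, -, hy, huy⟩ := exists_isRoot (S := B \ B₀) T.coe_verts
      (mem_verts.2 (hu.mem_vertexSet hB₀))
    have key : ∀ e ∈ B \ B₀, InComp T.graph (B \ B₀) x e → T.phi B₀ B e =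
        1 + if ∃ b, OnDart T.graph (B \ B₀) u y e u b then 1 else 0 := fun e he hi =>
      phi_of_one hB hu (fun v hv huv => hm v u hv hu (hxu.trans huv) hxu)
        (fun v hv huv => hd v hv (hxu.trans huv)) hy huy he (hi.trans hxu.symm)
    have key' : ∀ e ∈ B \ B₀, InComp T.graph (B \ B₀) x e → 2 ≤ T.phi B₀ B e →
        ∃ b, OnDart T.graph (B \ B₀) u y e u b := fun e he hi h => by
      rw [key e he hi] at h
      by_contra hno
      rw [if_neg hno] at h
      omega
    refine ⟨hsp, fun v e hv hxv he hi => ?_, fun e he hi => ?_, fun e he f hf hie hif h2e h2f => ?_⟩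
    · by_contra h2
      obtain ⟨b, hdart⟩ := key' e he hi (by omega)
      obtain rfl : v = u := hm v u (.of_isApex hB₀ hv) hu hxv hxu
      have hr : IsRoot T.graph (B \ B₀) v := IsApex.isRoot hB₀ hF hv fun w hw hvw =>
        hsp w v hw hv (hxv.trans hvw) hxv
      rw [← hr.eq hy huy] at hdart
      exact OnDart.not_self (isForest_sdiff hB) hdart
    · rw [key e he hi]
      split_ifs <;> omega
    · obtain ⟨b, hdart⟩ := key' e he hie h2e
      obtain ⟨c, hdart'⟩ := key' f hf hif h2f
      exact (hdart.first_unique (isForest_sdiff hB) hdart').1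
  -- Outside the vertex set, and at the vertex `0`, there are no edges of `B \ B₀`.
  · have hno : ∀ e ∈ B \ B₀, ¬ InComp T.graph (B \ B₀) x e := fun e he hi =>
      hx ⟨InComp.mem_vertexSet hi, InComp.ne_zero hB₀ hF he hi⟩
    exact ⟨hsp, fun v e _ _ he hi => absurd hi (hno e he), fun e he hi => absurd hi (hno e he),
      fun e he _ _ hi => absurd hi (hno e he)⟩

variable (T B₀ B) in
/-- The component of `x` has marks of all types but `r`. -/
def HasTypes (x : α) (r : ℕ) : Prop := ∀ s < 3, s ≠ r → T.HasType B₀ B x s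

lemma HasTypes.conn (hB₀ : IsLexSmallestTree T.graph B₀) (hB : IsForest T.graph B)
    (h : T.HasTypes B₀ B x r) (h' : T.HasTypes B₀ B y r) : Conn T.graph (B \ B₀) x y := by
  obtain ⟨s, t, hs, ht, hst, hsr, htr⟩ : ∃ s t, s < 3 ∧ t < 3 ∧ s ≠ t ∧ s ≠ r ∧ t ≠ r := by
    by_cases h0 : r = 0
    · exact ⟨1, 2, by omega⟩
    · by_cases h1 : r = 1
      · exact ⟨0, 2, by omega⟩
      · exact ⟨0, 1, by omega⟩
  exact HasType.conn hB₀ hB hst (h s hs hsr) (h t ht htr) (h' s hs hsr) (h' t ht htr)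

lemma HasTypes.false_of_three (hB₀ : IsLexSmallestTree T.graph B₀) (hB : IsForest T.graph B)
    (hr : r < 3) (hs : s < 3) (ht : t < 3) (hrs : r ≠ s) (hst : s ≠ t) (htr : t ≠ r)
    (hx : T.HasTypes B₀ B x r) (hy : T.HasTypes B₀ B y s) (hz : T.HasTypes B₀ B z t)
    (hxy : ¬ Conn T.graph (B \ B₀) x y) (hyz : ¬ Conn T.graph (B \ B₀) y z)
    (hxz : ¬ Conn T.graph (B \ B₀) x z) : False := by
  have key : ∀ {x y z}, T.HasTypes B₀ B x 2 → T.HasTypes B₀ B y 0 → T.HasTypes B₀ B z 1 →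
      ¬ Conn T.graph (B \ B₀) x z → False := fun hx hy hz => HasType.false_of_three hB₀ hB
    (hx 0 (by omega) (by omega)) (hx 1 (by omega) (by omega)) (hy 1 (by omega) (by omega))
    (hy 2 (by omega) (by omega)) (hz 0 (by omega) (by omega)) (hz 2 (by omega) (by omega))
  interval_cases r <;> interval_cases s <;> first | exact absurd rfl hrs | skip
  all_goals interval_cases t <;> first | exact absurd rfl hst | exact absurd rfl htr | skip
  · exact key hz hx hy fun h => hyz h.symm
  · exact key hy hx hz hyz
  · exact key hz hy hx fun h => hxz h.symm
  · exact key hy hz hx fun h => hxy h.symm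
  · exact key hx hy hz hxz
  · exact key hx hz hy hxy

lemma hasTypes_of_isMarked (hB₀ : IsLexSmallestTree T.graph B₀) (hB : IsForest T.graph B)
    (hu : T.IsMarked B₀ B u) (hv : T.IsMarked B₀ B v) (hxu : Conn T.graph (B \ B₀) x u)
    (hxv : Conn T.graph (B \ B₀) x v) (hne : u ≠ v) :
    ∃ r < 3, T.vtype B₀ u ≠ r ∧ T.vtype B₀ v ≠ r ∧ T.HasTypes B₀ B x r := by
  obtain ⟨r, hr, hur, hvr⟩ := exists_third (τ := T.vtype B₀) vtype_lt u v
  refine ⟨r, hr, hur, hvr, fun s hs hsr => ?_⟩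
  have huv := hu.vtype_ne hB₀ hB hv hne (hxu.symm.trans hxv)
  have h4 := vtype_lt (T := T) (B₀ := B₀)
  rcases vtype_cases (h4 u) (h4 v) hr hs huv hvr hur.symm with h | h | h
  exacts [⟨u, hu, hxu, h.symm⟩, ⟨v, hv, hxv, h.symm⟩, absurd h hsr]

/-- The weights of a spanning tree are those of a configuration. -/
lemma isConfig_phi (hB₀ : IsLexSmallestTree T.graph B₀) (hB : IsSpanningTree T.graph B) :
    IsConfig T.graph (T.vtype B₀) T.IsApex (B \ B₀) (T.phi B₀ B) := by
  have hBF : IsForest T.graph B := hB.acyclic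
  by_cases hdm : ∃ w, T.IsDoublyMarked B₀ B w
  · obtain ⟨w, hw⟩ := hdm
    -- The component of `w` joins `1` to `2`, and the edge `02` joins `0` to `2`. Any pair of types
    -- in another component would repeat a connection and close a cycle.
    refine .inl ⟨w, threeMarks_of_isDoublyMarked hB₀ hB hw, fun x hx => ?_⟩
    obtain ⟨⟨f, hf, hl⟩, hwm, hw2, hw1⟩ := hw.spec hB₀ hB
    have hw2' : T.HasType B₀ B w 2 := ⟨w, hwm, Conn.refl _, hw2⟩
    refine oneMark_phi hB₀ hB (fun u v hu hv hxu hxv => ?_) fun v hv hxv => ?_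
    · by_contra hne
      obtain ⟨r, hr, -, -, h⟩ := hasTypes_of_isMarked hB₀ hBF hu hv hxu hxv hne
      obtain rfl | rfl | rfl : r = 0 ∨ r = 1 ∨ r = 2 := by omega
      · exact hx (HasType.conn hB₀ hBF (by decide) hw1 hw2' (h 1 (by omega) (by omega))
          (h 2 (by omega) (by omega)))
      · refine HasType.false_of_mem hB₀ hBF (.inr rfl) hf hl (h 0 (by omega) (by omega)) ?_
        rw [vtype_two hB₀]
        exact h 2 (by omega) (by omega)
      · exact HasType.false_of_mem_two hB₀ hBF hf hl (h 0 (by omega) (by omega))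
          (h 1 (by omega) (by omega)) hw1 hw2'
    · obtain ⟨-, hvm, hv2, hv1⟩ := hv.spec hB₀ hB
      exact hx ((HasType.conn hB₀ hBF (by decide) hw1 hw2' hv1 ⟨v, hvm, Conn.refl _, hv2⟩).trans
        hxv.symm)
  push Not at hdm
  have hone : ∀ x, (∀ u v, T.IsMarked B₀ B u → T.IsMarked B₀ B v → Conn T.graph (B \ B₀) x u →
      Conn T.graph (B \ B₀) x v → u = v) → OneMark T.graph T.IsApex (B \ B₀) (T.phi B₀ B) x :=
    fun x hx => oneMark_phi hB₀ hB hx fun v hv => absurd hv (hdm v)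
  by_cases h3 : ∃ v w z, T.IsMarked B₀ B v ∧ T.IsMarked B₀ B w ∧ T.IsMarked B₀ B z ∧
      Conn T.graph (B \ B₀) v w ∧ Conn T.graph (B \ B₀) v z ∧ v ≠ w ∧ w ≠ z ∧ z ≠ v
  · obtain ⟨v, w, z, hv, hw, hz, hvw, hvz, h₁, h₂, h₃⟩ := h3
    have h₁' := hv.vtype_ne hB₀ hBF hw h₁ hvw
    have h₂' := hw.vtype_ne hB₀ hBF hz h₂ (hvw.symm.trans hvz)
    have h₃' := hz.vtype_ne hB₀ hBF hv h₃ hvz.symm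
    refine .inl ⟨v, threeMarks_of_isMarked hB₀ hB hv hw hz hvw hvz h₁' h₂' h₃', fun x hx => ?_⟩
    refine hone x fun u u' hu hu' hxu hxu' => ?_
    by_contra hne
    obtain ⟨r, hr, -, -, h⟩ := hasTypes_of_isMarked hB₀ hBF hu hu' hxu hxu' hne
    refine hx (HasTypes.conn hB₀ hBF (r := r) (fun s hs _ => ?_) h)
    have h4 := vtype_lt (T := T) (B₀ := B₀)
    rcases vtype_cases (h4 v) (h4 w) (h4 z) hs h₁' h₂' h₃' with h | h | h
    exacts [⟨v, hv, Conn.refl _, h.symm⟩, ⟨w, hw, hvw, h.symm⟩, ⟨z, hz, hvz, h.symm⟩]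
  have hcases : ∀ x, OneMark T.graph T.IsApex (B \ B₀) (T.phi B₀ B) x ∨ ∃ r < 3,
      TwoMarks T.graph (T.vtype B₀) T.IsApex (B \ B₀) (T.phi B₀ B) r x ∧
      T.HasTypes B₀ B x r := by
    intro x
    by_cases hx : ∀ u v, T.IsMarked B₀ B u → T.IsMarked B₀ B v → Conn T.graph (B \ B₀) x u →
        Conn T.graph (B \ B₀) x v → u = v
    · exact .inl (hone x hx)
    · push Not at hx
      obtain ⟨v, w, hv, hw, hxv, hxw, hne⟩ := hx
      obtain ⟨r, hr, hvr, hwr, h⟩ := hasTypes_of_isMarked hB₀ hBF hv hw hxv hxw hne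
      have hvw := hxv.symm.trans hxw
      have hmem : ∀ u, T.IsMarked B₀ B u → Conn T.graph (B \ B₀) v u → u = v ∨ u = w := by
        intro u hu hvu
        by_contra! hno
        exact h3 ⟨v, w, u, hv, hw, hu, hvw, hvu, hne, hno.2.symm, hno.1⟩
      obtain ⟨mv, hmv⟩ := exists_toEdge (sp := T.IsApex) hvw hne
      obtain ⟨mw, hmw⟩ := exists_toEdge (sp := T.IsApex) hvw.symm hne.symm
      have hp : IsPairAt T.graph (T.vtype B₀) T.IsApex (B \ B₀) v w mv mw r :=
        ⟨hvw, hv.vtype_ne hB₀ hBF hw hne hvw, hvr, hwr, hr,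
          fun u hu => hmem u (.of_isApex hB₀ hu), hmv, hmw⟩
      exact .inr ⟨r, hr, ⟨v, w, mv, mw, hxv, hp, weighted_phi_of_pair hB hv hw hp hmem
        fun u hu => absurd hu (hdm u)⟩, h⟩
  by_cases hall : ∀ x, OneMark T.graph T.IsApex (B \ B₀) (T.phi B₀ B) x
  · exact .inr ⟨T.c 1, T.c 1, 0, 1, by decide, .inl (hall _), .inl (Conn.refl _), fun x _ _ => hall x⟩
  push Not at hall
  obtain ⟨x, hx⟩ := hall
  obtain ⟨r, hr, hxr, hxT⟩ := (hcases x).resolve_left hx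
  by_cases hall : ∀ y, ¬ Conn T.graph (B \ B₀) x y → OneMark T.graph T.IsApex (B \ B₀) (T.phi B₀ B) y
  · exact .inr ⟨x, x, r, r + 1, by omega, .inr hxr, .inl (Conn.refl _), fun y hy _ => hall y hy⟩
  push Not at hall
  obtain ⟨y, hxy, hy⟩ := hall
  obtain ⟨s, hs, hys, hyT⟩ := (hcases y).resolve_left hy
  -- Different components with two marks have different missing types; three of them would join `0`,
  -- `1`, `2` in a triangle.
  have hrs : r ≠ s := by
    rintro rfl
    exact hxy (hxT.conn hB₀ hBF hyT)
  refine .inr ⟨x, y, r, s, hrs, .inr hxr, .inr (.inr hys), fun z hxz hyz => ?_⟩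
  by_contra hz
  obtain ⟨t, ht, -, hzT⟩ := (hcases z).resolve_left hz
  refine HasTypes.false_of_three hB₀ hBF hr hs ht hrs ?_ ?_ hxT hyT hzT hxy hyz hxz
  · rintro rfl
    exact hyz (hyT.conn hB₀ hBF hzT)
  · rintro rfl
    exact hxz (hxT.conn hB₀ hBF hzT)

end IsConfig

end TriconedGraph

namespace TriconedGraph

/-! ### Spanning trees with given marks -/

section Construction

variable {α β : Type*} [LinearOrder α] [LinearOrder β] {T : TriconedGraph α β} {B₀ F : Finset β}
  {M : β →₀ ℕ} {e f g : β} {u v w x y z a b : α} {r s t : ℕ}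

open Classical in
/-- The weights of a component with one mark determine a possible position of the mark. -/
lemma exists_mark_of_oneMark (hB₀ : IsLexSmallestTree T.graph B₀) (hF : IsForest T.graph F)
    (hF₀ : ∀ e ∈ F, e ∉ B₀) (hM : ∀ e ∈ F, 1 ≤ M e) (h : OneMark T.graph T.IsApex F M y)
    (hy : IsRoot T.graph F y) :
    ∃ u, Conn T.graph F y u ∧ (∀ v, T.IsApex v → Conn T.graph F y v → v = u) ∧
      ∀ e ∈ F, InComp T.graph F y e →
        M e = 1 + if ∃ b, OnDart T.graph F u y e u b then 1 else 0 := by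
  by_cases hs : Saturated T.graph T.IsApex F M y
  · obtain ⟨u, m, hu⟩ := h.exists_isMarkAt hM hs (Conn.refl y)
    refine ⟨u, hu.conn, hu.sp_eq, fun e he hi => ?_⟩
    rw [hu.weighted e he hi]
    rcases hu.toEdge with ⟨hua, rfl⟩ | ⟨-, f, b, hd, rfl⟩
    · have hr : IsRoot T.graph F u := IsApex.isRoot hB₀ hF₀ hua fun v hv huv =>
        hu.sp_eq v hv (hu.conn.trans huv)
      rw [hy.eq hr hu.conn, if_neg, Multiset.count_zero]
      rintro ⟨b, hd⟩
      exact OnDart.not_self hF hd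
    · rw [Multiset.count_singleton]
      congr 1
      refine if_congr ⟨?_, ?_⟩ rfl rfl
      · rintro rfl
        exact ⟨b, hd⟩
      · rintro ⟨c, hd'⟩
        exact (hd'.first_unique hF hd).1
  · have hs1 := fun x hx hc => hs (.inl ⟨x, hx, hc⟩)
    -- If all weights are one and there is no special vertex, the mark is put on the smallest
    -- vertex, where it empowers nothing.
    refine ⟨y, Conn.refl _, fun v hv hc => absurd hc (hs1 v hv), fun e he hi => ?_⟩
    rw [if_neg]
    · by_contra hne
      have := hM e he
      exact hs (.inr ⟨e, he, hi, by omega⟩)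
    · rintro ⟨b, hd⟩
      exact OnDart.not_self hF hd

open Classical in
/-- There is a spanning tree with given marks on the components of the vertices in `R`, with one
mark on each other component, and with the given edges among `01` and `02`. -/
lemma exists_isSpanningTree (hB₀ : IsLexSmallestTree T.graph B₀) (hF : IsForest T.graph F)
    (hFE : (F : Set β) ⊆ E(T.graph)) (hF₀ : ∀ e ∈ F, e ∉ B₀) (hM : ∀ e ∈ F, 1 ≤ M e)
    {R X : Finset α} {Q : Finset β} (hR : R ⊆ (roots T.graph T.verts F).erase (T.c 0))
    (hRM : ∀ x, (∀ r ∈ R, ¬ Conn T.graph F r x) → OneMark T.graph T.IsApex F M x)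
    (hX : ∀ x ∈ X, ∃ r ∈ R, Conn T.graph F r x) (hRX : ∀ r ∈ R, ∃ x ∈ X, Conn T.graph F r x)
    (hXa : ∀ x, T.IsApex x → ∀ r ∈ R, Conn T.graph F r x → x ∈ X)
    (hQ : ∀ f ∈ Q, T.IsConeLink f (T.c 0) (T.c 1) ∨ T.IsConeLink f (T.c 0) (T.c 2))
    (hcard : X.card + Q.card ≤ R.card + 2)
    (hreach : ∀ B : Finset β, F ⊆ B → Q ⊆ B →
      (∀ u ∈ X, Conn T.graph B (T.apex (T.vtype B₀ u)) u) →
      Conn T.graph B (T.c 0) (T.c 1) ∧ Conn T.graph B (T.c 0) (T.c 2)) :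
    ∃ B, IsSpanningTree T.graph B ∧ B \ B₀ = F ∧ Q ⊆ B ∧
      (∀ u, (∃ r ∈ R, Conn T.graph F r u) → (T.IsMarked B₀ B u ↔ u ∈ X)) ∧
      (∀ f, T.IsConeLink f (T.c 0) (T.c 2) → f ∈ B → f ∈ Q) ∧
      ∀ y ∈ T.verts, y ≠ T.c 0 → IsRoot T.graph F y → (∀ r ∈ R, ¬ Conn T.graph F r y) →
        ∃ u, T.IsMarked B₀ B u ∧ Conn T.graph F y u ∧
          (∀ v, T.IsMarked B₀ B v → Conn T.graph F y v → v = u) ∧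
          ∀ e ∈ F, InComp T.graph F y e →
            M e = 1 + if ∃ b, OnDart T.graph F u y e u b then 1 else 0 := by
  -- `ce u` will be the edge from `u` to its parent; its value at `0` and outside the graph is
  -- irrelevant.
  have hce : ∀ u, ∃ e, u ∈ V(T.graph) → u ≠ T.c 0 → ∃ v, T.IsConeLink e v u := by
    intro u
    by_cases hu : u ∈ V(T.graph) ∧ u ≠ T.c 0
    · obtain ⟨e, v, h⟩ := exists_isConeLink hu.1 hu.2
      exact ⟨e, fun _ _ => ⟨v, h⟩⟩
    · obtain ⟨e, -⟩ := T.adj_one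
      exact ⟨e, fun h h' => absurd ⟨h, h'⟩ hu⟩
  choose ce hce using hce
  -- `O` consists of the roots of the components, other than `{0}`, that need a single mark.
  set O : Finset α := ((roots T.graph T.verts F).erase (T.c 0)) \ R with hO
  have hOR : ∀ y, y ∈ O ↔ y ∈ T.verts ∧ y ≠ T.c 0 ∧ IsRoot T.graph F y ∧
      ∀ r ∈ R, ¬ Conn T.graph F r y := by
    intro y
    rw [hO, Finset.mem_sdiff, Finset.mem_erase, mem_roots]
    constructor
    · rintro ⟨⟨h0, hV, hr⟩, hyR⟩
      refine ⟨hV, h0, hr, fun r hrR hc => hyR ?_⟩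
      rwa [← (mem_roots.1 (Finset.mem_of_mem_erase (hR hrR))).2.eq hr hc]
    · rintro ⟨hV, h0, hr, h⟩
      exact ⟨⟨h0, hV, hr⟩, fun hyR => h y hyR (Conn.refl y)⟩
  have hσ : ∀ y, ∃ u, y ∈ O → Conn T.graph F y u ∧
      (∀ v, T.IsApex v → Conn T.graph F y v → v = u) ∧ ∀ e ∈ F, InComp T.graph F y e →
        M e = 1 + if ∃ b, OnDart T.graph F u y e u b then 1 else 0 := by
    intro y
    by_cases hy : y ∈ O
    · obtain ⟨-, -, hr, h⟩ := (hOR y).1 hy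
      obtain ⟨u, hu⟩ := exists_mark_of_oneMark hB₀ hF hF₀ hM (hRM y h) hr
      exact ⟨u, fun _ => hu⟩
    · exact ⟨y, fun h => absurd h hy⟩
  choose σ hσ using hσ
  set S : Finset α := O.image σ ∪ X with hS
  have hmemS : ∀ u, u ∈ S ↔ (∃ y ∈ O, σ y = u) ∨ u ∈ X := fun u => by
    rw [hS, Finset.mem_union, Finset.mem_image]
  have hne0 : ∀ {x y}, Conn T.graph F x y → x ≠ T.c 0 → y ≠ T.c 0 := fun h hx hy =>
    hx (conn_zero hB₀ hF₀ (hy ▸ h))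
  have hRV : ∀ r ∈ R, r ∈ V(T.graph) ∧ r ≠ T.c 0 ∧ IsRoot T.graph F r := fun r hr => by
    have := Finset.mem_erase.1 (hR hr)
    exact ⟨mem_verts.1 (mem_roots.1 this.2).1, this.1, (mem_roots.1 this.2).2⟩
  have hSV : ∀ u ∈ S, u ∈ V(T.graph) ∧ u ≠ T.c 0 := by
    intro u hu
    rcases (hmemS u).1 hu with ⟨y, hy, rfl⟩ | hu
    · obtain ⟨hyV, hy0, -⟩ := (hOR y).1 hy
      exact ⟨(hσ y hy).1.mem_vertexSet (mem_verts.1 hyV), hne0 (hσ y hy).1 hy0⟩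
    · obtain ⟨r, hr, hc⟩ := hX u hu
      exact ⟨hc.mem_vertexSet (hRV r hr).1, hne0 hc (hRV r hr).2.1⟩
  have hroot : ∀ x ∈ V(T.graph), x ≠ T.c 0 → (∃ r ∈ R, Conn T.graph F r x) ∨
      ∃ y ∈ O, Conn T.graph F y x := by
    intro x hx hx0
    obtain ⟨y, hyV, hy, hxy⟩ := exists_isRoot (S := F) T.coe_verts (mem_verts.2 hx)
    by_cases h : ∃ r ∈ R, Conn T.graph F r x
    · exact .inl h
    · push Not at h
      exact .inr ⟨y, (hOR y).2 ⟨hyV, hne0 hxy hx0, hy, fun r hr hc => h r hr (hc.trans hxy.symm)⟩,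
        hxy.symm⟩
  have hSa : ∀ x, T.IsApex x → x ∈ S := by
    intro x hx
    obtain ⟨hxV, hx0⟩ : x ∈ V(T.graph) ∧ x ≠ T.c 0 := by
      rcases hx with rfl | rfl
      exacts [⟨c_mem 1, T.c_ne (by decide)⟩, ⟨c_mem 2, T.c_ne (by decide)⟩]
    rcases hroot x hxV hx0 with ⟨r, hr, hc⟩ | ⟨y, hy, hc⟩
    · exact (hmemS x).2 (.inr (hXa x hx r hr hc))
    · exact (hmemS x).2 (.inl ⟨y, hy, ((hσ y hy).2.1 x hx hc).symm⟩)
  -- The tree consists of `F`, the parent edges of the normal marks, and the prescribed edges among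
  -- `01` and `02`.
  set B : Finset β := F ∪ ((S \ {T.c 1, T.c 2}).image ce ∪ Q) with hBdef
  have hapex : ∀ u, u ∉ ({T.c 1, T.c 2} : Finset α) ↔ ¬ T.IsApex u := by simp [IsApex]
  have hmemB : ∀ e, e ∈ B ↔ e ∈ F ∨ (∃ u ∈ S, ¬ T.IsApex u ∧ ce u = e) ∨ e ∈ Q := fun e => by
    rw [hBdef, Finset.mem_union, Finset.mem_union, Finset.mem_image]
    simp only [Finset.mem_sdiff, hapex, and_assoc]
  have hce' : ∀ u ∈ S, ∃ v, T.IsConeLink (ce u) v u := fun u hu => hce u (hSV u hu).1 (hSV u hu).2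
  have hQT : ∀ f ∈ Q, ∃ x, T.IsApex x ∧ T.IsConeLink f (T.c 0) x := fun f hf => by
    rcases hQ f hf with h | h
    exacts [⟨_, .inl rfl, h⟩, ⟨_, .inr rfl, h⟩]
  have hFB : F ⊆ B := Finset.subset_union_left
  have hSconn : ∀ u ∈ S, Conn T.graph B (T.apex (T.vtype B₀ u)) u := by
    intro u hu
    by_cases hua : T.IsApex u
    · rw [apex_vtype hB₀ hua]
    · obtain ⟨v, hv⟩ := hce' u hu
      have := hv.eq_apex hB₀ hua
      subst this
      exact conn_of_isLink ((hmemB _).2 (.inr (.inl ⟨u, hu, hua, rfl⟩))) hv.1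
  -- Once `1` and `2` are joined to `0`, each mark is joined to `0` through the special vertex of
  -- its type, and so is each component.
  obtain ⟨h1, h2⟩ := hreach B hFB (fun f hf => (hmemB f).2 (.inr (.inr hf)))
    fun u hu => hSconn u ((hmemS u).2 (.inr hu))
  have hapexconn : ∀ r, Conn T.graph B (T.c 0) (T.apex r) := by
    intro r
    unfold apex
    split_ifs
    exacts [h1, h2, Conn.refl _]
  have hconn : ∀ x ∈ V(T.graph), Conn T.graph B (T.c 0) x := by
    intro x hx
    by_cases hx0 : x = T.c 0
    · rw [hx0]
    · obtain ⟨u, hu, hc⟩ : ∃ u ∈ S, Conn T.graph F x u := by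
        rcases hroot x hx hx0 with ⟨r, hr, hc⟩ | ⟨y, hy, hc⟩
        · obtain ⟨u, hu, hc'⟩ := hRX r hr
          exact ⟨u, (hmemS u).2 (.inr hu), hc.symm.trans hc'⟩
        · exact ⟨σ y, (hmemS _).2 (.inl ⟨y, hy, rfl⟩), hc.symm.trans (hσ y hy).1⟩
      exact ((hapexconn _).trans (hSconn u hu)).trans (Conn.mono hc.symm hFB)
  -- There are at most |O| + |X| marks, and those on `1` and `2` contribute no edge. So `B` has at
  -- most |F| + |O| + |X| - 2 + |Q| ≤ |F| + |O| + |R| edges. As |O| + |R| is the number of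
  -- components other than `{0}`, this bound equals |V| - 1.
  have hcardB : B.card < T.verts.card := by
    have c1 : (roots T.graph T.verts F).card + F.card = T.verts.card :=
      IsForest.card_roots T.coe_verts hF hFE
    have h0 : T.c 0 ∈ roots T.graph T.verts F := mem_roots.2 ⟨mem_verts.2 (c_mem 0), fun y hy =>
      (conn_zero hB₀ hF₀ hy.symm).ge⟩
    have c2 := Finset.card_erase_of_mem h0
    have c3 := Finset.card_pos.2 ⟨_, h0⟩
    have c4 : O.card = _ - R.card := Finset.card_sdiff_of_subset hR
    have c5 := Finset.card_le_card hR
    have c6 : S.card ≤ O.card + X.card :=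
      (Finset.card_union_le _ _).trans (Nat.add_le_add_right Finset.card_image_le _)
    have hsub : {T.c 1, T.c 2} ⊆ S := by
      intro x hx
      rw [Finset.mem_insert, Finset.mem_singleton] at hx
      exact hSa x hx
    have c7 : (S \ {T.c 1, T.c 2}).card = S.card - 2 := by
      rw [Finset.card_sdiff_of_subset hsub, Finset.card_pair (T.c_ne (by decide))]
    have c8 := Finset.card_le_card hsub
    rw [Finset.card_pair (T.c_ne (by decide))] at c8
    have c9 : B.card ≤ F.card + ((S \ {T.c 1, T.c 2}).card + Q.card) :=
      (Finset.card_union_le _ _).trans (Nat.add_le_add_left ((Finset.card_union_le _ _).trans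
        (Nat.add_le_add_right Finset.card_image_le _)) _)
    omega
  have hBE : (B : Set β) ⊆ E(T.graph) := by
    intro e he
    rcases (hmemB e).1 (Finset.mem_coe.1 he) with he | ⟨u, hu, -, rfl⟩ | he
    · exact hFE (Finset.mem_coe.2 he)
    · obtain ⟨v, hv⟩ := hce' u hu
      exact hv.1.edge_mem
    · obtain ⟨x, -, hx⟩ := hQT e he
      exact hx.1.edge_mem
  have hcone : ∀ e ∈ B, e ∉ F → e ∈ B₀ := by
    intro e he heF
    rcases ((hmemB e).1 he).resolve_left heF with ⟨u, hu, -, rfl⟩ | he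
    · obtain ⟨v, hv⟩ := hce' u hu
      exact hv.mem_tree hB₀
    · obtain ⟨x, -, hx⟩ := hQT e he
      exact hx.mem_tree hB₀
  have hmark : ∀ u, T.IsMarked B₀ B u ↔ u ∈ S := by
    intro u
    rw [isMarked_iff hB₀]
    constructor
    · rintro (hu | ⟨hua, e, he, v, h⟩)
      · exact hSa u hu
      · rcases (hmemB e).1 he with he | ⟨u', hu', -, rfl⟩ | he
        · exact absurd (h.mem_tree hB₀) (hF₀ e he)
        · obtain ⟨v', hv'⟩ := hce' u' hu'
          exact (h.eq_of_isLink hv').2 ▸ hu'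
        · obtain ⟨x, hx, hl⟩ := hQT e he
          exact absurd ((h.eq_of_isLink hl).2 ▸ hx) hua
    · intro hu
      by_cases hua : T.IsApex u
      · exact .inl hua
      · obtain ⟨v, hv⟩ := hce' u hu
        exact .inr ⟨hua, ce u, (hmemB _).2 (.inr (.inl ⟨u, hu, hua, rfl⟩)), v, hv⟩
  have hOx : ∀ y ∈ O, ∀ z ∈ O, Conn T.graph F y (σ z) → y = z := fun y hy z hz h =>
    ((hOR y).1 hy).2.2.1.eq ((hOR z).1 hz).2.2.1 (h.trans (hσ z hz).1.symm)
  refine ⟨B, ⟨hBE, fun x hx y hy => (hconn x hx).symm.trans (hconn y hy),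
    isForest_of_card T.coe_verts (fun x hx y hy => (hconn x (mem_verts.1 hx)).symm.trans
      (hconn y (mem_verts.1 hy))) hcardB⟩, ?_, fun f hf => (hmemB f).2 (.inr (.inr hf)), ?_, ?_, ?_⟩
  · ext e
    rw [Finset.mem_sdiff]
    refine ⟨fun ⟨he, he₀⟩ => ?_, fun he => ⟨hFB he, hF₀ e he⟩⟩
    by_contra heF
    exact he₀ (hcone e he heF)
  · rintro u ⟨r, hr, hc⟩
    rw [hmark, hmemS]
    refine ⟨fun h => h.resolve_left ?_, .inr⟩
    rintro ⟨y, hy, rfl⟩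
    exact ((hOR y).1 hy).2.2.2 r hr (hc.trans (hσ y hy).1.symm)
  · intro f hl hf
    rcases (hmemB f).1 hf with hf | ⟨u, hu, hua, rfl⟩ | hf
    · exact absurd (hl.mem_tree hB₀) (hF₀ f hf)
    · obtain ⟨v, hv⟩ := hce' u hu
      exact absurd (.inr (hl.eq_of_isLink hv).2.symm) hua
    · exact hf
  · intro y hyV hy0 hy hyR
    have hyO : y ∈ O := (hOR y).2 ⟨hyV, hy0, hy, hyR⟩
    refine ⟨σ y, (hmark _).2 ((hmemS _).2 (.inl ⟨y, hyO, rfl⟩)), (hσ y hyO).1, fun v hv hc => ?_,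
      (hσ y hyO).2.2⟩
    rcases (hmemS v).1 ((hmark v).1 hv) with ⟨z, hz, rfl⟩ | hvX
    · rw [hOx y hyO z hz hc]
    · obtain ⟨r, hr, hc'⟩ := hX v hvX
      exact absurd (hc'.trans hc.symm) (hyR r hr)

end Construction

end TriconedGraph

namespace TriconedGraph

/-! ### Realising configurations by spanning trees -/

section Realization

variable {α β : Type*} [LinearOrder α] [LinearOrder β] {T : TriconedGraph α β} {B₀ B F : Finset β}
  {M : β →₀ ℕ} {e f g : β} {u v w x y z a b : α} {r s t : ℕ} {mv mw mz : Multiset β}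

/-- On the components of `R` the weights are compared by `hW`; on the others the constructed mark
reproduces them. No extra mark can interfere there: a doubly marked vertex has type `2` and shares
its component with a mark of type `1`, whereas these components have only one marked vertex. -/
lemma exists_phi_eq (hB₀ : IsLexSmallestTree T.graph B₀) (hF : IsForest T.graph F)
    (hFE : (F : Set β) ⊆ E(T.graph)) (hF₀ : ∀ e ∈ F, e ∉ B₀) (hM : ∀ e ∈ F, 1 ≤ M e)
    (hM₀ : ∀ e ∉ F, M e = 0)
    {R X : Finset α} {Q : Finset β} (hR : R ⊆ (roots T.graph T.verts F).erase (T.c 0))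
    (hRM : ∀ x, (∀ r ∈ R, ¬ Conn T.graph F r x) → OneMark T.graph T.IsApex F M x)
    (hX : ∀ x ∈ X, ∃ r ∈ R, Conn T.graph F r x) (hRX : ∀ r ∈ R, ∃ x ∈ X, Conn T.graph F r x)
    (hXa : ∀ x, T.IsApex x → ∀ r ∈ R, Conn T.graph F r x → x ∈ X)
    (hQ : ∀ f ∈ Q, T.IsConeLink f (T.c 0) (T.c 1) ∨ T.IsConeLink f (T.c 0) (T.c 2))
    (hcard : X.card + Q.card ≤ R.card + 2)
    (hreach : ∀ B : Finset β, F ⊆ B → Q ⊆ B →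
      (∀ u ∈ X, Conn T.graph B (T.apex (T.vtype B₀ u)) u) →
      Conn T.graph B (T.c 0) (T.c 1) ∧ Conn T.graph B (T.c 0) (T.c 2))
    (hW : ∀ B, IsSpanningTree T.graph B → B \ B₀ = F → Q ⊆ B →
      (∀ u, (∃ r ∈ R, Conn T.graph F r u) → (T.IsMarked B₀ B u ↔ u ∈ X)) →
      (∀ f, T.IsConeLink f (T.c 0) (T.c 2) → f ∈ B → f ∈ Q) →
      ∀ r ∈ R, ∃ m, Weighted T.graph F M r m ∧ Weighted T.graph F (T.phi B₀ B) r m) :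
    ∃ B, IsSpanningTree T.graph B ∧ T.phi B₀ B = M := by
  classical
  obtain ⟨B, hB, rfl, hQB, hBX, hBQ, hBO⟩ :=
    exists_isSpanningTree hB₀ hF hFE hF₀ hM hR hRM hX hRX hXa hQ hcard hreach
  refine ⟨B, hB, ?_⟩
  ext e
  by_cases he : e ∈ B \ B₀
  swap
  · rw [hM₀ e he]
    exact phi₂_apply_of_not_mem he
  obtain ⟨a, b, hl⟩ := T.graph.exists_isLink_of_mem_edgeSet (hFE (Finset.mem_coe.2 he))
  have hia : InComp T.graph (B \ B₀) a e := ⟨a, b, hl, Conn.refl a⟩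
  by_cases ha : ∃ r ∈ R, Conn T.graph (B \ B₀) r a
  · obtain ⟨r, hr, hc⟩ := ha
    obtain ⟨m, h1, h2⟩ := hW B hB rfl hQB hBX hBQ r hr
    rw [h1 e he (hia.trans hc), h2 e he (hia.trans hc)]
  · push Not at ha
    obtain ⟨y, hyV, hy, hay⟩ := exists_isRoot (S := B \ B₀) T.coe_verts (mem_verts.2 hl.left_mem)
    have hiy : InComp T.graph (B \ B₀) y e := hia.trans hay.symm
    obtain ⟨u, hu, hyu, huniq, hMu⟩ := hBO y hyV (InComp.ne_zero hB₀ hF₀ he hiy) hy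
      fun r hr hc => ha r hr (hc.trans hay.symm)
    rw [hMu e he hiy]
    refine phi_of_one hB hu (fun v hv hc => huniq v hv (hyu.trans hc)) (fun v hv hc => ?_) hy
      hyu.symm he (hiy.trans hyu.symm)
    obtain ⟨-, hvm, hv2, w, hwm, hvw, hw1⟩ := hv.spec hB₀ hB
    have h1 := huniq v hvm (hyu.trans hc)
    have h2 := huniq w hwm ((hyu.trans hc).trans hvw)
    rw [h1] at hv2
    rw [h2] at hw1
    omega

/-- The case of one exceptional component. -/
lemma exists_phi_eq_of_component (hB₀ : IsLexSmallestTree T.graph B₀) (hF : IsForest T.graph F)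
    (hFE : (F : Set β) ⊆ E(T.graph)) (hF₀ : ∀ e ∈ F, e ∉ B₀) (hM : ∀ e ∈ F, 1 ≤ M e)
    (hM₀ : ∀ e ∉ F, M e = 0) {X : Finset α} {Q : Finset β} (he : e ∈ F)
    (hve : InComp T.graph F v e)
    (hRM : ∀ x, ¬ Conn T.graph F v x → OneMark T.graph T.IsApex F M x)
    (hX : ∀ x ∈ X, Conn T.graph F v x) (hXne : X.Nonempty)
    (hXa : ∀ x, T.IsApex x → Conn T.graph F v x → x ∈ X)
    (hQ : ∀ f ∈ Q, T.IsConeLink f (T.c 0) (T.c 1) ∨ T.IsConeLink f (T.c 0) (T.c 2))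
    (hcard : X.card + Q.card ≤ 3)
    (hreach : ∀ B : Finset β, F ⊆ B → Q ⊆ B →
      (∀ u ∈ X, Conn T.graph B (T.apex (T.vtype B₀ u)) u) →
      Conn T.graph B (T.c 0) (T.c 1) ∧ Conn T.graph B (T.c 0) (T.c 2))
    (hW : ∀ B, IsSpanningTree T.graph B → B \ B₀ = F → Q ⊆ B →
      (∀ u, Conn T.graph F v u → (T.IsMarked B₀ B u ↔ u ∈ X)) →
      (∀ f, T.IsConeLink f (T.c 0) (T.c 2) → f ∈ B → f ∈ Q) →
      ∃ m, Weighted T.graph F M v m ∧ Weighted T.graph F (T.phi B₀ B) v m) :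
    ∃ B, IsSpanningTree T.graph B ∧ T.phi B₀ B = M := by
  obtain ⟨y, hyV, hy, hvy⟩ := exists_isRoot (S := F) T.coe_verts
    (mem_verts.2 (InComp.mem_vertexSet hve))
  have hy0 : y ≠ T.c 0 := InComp.ne_zero hB₀ hF₀ he (hve.trans hvy.symm)
  have hex : ∀ {u}, (∃ r ∈ ({y} : Finset α), Conn T.graph F r u) ↔ Conn T.graph F v u := by
    intro u
    simp only [Finset.mem_singleton, exists_eq_left]
    exact ⟨fun h => hvy.trans h, fun h => hvy.symm.trans h⟩
  refine exists_phi_eq hB₀ hF hFE hF₀ hM hM₀ (R := {y}) (X := X) (Q := Q) ?_ (fun x hx => ?_)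
    (fun x hx => hex.2 (hX x hx)) (fun r hr => ?_) (fun x hx r hr hc => ?_) hQ ?_ hreach
    fun B hB hBF hQB hBX hBQ r hr => ?_
  · rw [Finset.singleton_subset_iff, Finset.mem_erase, mem_roots]
    exact ⟨hy0, hyV, hy⟩
  · exact hRM x fun h => hx y (Finset.mem_singleton_self y) (hvy.symm.trans h)
  · obtain ⟨x, hx⟩ := hXne
    rw [Finset.mem_singleton.1 hr]
    exact ⟨x, hx, hvy.symm.trans (hX x hx)⟩
  · rw [Finset.mem_singleton.1 hr] at hc
    exact hXa x hx (hvy.trans hc)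
  · rw [Finset.card_singleton]
    exact hcard
  · obtain ⟨m, h1, h2⟩ := hW B hB hBF hQB (fun u hu => hBX u (hex.2 hu)) hBQ
    rw [Finset.mem_singleton.1 hr]
    exact ⟨m, h1.of_conn hvy, h2.of_conn hvy⟩

lemma conn_apex_of_mem (hFB : F ⊆ B) {X : Finset α}
    (h : ∀ u ∈ X, Conn T.graph B (T.apex (T.vtype B₀ u)) u) (hu : u ∈ X) (hv : v ∈ X)
    (huv : Conn T.graph F u v) :
    Conn T.graph B (T.apex (T.vtype B₀ u)) (T.apex (T.vtype B₀ v)) :=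
  ((h u hu).trans (huv.mono hFB)).trans (h v hv).symm

/-- A pair of marks joins the special vertices of two types. -/
lemma conn_apex_of_pair (h : IsPairAt T.graph (T.vtype B₀) T.IsApex F v w mv mw r)
    (hc : Conn T.graph B (T.apex (T.vtype B₀ v)) (T.apex (T.vtype B₀ w)))
    (hs : s < 3) (ht : t < 3) (hsr : s ≠ r) (htr : t ≠ r) :
    Conn T.graph B (T.apex s) (T.apex t) := by
  have h4 := vtype_lt (T := T) (B₀ := B₀)
  have h1 := vtype_cases (h4 v) (h4 w) h.lt hs h.ne h.ne_right h.ne_left.symm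
  have h2 := vtype_cases (h4 v) (h4 w) h.lt ht h.ne h.ne_right h.ne_left.symm
  rcases h1 with rfl | rfl | rfl
  · rcases h2 with rfl | rfl | rfl
    exacts [Conn.refl _, hc, absurd rfl htr]
  · rcases h2 with rfl | rfl | rfl
    exacts [hc.symm, Conn.refl _, absurd rfl htr]
  · exact absurd rfl hsr

lemma IsPairAt.exists_mem (h : IsPairAt T.graph (T.vtype B₀) T.IsApex F v w mv mw r) :
    ∃ e ∈ F, InComp T.graph F v e := by
  obtain ⟨e, he, z, -, hl⟩ := Conn.eq_or_exists_isLink h.conn fun h' => h.ne (h' ▸ rfl)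
  exact ⟨e, he, v, z, hl, Conn.refl v⟩

/-- A double mark needs the edge `02` and has type `2`; but if `02` is present, `2` is the type
missing from the pair. -/
lemma IsPairAt.not_isDoublyMarked (hB₀ : IsLexSmallestTree T.graph B₀)
    (hB : IsSpanningTree T.graph B)
    (h : IsPairAt T.graph (T.vtype B₀) T.IsApex (B \ B₀) v w mv mw r)
    (hm : ∀ u, T.IsMarked B₀ B u → Conn T.graph (B \ B₀) v u → u = v ∨ u = w)
    (hr : (∃ f ∈ B, T.IsConeLink f (T.c 0) (T.c 2)) → r = 2) (hu : T.IsDoublyMarked B₀ B u) :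
    ¬ Conn T.graph (B \ B₀) v u := by
  intro hc
  obtain ⟨hf, hum, hu2, -⟩ := hu.spec hB₀ hB
  have hr := hr hf
  rcases hm u hum hc with rfl | rfl
  · exact h.ne_left (hu2.trans hr.symm)
  · exact h.ne_right (hu2.trans hr.symm)

variable (T) in
lemma exists_isConeLink_one_two : ∃ e₁ e₂, T.IsConeLink e₁ (T.c 0) (T.c 1) ∧
    T.IsConeLink e₂ (T.c 0) (T.c 2) := by
  obtain ⟨e₁, h₁⟩ := T.adj_one
  obtain ⟨e₂, h₂⟩ := T.adj_two
  exact ⟨e₁, e₂, ⟨h₁, .inl rfl⟩, ⟨h₂, .inl rfl⟩⟩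

/-- The case of a component with three usual marks. -/
lemma exists_phi_eq_of_triple (hB₀ : IsLexSmallestTree T.graph B₀) (hF : IsForest T.graph F)
    (hFE : (F : Set β) ⊆ E(T.graph)) (hF₀ : ∀ e ∈ F, e ∉ B₀) (hM : ∀ e ∈ F, 1 ≤ M e)
    (hM₀ : ∀ e ∉ F, M e = 0) (hRM : ∀ x, ¬ Conn T.graph F v x → OneMark T.graph T.IsApex F M x)
    (hvw : Conn T.graph F v w) (hvz : Conn T.graph F v z) (h₁ : T.vtype B₀ v ≠ T.vtype B₀ w)
    (h₂ : T.vtype B₀ w ≠ T.vtype B₀ z) (h₃ : T.vtype B₀ z ≠ T.vtype B₀ v)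
    (hXa : ∀ x, T.IsApex x → Conn T.graph F v x → x = v ∨ x = w ∨ x = z)
    (hW : ∀ B, IsSpanningTree T.graph B → B \ B₀ = F → T.IsMarked B₀ B v → T.IsMarked B₀ B w →
      T.IsMarked B₀ B z → ∃ m, Weighted T.graph F M v m ∧ Weighted T.graph F (T.phi B₀ B) v m) :
    ∃ B, IsSpanningTree T.graph B ∧ T.phi B₀ B = M := by
  obtain ⟨e, he, y, -, hl⟩ := Conn.eq_or_exists_isLink hvw fun h' => h₁ (h' ▸ rfl)
  refine exists_phi_eq_of_component hB₀ hF hFE hF₀ hM hM₀ (X := {v, w, z}) (Q := ∅) he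
    ⟨v, y, hl, Conn.refl v⟩ hRM ?_ (Finset.insert_nonempty _ _) ?_ (by simp) ?_ ?_ ?_
  · intro x hx
    rw [Finset.mem_insert, Finset.mem_insert, Finset.mem_singleton] at hx
    rcases hx with rfl | rfl | rfl
    exacts [Conn.refl _, hvw, hvz]
  · intro x hx hc
    simpa using hXa x hx hc
  · simpa using Finset.card_le_three
  · intro B hFB _ hXB
    have hv : v ∈ ({v, w, z} : Finset α) := by simp
    have hw : w ∈ ({v, w, z} : Finset α) := by simp
    have hz : z ∈ ({v, w, z} : Finset α) := by simp
    have hvw' := conn_apex_of_mem hFB hXB hv hw hvw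
    have hvz' := conn_apex_of_mem hFB hXB hv hz hvz
    have hall : ∀ s < 3, Conn T.graph B (T.apex (T.vtype B₀ v)) (T.apex s) := by
      intro s hs
      have h4 := vtype_lt (T := T) (B₀ := B₀)
      rcases vtype_cases (h4 v) (h4 w) (h4 z) hs h₁ h₂ h₃ with rfl | rfl | rfl
      exacts [Conn.refl _, hvw', hvz']
    have h0 := (hall 0 (by omega)).symm
    exact ⟨h0.trans (hall 1 (by omega)), h0.trans (hall 2 (by omega))⟩
  · intro B hB hBF _ hBX _
    exact hW B hB hBF ((hBX v (Conn.refl _)).2 (by simp)) ((hBX w hvw).2 (by simp))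
      ((hBX z hvz).2 (by simp))

lemma exists_phi_eq_of_threeMarks (hB₀ : IsLexSmallestTree T.graph B₀) (hF : IsForest T.graph F)
    (hFE : (F : Set β) ⊆ E(T.graph)) (hF₀ : ∀ e ∈ F, e ∉ B₀) (hM : ∀ e ∈ F, 1 ≤ M e)
    (hM₀ : ∀ e ∉ F, M e = 0) (h : ThreeMarks T.graph (T.vtype B₀) T.IsApex F M u)
    (hRM : ∀ x, ¬ Conn T.graph F u x → OneMark T.graph T.IsApex F M x) :
    ∃ B, IsSpanningTree T.graph B ∧ T.phi B₀ B = M := by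
  rcases h with ⟨v, w, z, mv, mw, mz, huv, h, hwt⟩ | ⟨v, w, z, mv, mw, e, a, b, huv, h, hwt⟩ <;>
    replace hRM : ∀ x, ¬ Conn T.graph F v x → OneMark T.graph T.IsApex F M x :=
      fun x hx => hRM x fun h => hx (huv.symm.trans h)
  · refine exists_phi_eq_of_triple hB₀ hF hFE hF₀ hM hM₀ hRM h.conn₁ h.conn₂ h.ne₁ h.ne₂ h.ne₃
      h.sp_mem ?_
    rintro B hB rfl hv hw hz
    exact ⟨_, hwt, weighted_phi_of_tripod hB₀ hB hv hw hz h⟩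
  rcases h.mid with ⟨hza, hzv, hzw⟩ | ⟨rfl, hv1, hz2⟩
  · refine exists_phi_eq_of_triple hB₀ hF hFE hF₀ hM hM₀ hRM h.btw.1 h.btw.conn_left h.lt.ne
      hzw.symm hzv (fun x hx hc => (h.sp_mem x hx hc).imp id .inl) ?_
    rintro B hB rfl hv hw hz
    exact ⟨_, hwt, weighted_phi_of_sandwich hB₀ hB hv hw hz hza hzv hzw h⟩
  -- With an extra mark there are only two marked vertices. The edge `02` makes up for the third one
  -- in the count and produces the double mark.
  · obtain ⟨e₂, h₂⟩ := T.adj_two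
    obtain ⟨e', he', y, -, hl⟩ := Conn.eq_or_exists_isLink h.btw.1 fun h' => h.lt.ne (h' ▸ rfl)
    refine exists_phi_eq_of_component hB₀ hF hFE hF₀ hM hM₀ (X := {v, z}) (Q := {e₂}) he'
      ⟨v, y, hl, Conn.refl v⟩ hRM ?_ (Finset.insert_nonempty _ _) ?_ ?_ ?_ ?_ ?_
    · intro x hx
      rw [Finset.mem_insert, Finset.mem_singleton] at hx
      rcases hx with rfl | rfl
      exacts [Conn.refl _, h.btw.1]
    · intro x hx hc
      simpa using h.sp_mem x hx hc
    · intro f hf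
      rw [Finset.mem_singleton.1 hf]
      exact .inr ⟨h₂, .inl rfl⟩
    · rw [Finset.card_singleton]
      exact Nat.add_le_add_right Finset.card_le_two 1
    · intro B hFB hQB hXB
      have hc := conn_of_isLink (hQB (Finset.mem_singleton_self _)) h₂
      have hc' := conn_apex_of_mem hFB hXB (u := v) (v := z) (by simp) (by simp) h.btw.1
      rw [hv1, hz2] at hc'
      exact ⟨hc.trans hc'.symm, hc⟩
    · rintro B hB rfl hQB hBX -
      have hv := (hBX v (Conn.refl _)).2 (by simp)
      have hz := (hBX z h.btw.1).2 (by simp)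
      exact ⟨_, hwt, weighted_phi_of_extra hB₀ hB hv (hv.isDoublyMarked hB₀ hB
        (hQB (Finset.mem_singleton_self _)) h₂ hz h.btw.1 hv1 hz2) hv1 h⟩

/-- A configuration comes from a spanning tree. -/
theorem exists_phi_eq_of_isConfig (hB₀ : IsLexSmallestTree T.graph B₀) (hF : IsForest T.graph F)
    (hFE : (F : Set β) ⊆ E(T.graph)) (hF₀ : ∀ e ∈ F, e ∉ B₀) (hM : ∀ e ∈ F, 1 ≤ M e)
    (hM₀ : ∀ e ∉ F, M e = 0) (h : IsConfig T.graph (T.vtype B₀) T.IsApex F M) :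
    ∃ B, IsSpanningTree T.graph B ∧ T.phi B₀ B = M := by
  obtain ⟨e₁, e₂, he₁, he₂⟩ := exists_isConeLink_one_two T
  have hne₂ : ∀ f, T.IsConeLink f (T.c 0) (T.c 2) → f ≠ e₁ := by
    rintro f h rfl
    exact T.c_ne (by decide) (h.eq_of_isLink he₁).2
  rcases h.cases with h | ⟨u, r, ⟨v, w, mv, mw, huv, hp, hwt⟩, ho⟩ | ⟨u, h, ho⟩ |
    ⟨u, u', r, r', hrr, huu, ⟨v, w, mv, mw, huv, hp, hwt⟩, ⟨v', w', mv', mw', huv', hp', hwt'⟩, ho⟩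
  · refine exists_phi_eq hB₀ hF hFE hF₀ hM hM₀ (R := ∅) (X := ∅) (Q := {e₁, e₂})
      (Finset.empty_subset _) (fun x _ => h x) (by simp) (by simp) (by simp) ?_ ?_ ?_ (by simp)
    · intro f hf
      rw [Finset.mem_insert, Finset.mem_singleton] at hf
      rcases hf with rfl | rfl
      exacts [.inl he₁, .inr he₂]
    · simpa using Finset.card_le_two
    · exact fun B _ hQ _ => ⟨conn_of_isLink (hQ (by simp)) he₁.1, conn_of_isLink (hQ (by simp)) he₂.1⟩
  · obtain ⟨e, he, hve⟩ := IsPairAt.exists_mem hp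
    have key : ∀ e₃, T.IsConeLink e₃ (T.c 0) (T.c 1) ∨ T.IsConeLink e₃ (T.c 0) (T.c 2) →
        (T.IsConeLink e₃ (T.c 0) (T.c 2) → r = 2) →
        (∀ B : Finset β, F ⊆ B → e₃ ∈ B → (∀ s t, s < 3 → t < 3 → s ≠ r → t ≠ r →
          Conn T.graph B (T.apex s) (T.apex t)) →
            Conn T.graph B (T.c 0) (T.c 1) ∧ Conn T.graph B (T.c 0) (T.c 2)) →
        ∃ B, IsSpanningTree T.graph B ∧ T.phi B₀ B = M := by
      intro e₃ he₃ hr hreach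
      refine exists_phi_eq_of_component hB₀ hF hFE hF₀ hM hM₀ (X := {v, w}) (Q := {e₃}) he hve
        (fun x hx => ho x fun h => hx (huv.symm.trans h)) ?_ (Finset.insert_nonempty _ _) ?_ ?_ ?_ ?_
        ?_
      · intro x hx
        rw [Finset.mem_insert, Finset.mem_singleton] at hx
        rcases hx with rfl | rfl
        exacts [Conn.refl _, hp.conn]
      · intro x hx hc
        simpa using hp.sp_mem x hx hc
      · intro f hf
        rwa [Finset.mem_singleton.1 hf]
      · rw [Finset.card_singleton]
        exact Nat.add_le_add_right Finset.card_le_two 1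
      · intro B hFB hQB hXB
        exact hreach B hFB (hQB (Finset.mem_singleton_self _)) fun s t hs ht hsr htr =>
          conn_apex_of_pair hp (conn_apex_of_mem hFB hXB (by simp) (by simp) hp.conn) hs ht hsr htr
      · rintro B hB rfl hQB hBX hBQ
        have hm : ∀ u, T.IsMarked B₀ B u → Conn T.graph (B \ B₀) v u → u = v ∨ u = w :=
          fun u hu hc => by simpa using (hBX u hc).1 hu
        refine ⟨_, hwt, weighted_phi_of_pair hB ((hBX v (Conn.refl _)).2 (by simp))
          ((hBX w hp.conn).2 (by simp)) hp hm fun u hu => IsPairAt.not_isDoublyMarked hB₀ hB hp hm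
            (fun ⟨f, hf, hl⟩ => hr ?_) hu⟩
        rw [← Finset.mem_singleton.1 (hBQ f hl hf)]
        exact hl
    -- One of `01`, `02` is added to the connection given by the pair. The edge `02` is used only
    -- for marks of types `0` and `1`, where `01` would close a cycle; in the other cases `01`
    -- avoids any double mark.
    by_cases hr : r = 2
    · refine key e₂ (.inr he₂) (fun _ => hr) fun B _ h2 hc => ⟨hc 0 1 ?_ ?_ ?_ ?_,
        conn_of_isLink h2 he₂.1⟩ <;> omega
    · refine key e₁ (.inl he₁) (fun h => absurd rfl (hne₂ _ h)) fun B _ h1 hc => ?_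
      have h1 := conn_of_isLink h1 he₁.1
      refine ⟨h1, ?_⟩
      by_cases hr0 : r = 0
      · exact h1.trans (hc 1 2 (by omega) (by omega) (by omega) (by omega))
      · exact hc 0 2 (by omega) (by omega) (by omega) (by omega)
  · exact exists_phi_eq_of_threeMarks hB₀ hF hFE hF₀ hM hM₀ h ho
  · obtain ⟨e, he, hve⟩ := IsPairAt.exists_mem hp
    obtain ⟨e', he', hve'⟩ := IsPairAt.exists_mem hp'
    obtain ⟨y, hyV, hy, hvy⟩ := exists_isRoot (S := F) T.coe_verts
      (mem_verts.2 (InComp.mem_vertexSet hve))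
    obtain ⟨y', hyV', hy', hvy'⟩ := exists_isRoot (S := F) T.coe_verts
      (mem_verts.2 (InComp.mem_vertexSet hve'))
    have hy0 : y ≠ T.c 0 := InComp.ne_zero hB₀ hF₀ he (hve.trans hvy.symm)
    have hy0' : y' ≠ T.c 0 := InComp.ne_zero hB₀ hF₀ he' (hve'.trans hvy'.symm)
    have hyy : y ≠ y' := by
      rintro rfl
      exact huu (((huv.trans hvy).trans hvy'.symm).trans huv'.symm)
    have hX : ∀ x, x ∈ ({v, w} ∪ {v', w'} : Finset α) ↔ (x = v ∨ x = w) ∨ x = v' ∨ x = w' := fun x => by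
      simp only [Finset.mem_union, Finset.mem_insert, Finset.mem_singleton]
    have hno : ∀ {x}, Conn T.graph F v x → ¬ Conn T.graph F v' x := fun h h' =>
      huu (((huv.trans h).trans h'.symm).trans huv'.symm)
    have hXv : ∀ {x}, Conn T.graph F v x → x ∈ ({v, w} ∪ {v', w'} : Finset α) → x = v ∨ x = w := by
      intro x hc hx
      rcases (hX x).1 hx with h | rfl | rfl
      exacts [h, absurd (Conn.refl _) (hno hc), absurd hp'.conn (hno hc)]
    have hXv' : ∀ {x}, Conn T.graph F v' x → x ∈ ({v, w} ∪ {v', w'} : Finset α) →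
        x = v' ∨ x = w' := by
      intro x hc hx
      rcases (hX x).1 hx with (rfl | rfl) | h
      exacts [absurd hc (hno (Conn.refl _)), absurd hc (hno hp.conn), h]
    refine exists_phi_eq hB₀ hF hFE hF₀ hM hM₀ (R := {y, y'}) (X := {v, w} ∪ {v', w'}) (Q := ∅)
      ?_ (fun x hx => ?_) ?_ ?_ ?_ (by simp) ?_ ?_ ?_
    · intro x hx
      rw [Finset.mem_insert, Finset.mem_singleton] at hx
      rw [Finset.mem_erase, mem_roots]
      rcases hx with rfl | rfl
      exacts [⟨hy0, hyV, hy⟩, ⟨hy0', hyV', hy'⟩]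
    · exact ho x (fun h => hx y (by simp) (hvy.symm.trans (huv.symm.trans h)))
        fun h => hx y' (by simp) (hvy'.symm.trans (huv'.symm.trans h))
    · intro x hx
      rcases (hX x).1 hx with (rfl | rfl) | rfl | rfl
      exacts [⟨y, by simp, hvy.symm⟩, ⟨y, by simp, hvy.symm.trans hp.conn⟩,
        ⟨y', by simp, hvy'.symm⟩, ⟨y', by simp, hvy'.symm.trans hp'.conn⟩]
    · intro x hx
      rw [Finset.mem_insert, Finset.mem_singleton] at hx
      rcases hx with rfl | rfl
      exacts [⟨v, by simp, hvy.symm⟩, ⟨v', by simp, hvy'.symm⟩]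
    · intro x hx z hz hc
      rw [Finset.mem_insert, Finset.mem_singleton] at hz
      rw [hX]
      rcases hz with rfl | rfl
      exacts [.inl (hp.sp_mem x hx (hvy.trans hc)), .inr (hp'.sp_mem x hx (hvy'.trans hc))]
    · rw [Finset.card_pair hyy, Finset.card_empty]
      exact (Finset.card_union_le _ _).trans
        (Nat.add_le_add Finset.card_le_two Finset.card_le_two)
    · intro B hFB _ hXB
      have h1 : ∀ {s t}, s < 3 → t < 3 → s ≠ r → t ≠ r → Conn T.graph B (T.apex s) (T.apex t) :=
        conn_apex_of_pair hp (conn_apex_of_mem hFB hXB (by simp) (by simp) hp.conn)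
      have h2 : ∀ {s t}, s < 3 → t < 3 → s ≠ r' → t ≠ r' → Conn T.graph B (T.apex s) (T.apex t) :=
        conn_apex_of_pair hp' (conn_apex_of_mem hFB hXB (by simp) (by simp) hp'.conn)
      -- Two pairs with different missing types give two sides of the triangle `0`, `1`, `2`, which
      -- connect all three vertices.
      have hjoin : ∀ i j k, i < 3 → j < 3 → k < 3 → i ≠ j → j ≠ k → k ≠ i →
          Conn T.graph B (T.apex i) (T.apex j) := by
        intro i j k hi hj hk hij hjk hki
        by_cases hrk : r = k
        · exact h1 hi hj (by omega) (by omega)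
        by_cases hrk' : r' = k
        · exact h2 hi hj (by omega) (by omega)
        by_cases hri : r = i
        · exact (h2 hi hk (by omega) (by omega)).trans (h1 hk hj (by omega) (by omega))
        · have := hp.lt
          have := hp'.lt
          exact (h1 hi hk (by omega) (by omega)).trans (h2 hk hj (by omega) (by omega))
      exact ⟨hjoin 0 1 2 (by omega) (by omega) (by omega) (by omega) (by omega) (by omega),
        hjoin 0 2 1 (by omega) (by omega) (by omega) (by omega) (by omega) (by omega)⟩
    · rintro B hB rfl _ hBX hBQ z hz
      have hno2 : (∃ f ∈ B, T.IsConeLink f (T.c 0) (T.c 2)) → False :=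
        fun ⟨f, hf, hl⟩ => by simpa using hBQ f hl hf
      have hB1 : ∀ {u}, Conn T.graph (B \ B₀) v u → (T.IsMarked B₀ B u ↔ _) := fun {u} hc =>
        hBX u ⟨y, by simp, hvy.symm.trans hc⟩
      have hB2 : ∀ {u}, Conn T.graph (B \ B₀) v' u → (T.IsMarked B₀ B u ↔ _) := fun {u} hc =>
        hBX u ⟨y', by simp, hvy'.symm.trans hc⟩
      have hm1 : ∀ u, T.IsMarked B₀ B u → Conn T.graph (B \ B₀) v u → u = v ∨ u = w :=
        fun u hu hc => hXv hc ((hB1 hc).1 hu)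
      have hm2 : ∀ u, T.IsMarked B₀ B u → Conn T.graph (B \ B₀) v' u → u = v' ∨ u = w' :=
        fun u hu hc => hXv' hc ((hB2 hc).1 hu)
      rw [Finset.mem_insert, Finset.mem_singleton] at hz
      rcases hz with rfl | rfl
      · exact ⟨_, hwt.of_conn hvy, (weighted_phi_of_pair hB ((hB1 (Conn.refl _)).2 (by simp))
          ((hB1 hp.conn).2 (by simp)) hp hm1 fun u hu => IsPairAt.not_isDoublyMarked hB₀ hB hp hm1
            (fun h => (hno2 h).elim) hu).of_conn hvy⟩
      · exact ⟨_, hwt'.of_conn hvy', (weighted_phi_of_pair hB ((hB2 (Conn.refl _)).2 (by simp))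
          ((hB2 hp'.conn).2 (by simp)) hp' hm2 fun u hu => IsPairAt.not_isDoublyMarked hB₀ hB hp'
            hm2 (fun h => (hno2 h).elim) hu).of_conn hvy'⟩

end Realization

end TriconedGraph

namespace TriconedGraph

/-! ### The order ideal -/

section Ideal

variable {α β : Type*} [LinearOrder α] [LinearOrder β] {T : TriconedGraph α β} {B₀ B F : Finset β}
  {M N : β →₀ ℕ} {e f g : β} {u v w x y z a b : α} {r s t : ℕ}

variable (T B₀) in
/-- The weights `M` are those of a configuration in a forest of edges outside of the smallest
spanning tree. -/
structure IsValid (F : Finset β) (M : β →₀ ℕ) : Prop where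
  isForest : IsForest T.graph F
  subset : (F : Set β) ⊆ E(T.graph)
  not_mem : ∀ e ∈ F, e ∉ B₀
  one_le : ∀ e ∈ F, 1 ≤ M e
  eq_zero : ∀ e ∉ F, M e = 0
  isConfig : IsConfig T.graph (T.vtype B₀) T.IsApex F M

lemma isValid_phi (hB₀ : IsLexSmallestTree T.graph B₀) (hB : IsSpanningTree T.graph B) :
    T.IsValid B₀ (B \ B₀) (T.phi B₀ B) where
  isForest := isForest_sdiff hB
  subset e he := hB.subset (Finset.mem_coe.2 (Finset.mem_sdiff.1 (Finset.mem_coe.1 he)).1)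
  not_mem := not_mem_of_mem_sdiff
  one_le e he := by
    have he : e ∈ (T.phi₁ B₀ B).edges := he
    simp [phi, phi₂, he]
  eq_zero e he := phi₂_apply_of_not_mem he
  isConfig := isConfig_phi hB₀ hB

/-- From here on spanning trees are replaced by valid weights, for which division and maximality can
be treated component by component. -/
lemma mem_imagePhi_iff (hB₀ : IsLexSmallestTree T.graph B₀) :
    M ∈ T.imagePhi B₀ ↔ ∃ F, T.IsValid B₀ F M := by
  constructor
  · rintro ⟨B, hB, rfl⟩
    exact ⟨_, isValid_phi hB₀ hB⟩
  · rintro ⟨F, h⟩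
    exact exists_phi_eq_of_isConfig hB₀ h.isForest h.subset h.not_mem h.one_le h.eq_zero h.isConfig

lemma IsValid.mem_of_ne_zero (h : T.IsValid B₀ F M) (he : M e ≠ 0) : e ∈ F := by
  by_contra h'
  exact he (h.eq_zero e h')

/-- Dividing by a variable. -/
lemma IsValid.sub_single (h : T.IsValid B₀ F M) (he : e ∈ F) :
    ∃ F', T.IsValid B₀ F' (M - Finsupp.single e 1) := by
  have hval : ∀ f, f ≠ e → (M - Finsupp.single e 1 : β →₀ ℕ) f = M f := fun f hf => by
    rw [Finsupp.tsub_apply, Finsupp.single_eq_of_ne hf, tsub_zero]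
  have hval' : (M - Finsupp.single e 1 : β →₀ ℕ) e = M e - 1 := by
    rw [Finsupp.tsub_apply, Finsupp.single_eq_same]
  by_cases h2 : 2 ≤ M e
  · refine ⟨F, h.isForest, h.subset, h.not_mem, fun f hf => ?_, fun f hf => ?_,
      h.isConfig.sub_single h.isForest vtype_lt he h2⟩
    · by_cases hfe : f = e
      · rw [hfe, hval']
        omega
      · rw [hval f hfe]
        exact h.one_le f hf
    · rw [hval f fun hfe => hf (hfe ▸ he)]
      exact h.eq_zero f hf
  · have h1 : M e = 1 := le_antisymm (by omega) (h.one_le e he)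
    obtain ⟨a, b, hl⟩ := T.graph.exists_isLink_of_mem_edgeSet (h.subset (Finset.mem_coe.2 he))
    refine ⟨F.erase e, h.isForest.subset (Finset.erase_subset e F),
      (Finset.coe_subset.2 (Finset.erase_subset e F)).trans h.subset,
      fun f hf => h.not_mem f (Finset.mem_of_mem_erase hf), fun f hf => ?_, fun f hf => ?_,
      h.isConfig.erase h.isForest vtype_lt he h1 hl⟩
    · rw [hval f (Finset.ne_of_mem_erase hf)]
      exact h.one_le f (Finset.mem_of_mem_erase hf)
    · by_cases hfe : f = e
      · rw [hfe, hval', h1]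
      · rw [hval f hfe]
        exact h.eq_zero f fun hfF => hf (Finset.mem_erase.2 ⟨hfe, hfF⟩)

lemma IsValid.of_le (h : T.IsValid B₀ F M) (hN : N ≤ M) : ∃ F', T.IsValid B₀ F' N := by
  induction hk : M.degree using Nat.strong_induction_on generalizing F M with
  | _ k ih =>
    by_cases hNM : N = M
    · exact ⟨F, hNM ▸ h⟩
    · obtain ⟨e, he⟩ : ∃ e, N e < M e := by
        by_contra! hle
        exact hNM (le_antisymm hN hle)
      have hs : Finsupp.single e 1 ≤ M := Finsupp.single_le_iff.2 (by omega)
      obtain ⟨F', h'⟩ := h.sub_single (h.mem_of_ne_zero (e := e) (by omega))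
      refine ih _ ?_ h' (fun f => ?_) rfl
      · have := congrArg Finsupp.degree (tsub_add_cancel_of_le hs)
        rw [map_add, Finsupp.degree_single] at this
        omega
      · rw [Finsupp.tsub_apply]
        by_cases hfe : f = e
        · rw [hfe, Finsupp.single_eq_same]
          omega
        · rw [Finsupp.single_eq_of_ne hfe, tsub_zero]
          exact hN f

lemma finite_imagePhi : (T.imagePhi B₀).Finite := by
  refine ((T.finite_edgeSet.toFinset.powerset.finite_toSet).image (T.phi B₀)).subset ?_
  rintro M ⟨B, hB, rfl⟩
  refine ⟨B, Finset.mem_coe.2 (Finset.mem_powerset.2 fun e he => ?_), rfl⟩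
  exact (Set.Finite.mem_toFinset _).2 (hB.subset (Finset.mem_coe.2 he))

lemma isOrderIdeal_imagePhi (hB₀ : IsLexSmallestTree T.graph B₀) :
    IsOrderIdeal (T.imagePhi B₀) := by
  refine ⟨finite_imagePhi, fun M hM N hN => ?_⟩
  obtain ⟨F, h⟩ := (mem_imagePhi_iff hB₀).1 hM
  exact (mem_imagePhi_iff hB₀).2 (h.of_le hN)

/-! ### Maximal configurations -/

lemma IsValid.add_single (h : T.IsValid B₀ F M) (hf : f ∈ F)
    (hc : IsConfig T.graph (T.vtype B₀) T.IsApex F (M + Finsupp.single f 1)) :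
    T.IsValid B₀ F (M + Finsupp.single f 1) where
  isForest := h.isForest
  subset := h.subset
  not_mem := h.not_mem
  one_le e he := (h.one_le e he).trans (by rw [Finsupp.add_apply]; exact Nat.le_add_right _ _)
  eq_zero e he := by
    have hef : e ≠ f := fun h => he (h ▸ hf)
    rw [add_single_apply_of_ne hef]
    exact h.eq_zero e he
  isConfig := hc

lemma IsValid.insert_edge (h : T.IsValid B₀ F M) (hg : g ∉ B₀) (hl : T.graph.IsLink g x y)
    (hxy : ¬ Conn T.graph F x y)
    (hc : IsConfig T.graph (T.vtype B₀) T.IsApex (insert g F) (M + Finsupp.single g 1)) :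
    T.IsValid B₀ (insert g F) (M + Finsupp.single g 1) where
  isForest := h.isForest.insert_edge hl hxy
  subset := by
    rw [Finset.coe_insert]
    exact Set.insert_subset hl.edge_mem h.subset
  not_mem e he := by
    rcases Finset.mem_insert.1 he with rfl | he
    exacts [hg, h.not_mem e he]
  one_le e he := by
    rw [Finsupp.add_apply]
    rcases Finset.mem_insert.1 he with rfl | he
    · rw [Finsupp.single_eq_same]
      exact Nat.le_add_left _ _
    · exact (h.one_le e he).trans (Nat.le_add_right _ _)
  eq_zero e he := by
    rw [Finset.mem_insert, not_or] at he
    rw [add_single_apply_of_ne he.1]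
    exact h.eq_zero e he.2
  isConfig := hc

lemma not_mem_add_single (hM : Maximal (· ∈ T.imagePhi B₀) M) :
    M + Finsupp.single f 1 ∉ T.imagePhi B₀ := by
  intro h
  have := hM.2 h (le_add_of_nonneg_right (zero_le)) f
  rw [Finsupp.add_apply, Finsupp.single_eq_same] at this
  omega

variable (hB₀ : IsLexSmallestTree T.graph B₀) (hM : Maximal (· ∈ T.imagePhi B₀) M)
  (h : T.IsValid B₀ F M)
include hB₀ hM h

/-- Otherwise `x` is isolated, and an edge at `x` outside `B₀` could be attached with weight one
without changing the marks elsewhere. -/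
lemma IsValid.exists_mem_of_maximal (hx : x ∈ V(T.graph)) (hx0 : x ≠ T.c 0)
    (hxa : ¬ T.IsApex x) : ∃ e ∈ F, InComp T.graph F x e := by
  by_contra! hno
  obtain ⟨g, -, hg₀, y, hl⟩ := exists_isLink_of_normal hB₀ hx hx0 hxa
  have hno' : ∀ e ∈ F, ∀ z, ¬ T.graph.IsLink e x z := fun e he z hl =>
    hno e he ⟨x, z, hl, Conn.refl x⟩
  have hxy : ¬ Conn T.graph F x y := by
    intro hc
    obtain ⟨e, he, z, -, hz⟩ := hc.eq_or_exists_isLink (ne_of_isLink hl)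
    exact hno' e he z hz
  refine not_mem_add_single hM ((mem_imagePhi_iff hB₀).2 ⟨_, h.insert_edge hg₀ hl hxy ?_⟩)
  exact h.isConfig.attach h.isForest hl (ne_of_isLink hl) hno' hxa
    (h.eq_zero g fun hg => hno' g hg y hl)

/-- Without special vertex and without an edge of weight two, any edge of the component could be
raised; there is one by `exists_mem_of_maximal`. -/
lemma IsValid.saturated_of_maximal (hx : x ∈ V(T.graph)) (hx0 : x ≠ T.c 0)
    (ho : OneMark T.graph T.IsApex F M x) : Saturated T.graph T.IsApex F M x := by
  by_contra hs
  have hsp : ∀ y, T.IsApex y → ¬ Conn T.graph F x y := fun y hy hc => hs (.inl ⟨y, hy, hc⟩)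
  obtain ⟨f, hf, hi⟩ := h.exists_mem_of_maximal hB₀ hM hx hx0 fun hxa => hsp x hxa (Conn.refl x)
  refine not_mem_add_single (f := f) hM ((mem_imagePhi_iff hB₀).2 ⟨F, h.add_single hf ?_⟩)
  refine h.isConfig.add_single_of_oneMark ho hsp hf hi fun e he hie => ?_
  by_contra h2
  exact hs (.inr ⟨e, he, hie, by omega⟩)

/-- The edges available for extension are all those outside `B₀`. They never meet `0`, which serves
as the dummy component. -/
lemma IsValid.cases_of_maximal :
    (∃ u, ThreeMarks T.graph (T.vtype B₀) T.IsApex F M u ∧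
      ∀ x, ¬ Conn T.graph F u x → OneMark T.graph T.IsApex F M x) ∨
    (∃ u u' r r', r ≠ r' ∧ ¬ Conn T.graph F u u' ∧
      TwoMarks T.graph (T.vtype B₀) T.IsApex F M r u ∧
      TwoMarks T.graph (T.vtype B₀) T.IsApex F M r' u' ∧
      ∀ x, ¬ Conn T.graph F u x → ¬ Conn T.graph F u' x → OneMark T.graph T.IsApex F M x) := by
  refine (IsConfig.extends_or (A := {g | g ∈ E(T.graph) ∧ g ∉ B₀}) (o := T.c 0) h.isForest vtype_lt
    (fun x hx => vtype_ne_zero_of_isApex hB₀ hx) h.one_le h.eq_zero ?_ ?_ h.isConfig).resolve_left ?_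
  · rintro g ⟨-, hg₀⟩ p q hl
    have hp0 := ne_zero_of_not_mem_tree hB₀ hg₀ hl
    exact ⟨fun hc => hp0 (conn_zero hB₀ h.not_mem hc.symm),
      h.saturated_of_maximal hB₀ hM hl.left_mem hp0⟩
  · intro r hr hr3
    obtain ⟨g, hg, hg₀, p, q, hpq⟩ := exists_isLink_of_vtype hB₀ hr hr3
    exact ⟨g, ⟨hg, hg₀⟩, p, q, hpq⟩
  · rintro (⟨f, hf, hc⟩ | ⟨g, ⟨-, hg₀⟩, p, q, hl, hpq, hc⟩)
    · exact not_mem_add_single hM ((mem_imagePhi_iff hB₀).2 ⟨F, h.add_single hf hc⟩)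
    · exact not_mem_add_single hM ((mem_imagePhi_iff hB₀).2 ⟨_, h.insert_edge hg₀ hl hpq hc⟩)

end Ideal

end TriconedGraph

namespace TriconedGraph

/-! ### The degree of a maximal monomial -/

section Degree

variable {α β : Type*} [LinearOrder α] [LinearOrder β] {T : TriconedGraph α β} {B₀ B F : Finset β}
  {M N : β →₀ ℕ} {e f g : β} {u v w x y z a b : α} {r s t k : ℕ} {m : Multiset β}

variable (T) in
open Classical in
/-- The number of marks in the component of `x` of a saturated configuration: they are on special
vertices or add to the weights. -/
noncomputable def markCount (F : Finset β) (M : β →₀ ℕ) (x : α) : ℕ :=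
  ∑ e ∈ F, (if InComp T.graph F x e then M e - 1 else 0) +
    ∑ c ∈ {T.c 1, T.c 2}, if Conn T.graph F x c then 1 else 0

open Classical in
lemma markCount_eq {X : Finset α} (hX : ∀ v ∈ X, Conn T.graph F x v)
    (hXa : ∀ v, T.IsApex v → Conn T.graph F x v → v ∈ X) (hW : Weighted T.graph F M x m)
    (hm : ∀ e ∈ m, e ∈ F ∧ InComp T.graph F x e) :
    T.markCount F M x = m.card + (X.filter T.IsApex).card := by
  unfold markCount
  congr 1
  · rw [← Multiset.sum_count_eq_card fun e he => (hm e he).1]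
    refine Finset.sum_congr rfl fun e he => ?_
    split_ifs with hi
    · rw [hW e he hi]
      omega
    · exact (Multiset.count_eq_zero_of_notMem fun h => hi (hm e h).2).symm
  · rw [← Finset.card_filter]
    congr 1
    ext v
    simp only [Finset.mem_filter, Finset.mem_insert, Finset.mem_singleton]
    exact ⟨fun ⟨h, h'⟩ => ⟨hXa v h h', h⟩, fun ⟨h, h'⟩ => ⟨h', hX v h⟩⟩

open Classical in
lemma card_of_toEdge (h : ToEdge T.graph T.IsApex F v w m) :
    m.card + (if T.IsApex v then 1 else 0) = 1 := by
  rcases h with ⟨hv, rfl⟩ | ⟨hv, e, b, -, rfl⟩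
  · rw [if_pos hv, Multiset.card_zero]
  · rw [if_neg hv, Multiset.card_singleton]

lemma mem_of_toEdge (h : ToEdge T.graph T.IsApex F v w m) (hx : Conn T.graph F x v) (he : e ∈ m) :
    e ∈ F ∧ InComp T.graph F x e :=
  ⟨(h.exists_isLink he).1, (h.inComp he F).trans hx⟩

lemma markCount_of_oneMark (hM : ∀ e ∈ F, 1 ≤ M e) (h : OneMark T.graph T.IsApex F M x)
    (hs : Saturated T.graph T.IsApex F M x) : T.markCount F M x = 1 := by
  classical
  obtain ⟨u, m, hu⟩ := h.exists_isMarkAt hM hs (Conn.refl x)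
  rw [markCount_eq (X := {u}) (m := m) (by simpa using hu.conn)
    (fun v hv hc => Finset.mem_singleton.2 (hu.sp_eq v hv hc)) hu.weighted
    fun e he => mem_of_toEdge hu.toEdge hu.conn he, Finset.card_filter, Finset.sum_singleton,
    card_of_toEdge hu.toEdge]

lemma markCount_of_twoMarks (h : TwoMarks T.graph (T.vtype B₀) T.IsApex F M r x) :
    T.markCount F M x = 2 := by
  classical
  obtain ⟨v, w, mv, mw, hxv, hp, hW⟩ := h
  have hvw : v ≠ w := fun h => hp.ne (h ▸ rfl)
  have h1 := card_of_toEdge hp.left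
  have h2 := card_of_toEdge hp.right
  rw [markCount_eq (X := {v, w}) (m := mv + mw), Finset.card_filter, Finset.sum_pair hvw,
    Multiset.card_add]
  · omega
  · intro y hy
    rw [Finset.mem_insert, Finset.mem_singleton] at hy
    rcases hy with rfl | rfl
    exacts [hxv, hxv.trans hp.conn]
  · intro y hy hc
    simpa using hp.sp_mem y hy (hxv.symm.trans hc)
  · exact hW.of_conn hxv.symm
  · intro e he
    rcases Multiset.mem_add.1 he with he | he
    exacts [mem_of_toEdge hp.left hxv he, mem_of_toEdge hp.right (hxv.trans hp.conn) he]

lemma markCount_of_threeMarks (hF : IsForest T.graph F)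
    (h : ThreeMarks T.graph (T.vtype B₀) T.IsApex F M x) :
    T.markCount F M x = 3 := by
  classical
  rcases h with ⟨v, w, z, mv, mw, mz, hxv, h, hW⟩ | ⟨v, w, z, mv, mw, e₀, a, b, hxv, h, hW⟩
  · have hvw : v ≠ w := fun h' => h.ne₁ (h' ▸ rfl)
    have hwz : w ≠ z := fun h' => h.ne₂ (h' ▸ rfl)
    have hvz : v ≠ z := fun h' => h.ne₃ (h' ▸ rfl)
    have h1 := card_of_toEdge h.toEdge₁
    have h2 := card_of_toEdge h.toEdge₂
    have h3 := card_of_toEdge h.toEdge₃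
    rw [markCount_eq (X := {v, w, z}) (m := mv + mw + mz), Finset.card_filter,
      Finset.sum_insert (by simp [hvw, hvz]), Finset.sum_pair hwz, Multiset.card_add,
      Multiset.card_add]
    · omega
    · intro y hy
      rw [Finset.mem_insert, Finset.mem_insert, Finset.mem_singleton] at hy
      rcases hy with rfl | rfl | rfl
      exacts [hxv, hxv.trans h.conn₁, hxv.trans h.conn₂]
    · intro y hy hc
      simpa using h.sp_mem y hy (hxv.symm.trans hc)
    · exact hW.of_conn hxv.symm
    · intro e he
      rcases Multiset.mem_add.1 he with he | he
      · rcases Multiset.mem_add.1 he with he | he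
        exacts [mem_of_toEdge h.toEdge₁ hxv he, mem_of_toEdge h.toEdge₂ (hxv.trans h.conn₁) he]
      · exact mem_of_toEdge h.toEdge₃ (hxv.trans h.conn₂) he
  · have hvw : v ≠ w := fun h' => h.lt.ne (h' ▸ rfl)
    have h1 := card_of_toEdge h.left
    have h2 := card_of_toEdge h.right
    rw [markCount_eq (X := {v, w}) (m := mv + mw + {e₀}), Finset.card_filter, Finset.sum_pair hvw,
      Multiset.card_add, Multiset.card_add, Multiset.card_singleton]
    · omega
    · intro y hy
      rw [Finset.mem_insert, Finset.mem_singleton] at hy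
      rcases hy with rfl | rfl
      exacts [hxv, hxv.trans h.btw.1]
    · intro y hy hc
      simpa using h.sp_mem y hy (hxv.symm.trans hc)
    · exact hW.of_conn hxv.symm
    · intro e he
      rcases Multiset.mem_add.1 he with he | he
      · rcases Multiset.mem_add.1 he with he | he
        exacts [mem_of_toEdge h.left hxv he, mem_of_toEdge h.right (hxv.trans h.btw.1) he]
      · rw [Multiset.mem_singleton.1 he]
        exact ⟨(h.dart hF).mem, (h.dart hF).inComp.trans (hxv.trans h.btw.1)⟩

open Classical in
/-- Exactly one root belongs to the component of a vertex. -/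
lemma sum_roots_conn (hB₀ : IsLexSmallestTree T.graph B₀) (hF₀ : ∀ e ∈ F, e ∉ B₀)
    (hx : x ∈ V(T.graph)) (hx0 : x ≠ T.c 0) :
    ∑ y ∈ (roots T.graph T.verts F).erase (T.c 0), (if Conn T.graph F y x then k else 0) = k := by
  obtain ⟨z, hzV, hz, hxz⟩ := exists_isRoot (S := F) T.coe_verts (mem_verts.2 hx)
  have hz0 : z ≠ T.c 0 := fun h => hx0 (conn_zero hB₀ hF₀ (h ▸ hxz))
  rw [Finset.sum_eq_single z]
  · rw [if_pos hxz.symm]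
  · intro y hy hyz
    rw [if_neg]
    intro hc
    exact hyz ((mem_roots.1 (Finset.mem_of_mem_erase hy)).2.eq hz (hc.trans hxz))
  · intro h
    exact absurd (Finset.mem_erase.2 ⟨hz0, mem_roots.2 ⟨hzV, hz⟩⟩) h

open Classical in
-- Every edge of `F`, and each of `1` and `2`, belongs to exactly one component; the vertices `1`
-- and `2` account for the summand `2`.
lemma sum_markCount (hB₀ : IsLexSmallestTree T.graph B₀) (h : T.IsValid B₀ F M) :
    ∑ y ∈ (roots T.graph T.verts F).erase (T.c 0), T.markCount F M y =
      ∑ e ∈ F, (M e - 1) + 2 := by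
  unfold markCount
  rw [Finset.sum_add_distrib, Finset.sum_comm, Finset.sum_comm (s := (roots _ _ _).erase _)
    (t := {T.c 1, T.c 2})]
  congr 1
  · refine Finset.sum_congr rfl fun e he => ?_
    obtain ⟨a, b, hl⟩ := T.graph.exists_isLink_of_mem_edgeSet (h.subset (Finset.mem_coe.2 he))
    refine Eq.trans ?_ (sum_roots_conn (k := M e - 1) hB₀ h.not_mem hl.left_mem
      (ne_zero_of_not_mem_tree hB₀ (h.not_mem e he) hl))
    refine Finset.sum_congr rfl fun y _ => if_congr ⟨fun hi => hi.conn_of_isLink he hl,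
      fun hc => ⟨a, b, hl, hc⟩⟩ rfl rfl
  · rw [Finset.sum_pair (T.c_ne (by decide)), sum_roots_conn hB₀ h.not_mem (c_mem 1)
      (T.c_ne (by decide)), sum_roots_conn hB₀ h.not_mem (c_mem 2) (T.c_ne (by decide))]

lemma IsValid.degree_eq (h : T.IsValid B₀ F M) :
    M.degree = F.card + ∑ e ∈ F, (M e - 1) := by
  rw [Finsupp.degree_apply, Finset.sum_subset (s₂ := F) fun e he =>
    h.mem_of_ne_zero (Finsupp.mem_support_iff.1 he), Finset.card_eq_sum_ones,
    ← Finset.sum_add_distrib]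
  · refine Finset.sum_congr rfl fun e he => ?_
    have := h.one_le e he
    omega
  · exact fun e _ he => Finsupp.notMem_support_iff.1 he

lemma ThreeMarks.exists_mem (h : ThreeMarks T.graph (T.vtype B₀) T.IsApex F M x) :
    ∃ e ∈ F, InComp T.graph F x e := by
  have key : ∀ {v w}, Conn T.graph F x v → Conn T.graph F v w → T.vtype B₀ v ≠ T.vtype B₀ w →
      ∃ e ∈ F, InComp T.graph F x e := by
    intro v w hxv hvw hne
    obtain ⟨e, he, y, -, hl⟩ := Conn.eq_or_exists_isLink hvw fun h' => hne (h' ▸ rfl)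
    exact ⟨e, he, v, y, hl, hxv⟩
  rcases h with ⟨v, w, z, mv, mw, mz, hxv, h, -⟩ | ⟨v, w, z, mv, mw, e₀, a, b, hxv, h, -⟩
  exacts [key hxv h.conn₁ h.ne₁, key hxv h.btw.1 h.lt.ne]

lemma TwoMarks.exists_mem (h : TwoMarks T.graph (T.vtype B₀) T.IsApex F M r x) :
    ∃ e ∈ F, InComp T.graph F x e := by
  obtain ⟨v, w, mv, mw, hxv, h, -⟩ := h
  obtain ⟨e, he, hi⟩ := IsPairAt.exists_mem h
  exact ⟨e, he, hi.trans hxv⟩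

/-- The degree of the maximal monomials. -/
lemma IsValid.degree_of_maximal (hB₀ : IsLexSmallestTree T.graph B₀)
    (hM : Maximal (· ∈ T.imagePhi B₀) M) (h : T.IsValid B₀ F M) :
    M.degree + 1 = T.verts.card := by
  classical
  have h0 : T.c 0 ∈ roots T.graph T.verts F := mem_roots.2 ⟨mem_verts.2 (c_mem 0), fun y hy =>
    (conn_zero hB₀ h.not_mem hy.symm).ge⟩
  have c1 : (roots T.graph T.verts F).card + F.card = T.verts.card :=
    IsForest.card_roots T.coe_verts h.isForest h.subset
  have c2 := Finset.card_erase_of_mem h0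
  have c3 := Finset.card_pos.2 ⟨_, h0⟩
  have hroot : ∀ {u}, (∃ e ∈ F, InComp T.graph F u e) → u ∈ V(T.graph) ∧ u ≠ T.c 0 :=
    fun ⟨e, he, hi⟩ => ⟨InComp.mem_vertexSet hi, InComp.ne_zero hB₀ h.not_mem he hi⟩
  have hone : ∀ y ∈ (roots T.graph T.verts F).erase (T.c 0), OneMark T.graph T.IsApex F M y →
      T.markCount F M y = 1 := fun y hy ho => by
    obtain ⟨hy0, hy⟩ := Finset.mem_erase.1 hy
    exact markCount_of_oneMark h.one_le ho (h.saturated_of_maximal hB₀ hM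
      (mem_verts.1 (mem_roots.1 hy).1) hy0 ho)
  -- In a maximal configuration there are two marks more than components other than `{0}`: three
  -- marks in one component, or two in each of two.
  have hsum : ∑ y ∈ (roots T.graph T.verts F).erase (T.c 0), T.markCount F M y =
      ((roots T.graph T.verts F).erase (T.c 0)).card + 2 := by
    rw [Finset.card_eq_sum_ones]
    rcases h.cases_of_maximal hB₀ hM with ⟨u, hu, ho⟩ | ⟨u, u', r, r', -, huu, hu, hu', ho⟩
    · obtain ⟨huV, hu0⟩ := hroot (ThreeMarks.exists_mem hu)
      have h2 := sum_roots_conn (k := 2) hB₀ h.not_mem huV hu0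
      refine Eq.trans ?_ (congrArg (_ + ·) h2)
      rw [← Finset.sum_add_distrib]
      refine Finset.sum_congr rfl fun y hy => ?_
      split_ifs with hc
      · exact markCount_of_threeMarks h.isForest (ThreeMarks.of_conn hu hc)
      · exact hone y hy (ho y fun h => hc h.symm)
    · obtain ⟨huV, hu0⟩ := hroot (TwoMarks.exists_mem hu)
      obtain ⟨huV', hu0'⟩ := hroot (TwoMarks.exists_mem hu')
      have h1 := sum_roots_conn (k := 1) hB₀ h.not_mem huV hu0
      have h2 := sum_roots_conn (k := 1) hB₀ h.not_mem huV' hu0'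
      refine Eq.trans ?_ (congrArg (_ + ·) (congrArg₂ (· + ·) h1 h2))
      simp only [← Finset.sum_add_distrib]
      refine Finset.sum_congr rfl fun y hy => ?_
      split_ifs with hc hc' hc'
      · exact absurd (hc.symm.trans hc') huu
      · exact markCount_of_twoMarks (hu.of_conn hc.symm)
      · exact markCount_of_twoMarks (hu'.of_conn hc'.symm)
      · exact hone y hy (ho y (fun h => hc h.symm) fun h => hc' h.symm)
  -- Comparing the two counts of marks, the excess weight equals the number of components other than
  -- `{0}`. Adding |F| gives |V| - 1 by the count of roots.
  have := sum_markCount hB₀ h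
  rw [h.degree_eq]
  omega

end Degree

end TriconedGraph

end Triconed

theorem mainTheorem4 {α β : Type*} [LinearOrder α] [LinearOrder β]
    (T : Triconed.TriconedGraph α β) (B₀ : Finset β)
    (hB₀ : Triconed.IsLexSmallestTree T.graph B₀) :
    Triconed.IsPureOrderIdeal (T.imagePhi B₀) := by
  refine ⟨Triconed.TriconedGraph.isOrderIdeal_imagePhi hB₀, fun M N hM hN => ?_⟩
  obtain ⟨F, hF⟩ := (Triconed.TriconedGraph.mem_imagePhi_iff hB₀).1 hM.1
  obtain ⟨F', hF'⟩ := (Triconed.TriconedGraph.mem_imagePhi_iff hB₀).1 hN.1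
  have h1 := hF.degree_of_maximal hB₀ hM
  have h2 := hF'.degree_of_maximal hB₀ hN
  omega
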